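/- All vector spaces are over $\mathbf{Q}$. \textbf{Dendriform algebras.} A dendriform algebra is a vector space with bilinear products $\prec,\succ$ such that, with $\star=\prec+\succ$, $(a\prec b)\prec c=a\prec(b\star c)$, $(a\succ b)\prec c=a\succ(b\prec c)$ and $(a\star b)\succ c=a\succ(b\succ c)$. A dendriform algebra $D$ is free over a subspace $P$ if every linear map from $P$ to a dendriform algebra extends uniquely to a morphism of dendriform algebras on $D$. A bidendriform bialgebra is a dendriform algebra $A$ with two coproducts $\Delta_\prec,\Delta_\succ:A\to A\otimes A$ such that, with $\Delta=\Delta_\prec+\Delta_\succ$, $(\Delta_\prec\otimes Id)\Delta_\prec=(Id\otimes\Delta)\Delta_\prec$, $(\Delta_\succ\otimes Id)\Delta_\prec=(Id\otimes\Delta_\prec)\Delta_\succ$, $(\Delta\otimes Id)\Delta_\succ=(Id\otimes\Delta_\succ)\Delta_\succ$, and, writing $ab=a\star b$, $\Delta(a)=a'\otimes a''$, $\Delta_\prec(b)=b'_\prec\otimes b''_\prec$, $\Delta_\succ(b)=b'_\succ\otimes b''_\succ$, $$\Delta_\succ(a\succ b)=a'b'_\succ\otimes a''\succ b''_\succ+a'\otimes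 a''\succ b+b'_\succ\otimes a\succ b''_\succ+ab'_\succ\otimes b''_\succ+a\otimes b,$$ $$\Delta_\succ(a\prec b)=a'b'_\succ\otimes a''\prec b''_\succ+a'\otimes a''\prec b+b'_\succ\otimes a\prec b''_\succ,$$ $$\Delta_\prec(a\succ b)=a'b'_\prec\otimes a''\succ b''_\prec+ab'_\prec\otimes b''_\prec+b'_\prec\otimes a\succ b''_\prec,$$ $$\Delta_\prec(a\prec b)=a'b'_\prec\otimes a''\prec b''_\prec+a'b\otimes a''+b'_\prec\otimes a\prec b''_\prec+b\otimes a.$$ \textbf{Graded permutations.} Let $\mathbf{S}$ be the vector space with basis the pairs $(\sigma,d)$ with $k\ge 0$, $\sigma\in\mathfrak S_k$, $d:[k]\to\mathbf{N}^*$, written as biwords $\left(\begin{smallmatrix}\sigma(1)&\cdots&\sigma(k)\\ d(1)&\cdots&d(k)\end{smallmatrix}\right)$; let $1$ be the empty biword and $\mathbf{S}_+$ the span of the $(\sigma,d)$ with $k\ge1$. For $(\sigma,d)$ of length $k$, $(\sigma,d)\prec(\tau,e)$ (resp. $(\sigma,d)\succ(\tau,e)$) is the sum of the shufflings of the biword of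 $(\sigma,d)$ with the biword of $(\tau,e)$ whose first row is increased by $k$, such that the first biletter of the result comes from $(\sigma,d)$ (resp. from $(\tau,e)$); thus $x\prec1=1\succ x=x$ and $1\prec x=x\succ1=0$ for $x\in\mathbf{S}_+$, and $1\prec1=1\succ1=0$. The coproduct $\Delta_\prec(\sigma,d)$ (resp. $\Delta_\succ(\sigma,d)$) is the sum, over the cuts of the biword into two nonempty consecutive parts with the entry $1$ of the first row in the left (resp. right) part, of the tensor products of the two parts with standardized first rows. For $n\ge0$ let $p_n=\sum_k\sum_{d(1)+\cdots+d(k)=n}(id_k,d)$ (so $p_0=1$). Let $\mathbf{Descd}$ be the smallest subspace of $\mathbf{S}$ that contains all $p_n$, $n\ge0$, and is stable under $\prec$ and $\succ$, and let $\mathbf{Descd}_+=\mathbf{Descd}\cap\mathbf{S}_+$. \textbf{Action on shuffle algebras.} For a graded alphabet $X=\bigsqcup_{n\ge1}X_n$ ($|x|=n$ for $x\in X_n$), let $Sh(X)$ be the space with basis the words over $X$, with $u\prec v$ the sum of the shuffles of the words $u,v$ whose first letter is that of $u$ (so $1\prec v=0$ for the empty word $1$, including $v=1$, and $u\prec1=u$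 for $u\neq1$), $u\succ v=v\prec u$, and $\Delta$ the deconcatenation coproduct. On $End(Sh(X))$ put $f\prec g=\prec\circ(f\otimes g)\circ\Delta$ and $f\succ g=\succ\circ(f\otimes g)\circ\Delta$. Let $\Phi:\mathbf{S}\to End(Sh(X))$ be linear, where $\Phi(\sigma,d)$, $\sigma\in\mathfrak S_k$, sends $x_1\cdots x_l$ to $x_{\sigma(1)}\cdots x_{\sigma(l)}$ if $k=l$ and $|x_{\sigma(i)}|=d(i)$ for all $i$, and to $0$ otherwise. \textbf{Statement.} \begin{enumerate} \item For every $X$, $\Phi(a\prec b)=\Phi(a)\prec\Phi(b)$ and $\Phi(a\succ b)=\Phi(a)\succ\Phi(b)$ for $a,b\in\mathbf{S}$; $\Phi(p_n)$ is the projection of $Sh(X)$ onto the span of the words of weight $n$; and $\Phi(\mathbf{Descd})$ is the smallest subspace of $End(Sh(X))$ that contains these projections and is stable under $\prec$ and $\succ$. If all $X_n$ are infinite, $\Phi$ is injective. \item $\mathbf{Descd}=\mathbf{Q}\,p_0+\mathbf{Descd}_+$, and $\mathbf{Descd}_+$ is the smallest subspace that contains the $p_n$, $n\ge1$, and is stable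 under $\prec$ and $\succ$. \item For all $n\ge1$, $\Delta_\succ(p_n)=0$ and $\Delta_\prec(p_n)=\sum_{i=1}^{n-1}p_i\otimes p_{n-i}$. \item $(\mathbf{S}_+,\succ^{op},\prec^{op},\Delta_\succ^{op},\Delta_\prec^{op})$ is a bidendriform bialgebra, and $\mathbf{Descd}_+$ is a sub-bidendriform bialgebra of it: $\prec$ and $\succ$ map $\mathbf{Descd}_+\times\mathbf{Descd}_+$ to $\mathbf{Descd}_+$, and $\Delta_\prec$ and $\Delta_\succ$ map $\mathbf{Descd}_+$ to $\mathbf{Descd}_+\otimes\mathbf{Descd}_+$. \item $(\mathbf{Descd}_+,\prec,\succ)$ is a free dendriform algebra over its dendriform primitive elements $\mathbf{Descd}_+\cap Ker(\Delta_\prec)\cap Ker(\Delta_\succ)$. \end{enumerate} -/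

import Mathlib

open scoped TensorProduct

universe u v

noncomputable section

namespace GradedPerm

/-! ### Dendriform algebras, bidendriform bialgebras, freeness -/

section General

/-- A dendriform algebra over `ℚ`: two bilinear half-products with the half-shuffle relations. -/
structure DendriformAlgebra (A : Type*) [AddCommGroup A] [Module ℚ A] where
  prec : A →ₗ[ℚ] A →ₗ[ℚ] A
  succ : A →ₗ[ℚ] A →ₗ[ℚ] A
  prec_prec : ∀ a b c, prec (prec a b) c = prec a (prec b c + succ b c)
  succ_prec : ∀ a b c, prec (succ a b) c = succ a (prec b c)
  succ_succ : ∀ a b c, succ (prec a b + succ a b) c = succ a (succ b c)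

/-- The smallest linear subspace containing `s` and stable under both half-products. -/
def dendClosure {V : Type*} [AddCommGroup V] [Module ℚ V]
    (prec succ : V → V → V) (s : Set V) : Submodule ℚ V :=
  sInf {D | s ⊆ D ∧ ∀ a ∈ D, ∀ b ∈ D, prec a b ∈ D ∧ succ a b ∈ D}

variable {V : Type*} [AddCommGroup V] [Module ℚ V]

/-- The image of `D ⊗ D` in `V ⊗ V`. -/
def tensorSquare (D : Submodule ℚ V) : Submodule ℚ (V ⊗[ℚ] V) :=
  LinearMap.range (TensorProduct.map D.subtype D.subtype)

/-- The subspace `D` of `V` is stable under the operations `≺, ≻, Δ_≺, Δ_≻` of `V`, and is a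
bidendriform bialgebra for them. In Sweedler notation, with `ab = a ≺ b + a ≻ b` and
`a' ⊗ a'' = Δ_≺ a + Δ_≻ a`, the four compatibilities are
* `Δ_≻(a ≻ b) = a'b'_≻ ⊗ a''≻b''_≻ + a' ⊗ a''≻b + b'_≻ ⊗ a≻b''_≻ + ab'_≻ ⊗ b''_≻ + a ⊗ b`
* `Δ_≻(a ≺ b) = a'b'_≻ ⊗ a''≺b''_≻ + a' ⊗ a''≺b + b'_≻ ⊗ a≺b''_≻`
* `Δ_≺(a ≻ b) = a'b'_≺ ⊗ a''≻b''_≺ + ab'_≺ ⊗ b''_≺ + b'_≺ ⊗ a≻b''_≺`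
* `Δ_≺(a ≺ b) = a'b'_≺ ⊗ a''≺b''_≺ + a'b ⊗ a'' + b'_≺ ⊗ a≺b''_≺ + b ⊗ a`. -/
structure IsBidendriformOn (D : Submodule ℚ V) (prec succ : V →ₗ[ℚ] V →ₗ[ℚ] V)
    (dprec dsucc : V →ₗ[ℚ] V ⊗[ℚ] V) : Prop where
  prec_mem : ∀ a ∈ D, ∀ b ∈ D, prec a b ∈ D
  succ_mem : ∀ a ∈ D, ∀ b ∈ D, succ a b ∈ D
  dprec_mem : ∀ a ∈ D, dprec a ∈ tensorSquare D
  dsucc_mem : ∀ a ∈ D, dsucc a ∈ tensorSquare D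
  prec_prec : ∀ a ∈ D, ∀ b ∈ D, ∀ c ∈ D, prec (prec a b) c = prec a (prec b c + succ b c)
  succ_prec : ∀ a ∈ D, ∀ b ∈ D, ∀ c ∈ D, prec (succ a b) c = succ a (prec b c)
  succ_succ : ∀ a ∈ D, ∀ b ∈ D, ∀ c ∈ D, succ (prec a b + succ a b) c = succ a (succ b c)
  dprec_dprec : ∀ a ∈ D, TensorProduct.assoc ℚ V V V (dprec.rTensor V (dprec a)) =
    (dprec + dsucc).lTensor V (dprec a)
  dsucc_dprec : ∀ a ∈ D, TensorProduct.assoc ℚ V V V (dsucc.rTensor V (dprec a)) =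
    dprec.lTensor V (dsucc a)
  dsucc_dsucc : ∀ a ∈ D, TensorProduct.assoc ℚ V V V ((dprec + dsucc).rTensor V (dsucc a)) =
    dsucc.lTensor V (dsucc a)
  dsucc_succ : ∀ a ∈ D, ∀ b ∈ D, dsucc (succ a b) =
    TensorProduct.map₂ (prec + succ) succ (dprec a + dsucc a) (dsucc b) +
    (succ.flip b).lTensor V (dprec a + dsucc a) + (succ a).lTensor V (dsucc b) +
    (prec a + succ a).rTensor V (dsucc b) + a ⊗ₜ b
  dsucc_prec : ∀ a ∈ D, ∀ b ∈ D, dsucc (prec a b) =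
    TensorProduct.map₂ (prec + succ) prec (dprec a + dsucc a) (dsucc b) +
    (prec.flip b).lTensor V (dprec a + dsucc a) + (prec a).lTensor V (dsucc b)
  dprec_succ : ∀ a ∈ D, ∀ b ∈ D, dprec (succ a b) =
    TensorProduct.map₂ (prec + succ) succ (dprec a + dsucc a) (dprec b) +
    (prec a + succ a).rTensor V (dprec b) + (succ a).lTensor V (dprec b)
  dprec_prec' : ∀ a ∈ D, ∀ b ∈ D, dprec (prec a b) =
    TensorProduct.map₂ (prec + succ) prec (dprec a + dsucc a) (dprec b) +
    ((prec + succ).flip b).rTensor V (dprec a + dsucc a) + (prec a).lTensor V (dprec b) + b ⊗ₜ a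

/-- The dendriform primitive elements of `D`. -/
def primDend (D : Submodule ℚ V) (dprec dsucc : V →ₗ[ℚ] V ⊗[ℚ] V) : Submodule ℚ V :=
  D ⊓ (LinearMap.ker dprec ⊓ LinearMap.ker dsucc)

/-- The subspace `D` of `V` is stable under the half-products of `V`, satisfies the dendriform
relations, and is, as a dendriform algebra, free over its subspace `P`: every linear map from `P`
to a dendriform algebra extends to exactly one morphism of dendriform algebras on `D`. -/
structure IsFreeDendriformOn.{u₁, w} {V : Type w} [AddCommGroup V] [Module ℚ V]
    (D P : Submodule ℚ V) (prec succ : V →ₗ[ℚ] V →ₗ[ℚ] V) : Prop where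
  prec_mem : ∀ a ∈ D, ∀ b ∈ D, prec a b ∈ D
  succ_mem : ∀ a ∈ D, ∀ b ∈ D, succ a b ∈ D
  prec_prec : ∀ a ∈ D, ∀ b ∈ D, ∀ c ∈ D, prec (prec a b) c = prec a (prec b c + succ b c)
  succ_prec : ∀ a ∈ D, ∀ b ∈ D, ∀ c ∈ D, prec (succ a b) c = succ a (prec b c)
  succ_succ : ∀ a ∈ D, ∀ b ∈ D, ∀ c ∈ D, succ (prec a b + succ a b) c = succ a (succ b c)
  le : P ≤ D
  existsUnique_lift : ∀ (A : Type u₁) [AddCommGroup A] [Module ℚ A] (dA : DendriformAlgebra A)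
    (f : P →ₗ[ℚ] A), ∃! F : D →ₗ[ℚ] A,
      (∀ a b c : D, (c : V) = prec a b → F c = dA.prec (F a) (F b)) ∧
      (∀ a b c : D, (c : V) = succ a b → F c = dA.succ (F a) (F b)) ∧
      ∀ x : P, F ⟨x, le x.2⟩ = f x

end General

/-! ### Words and shuffles -/

/-- The list (with multiplicities) of all shuffles of two words. -/
def shuffles {α : Type*} : List α → List α → List (List α)
  | [], v => [v]
  | a :: u, [] => [a :: u]
  | a :: u, b :: v =>
    (shuffles u (b :: v)).map (a :: ·) ++ (shuffles (a :: u) v).map (b :: ·)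
termination_by u v => u.length + v.length

/-- The shuffles of two words whose first letter is the first letter of the first word;
in particular there are none if the first word is empty. -/
def halfShuffles {α : Type*} : List α → List α → List (List α)
  | [], _ => []
  | a :: u, v => (shuffles u v).map (a :: ·)

/-- The vector space with basis the words over `α`. -/
abbrev Words (α : Type*) := List α →₀ ℚ

/-- The word `w` as a basis vector. -/
def word {α : Type*} (w : List α) : Words α := Finsupp.single w 1

/-- The sum of a list of words. -/
def sumWords {α : Type*} (l : List (List α)) : Words α := (l.map word).sum

/-- Linear extension of a map given on words. -/
def linExt {α M : Type*} [AddCommGroup M] [Module ℚ M] (f : List α → M) : Words α →ₗ[ℚ] M :=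
  Finsupp.linearCombination ℚ f

/-- Bilinear extension of a map given on pairs of words. -/
def bilinExt {α M : Type*} [AddCommGroup M] [Module ℚ M] (f : List α → List α → M) :
    Words α →ₗ[ℚ] Words α →ₗ[ℚ] M :=
  linExt fun u => linExt (f u)

/-! ### The shuffle bialgebra `Sh(X)` of a graded alphabet and its endomorphisms -/

section Shuffle

variable {X : Type*}

/-- The half-shuffle `≺` of `Sh(X)`; on the empty word `1`: `w ≺ 1 = w` for `w ≠ 1`,
`1 ≺ w = 0` and `1 ≺ 1 = 0`. -/
def shPrec : Words X →ₗ[ℚ] Words X →ₗ[ℚ] Words X :=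
  bilinExt fun u v => sumWords (halfShuffles u v)

/-- The half-shuffle `≻` of `Sh(X)`: `u ≻ v = v ≺ u`. -/
def shSucc : Words X →ₗ[ℚ] Words X →ₗ[ℚ] Words X := shPrec.flip

/-- The deconcatenation coproduct of `Sh(X)`. -/
def deconc : Words X →ₗ[ℚ] Words X ⊗[ℚ] Words X :=
  linExt fun w => ∑ i ∈ Finset.range (w.length + 1), word (w.take i) ⊗ₜ word (w.drop i)

/-- The half-convolution `f ≺ g = ≺ ∘ (f ⊗ g) ∘ Δ` on `End(Sh(X))`. -/
def convPrec (f g : Module.End ℚ (Words X)) : Module.End ℚ (Words X) :=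
  TensorProduct.lift shPrec ∘ₗ TensorProduct.map f g ∘ₗ deconc

/-- The half-convolution `f ≻ g = ≻ ∘ (f ⊗ g) ∘ Δ` on `End(Sh(X))`. -/
def convSucc (f g : Module.End ℚ (Words X)) : Module.End ℚ (Words X) :=
  TensorProduct.lift shSucc ∘ₗ TensorProduct.map f g ∘ₗ deconc

/-- The projection of `Sh(X)` onto the span of the words of weight `n`. -/
def weightProj (wt : X → ℕ+) (n : ℕ) : Module.End ℚ (Words X) :=
  linExt fun x => if (x.map fun y => (wt y : ℕ)).sum = n then word x else 0

end Shuffle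

/-! ### Graded permutations -/

/-- A biletter: the entry in the first row and the entry in the second row. -/
abbrev Biletter := ℕ × ℕ

/-- The biword with rows `σ(1) … σ(k)` and `d(1) … d(k)`. -/
def biword {k : ℕ} (σ : Equiv.Perm (Fin k)) (d : Fin k → ℕ+) : List Biletter :=
  List.ofFn fun i => ((σ i : ℕ) + 1, (d i : ℕ))

/-- The space `S` with basis the graded permutations `(σ, d)`, `σ ∈ 𝔖_k`, `d : [k] → ℕ*`, `k ≥ 0`,
written as biwords. The operations below are given on arbitrary words in biletters, but only
matter on `S`. -/
def gradedPerms : Submodule ℚ (Words Biletter) :=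
  Submodule.span ℚ
    {x | ∃ (k : ℕ) (σ : Equiv.Perm (Fin k)) (d : Fin k → ℕ+), x = word (biword σ d)}

/-- The augmentation ideal `S_+`, spanned by the `(σ, d)` with `k ≥ 1`. -/
def gradedPermsPlus : Submodule ℚ (Words Biletter) :=
  Submodule.span ℚ
    {x | ∃ (k : ℕ) (σ : Equiv.Perm (Fin k)) (d : Fin k → ℕ+), 1 ≤ k ∧ x = word (biword σ d)}

/-- The action `Φ` of graded permutations on `Sh(X)`: `(σ, d)` with `σ ∈ 𝔖_k` sends
`x_1 … x_l` to `x_{σ(1)} … x_{σ(l)}` if `k = l` and `x_{σ(i)}` has weight `d(i)` for all `i`,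
and to `0` otherwise. -/
def toEnd {X : Type*} (wt : X → ℕ+) : Words Biletter →ₗ[ℚ] Module.End ℚ (Words X) :=
  linExt fun w => linExt fun x =>
    if w.length = x.length ∧ ∀ b ∈ w, (x[b.1 - 1]?).map (fun y => (wt y : ℕ)) = some b.2
    then word (w.filterMap fun b => x[b.1 - 1]?) else 0

/-- Add `k` to the first row. -/
def shift (k : ℕ) (w : List Biletter) : List Biletter := w.map fun b => (b.1 + k, b.2)

/-- `(σ, d) ≺ (τ, e)`: the sum of the shuffles of `(σ, d)` and of `(τ, e)` shifted that
start with the first biletter of `(σ, d)`. -/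
def prec : Words Biletter →ₗ[ℚ] Words Biletter →ₗ[ℚ] Words Biletter :=
  bilinExt fun u v => sumWords (halfShuffles u (shift u.length v))

/-- `(σ, d) ≻ (τ, e)`: the sum of the shuffles of `(σ, d)` and of `(τ, e)` shifted that
start with the first biletter of `(τ, e)` shifted. -/
def succ : Words Biletter →ₗ[ℚ] Words Biletter →ₗ[ℚ] Words Biletter :=
  bilinExt fun u v => sumWords (halfShuffles (shift u.length v) u)

/-- Standardization of the first row: each entry is replaced by its rank. -/
def std (w : List Biletter) : List Biletter := w.map fun b => (w.countP (·.1 ≤ b.1), b.2)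

/-- `Δ_≺`: cut into two nonempty parts with the entry `1` in the left part; standardize. -/
def dprec : Words Biletter →ₗ[ℚ] Words Biletter ⊗[ℚ] Words Biletter :=
  linExt fun w => ∑ i ∈ Finset.Ico 1 w.length,
    if 1 ∈ (w.take i).map Prod.fst then word (std (w.take i)) ⊗ₜ word (std (w.drop i)) else 0

/-- `Δ_≻`: cut into two nonempty parts with the entry `1` in the right part; standardize. -/
def dsucc : Words Biletter →ₗ[ℚ] Words Biletter ⊗[ℚ] Words Biletter :=
  linExt fun w => ∑ i ∈ Finset.Ico 1 w.length,
    if 1 ∈ (w.drop i).map Prod.fst then word (std (w.take i)) ⊗ₜ word (std (w.drop i)) else 0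

/-- The opposite structure `(≻ᵒᵖ, ≺ᵒᵖ, Δ_≻ᵒᵖ, Δ_≺ᵒᵖ)` on a subspace `D` of `S_+` is a
bidendriform bialgebra. -/
def IsBidendriformOp (D : Submodule ℚ (Words Biletter)) : Prop :=
  IsBidendriformOn D succ.flip prec.flip
    ((TensorProduct.comm ℚ (Words Biletter) (Words Biletter)).toLinearMap ∘ₗ dsucc)
    ((TensorProduct.comm ℚ (Words Biletter) (Words Biletter)).toLinearMap ∘ₗ dprec)

/-- `p_n`: the sum of the graded permutations `(id_k, d)` with `d(1) + … + d(k) = n`; for `n = 0`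
this is the unit, the empty biword. -/
def p (n : ℕ) : Words Biletter :=
  ∑ c : Composition n, word (List.ofFn fun i : Fin c.length => ((i : ℕ) + 1, c.blocksFun i))

/-- The dendriform descent algebra: the dendriform subalgebra generated by the `p_n`, `n ≥ 0`. -/
def descd : Submodule ℚ (Words Biletter) :=
  dendClosure (fun a b => prec a b) (fun a b => succ a b) (Set.range p)

/-- The augmentation ideal of the dendriform descent algebra. -/
def descdPlus : Submodule ℚ (Words Biletter) := descd ⊓ gradedPermsPlus

end GradedPerm

end

/-!
The space `S` of graded permutations sits inside the space of words on biletters, where the shuffle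
algebra gives everything that does not depend on the first row being a permutation.

*Products.* The product `gmul` (all shufflings, with unit the empty word) and the half-products
satisfy the dendriform relations on all words, in the form `(a ≺ b) ≺ c = a ≺ (bc)`,
`(a ≻ b) ≺ c = a ≻ (b ≺ c)`, `(ab) ≻ c = a ≻ (b ≻ c)` that includes the unit (`prec_prec`,
`succ_prec`, `succ_succ`). These come from the associativity of the shuffle product (`sh_assoc`,
`shPrec_shPrec`).

*Coproducts.* The reduced half-coproducts are replaced by unital ones, `halfCop`, which run over all
cuts of a biword, according to whether the right part holds the entry `1` or not. Deconcatenation of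
shuffles (`deconc_shPrec`) followed by standardization gives the short formulas
`Δ (a ≺ b) = Δ a (≺ ⊗ ·) (all cuts of b)`, up to a term `1 ⊗ (a ≺ b)` (`halfCop_prec`, and
`halfCop_succ` for `≻`). Removing the terms that involve the unit leaves the four compatibilities of
a bidendriform bialgebra. Coassociativity holds because both sides enumerate the cuts into three
parts with the least entry in a prescribed part (`cutSum_coassoc`).

*Action on shuffle algebras.* In a convolution product of the actions of biwords of lengths `k` and
`l`, only the cut of the argument after `k` letters contributes (`lift_map_toEnd`), so the action
respects the half-products. It is injective when there are enough letters, since a biword is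
recovered from its action on a word without repeated letters (`exists_isMatch`, `toEnd_injOn`).

*The dendriform descent algebra.* `Descd` is `ℚ p_0` plus the closure of the `p_n`, `n ≥ 1`, because
products with the unit are trivial (`descd_le_sup`). The coproducts of `p_n` come from cutting
compositions (`dprec_p`, `dsucc_p`), and the compatibilities propagate the stability under the
coproducts from the generators to the closure (`coprod_mem_descdPlus`).

*Freeness.* This part holds for every subspace `D` of `S_+` that is stable under the half-products
and the half-coproducts (`IsStable`). It proves directly the rigidity of bidendriform bialgebras.

The primitive elements generate: the recursion `e x = x - m (e x' ⊗ x'')` defines projections onto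
`ker Δ_≺` (`projPrec`, with `m (a ⊗ b) = a ≺ b`) and onto `ker (Δ_≺ + Δ_≻)` (`projFull`, with
`m (a ⊗ b) = b ≻ a`). With the latter, an element of `ker Δ_≺` is corrected to a primitive element
(`projPrim`). That these maps take values in the kernels is one computation (`coprod_lift_eq`), based
on coassociativity. As the corrections are products of shorter elements, an induction on the length
rebuilds every element of `D` from primitive ones (`reconstruct_eq`, `IsStable.le_of_primDend_le`).

There are no relations: a dendriform algebra generated by elements `g i` is spanned by the values of
binary trees, where a node `i` with subtrees `l`, `r` has the value `(l ≻ g i) ≺ r`. For primitive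
`g i` the half-coproducts lift to trees (`treeCop`, `treeEvalL_treeCop`): apart from the
trivial cuts `t ⊗ 1`, the left factors are combinations of trees with fewer nodes. If the `g i` are linearly independent, an induction on
the number of nodes reads off the coefficients of a linear relation from these left factors: the cuts
with the entry `1` on the right exclude the trees with a nonempty left subtree
(`apply_node_eq_zero_of_left`), those with `1` on the left exclude then the trees with a nonempty
right subtree (`apply_node_eq_zero_of_right`), and single nodes remain.

A linear map `f` from the primitive elements to a dendriform algebra `A` is extended without
defining a product on trees: the span of the trees in the pairs `(g i, f (g i))`, inside the product
of the words and of `A` with a unit adjoined, is closed under the half-products, and it is the graph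
of a map by the linear independence of the trees in the first component (`graph`,
`IsStable.exists_lift`).
-/

noncomputable section

namespace GradedPerm

/-! ### Linear maps on spaces of words -/

section Words

variable {α β M N : Type*} [AddCommGroup M] [Module ℚ M] [AddCommGroup N] [Module ℚ N]

@[simp] lemma linExt_word (f : List α → M) (w : List α) : linExt f (word w) = f w := by
  simp [linExt, word]

@[simp] lemma bilinExt_word (f : List α → List α → M) (u v : List α) :
    bilinExt f (word u) (word v) = f u v := by
  simp [bilinExt]

lemma hom_ext_word {f g : Words α →ₗ[ℚ] M} (h : ∀ w, f (word w) = g (word w)) : f = g := by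
  refine Finsupp.lhom_ext' fun w => LinearMap.ext_ring ?_
  simpa [word] using h w

lemma hom_ext_word₂ {f g : Words α →ₗ[ℚ] Words β →ₗ[ℚ] M}
    (h : ∀ u v, f (word u) (word v) = g (word u) (word v)) : f = g :=
  hom_ext_word fun u => hom_ext_word fun v => h u v

lemma words_induction {P : Words α → Prop} (x : Words α) (h : ∀ w, P (word w)) (h0 : P 0)
    (hadd : ∀ x y, P x → P y → P (x + y)) (hsmul : ∀ (c : ℚ) x, P x → P (c • x)) : P x := by
  induction x using Finsupp.induction_linear with
  | zero => exact h0
  | add x y hx hy => exact hadd x y hx hy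
  | single w c =>
    have := hsmul c _ (h w)
    simpa [word] using this

@[simp] lemma sumWords_nil : sumWords ([] : List (List α)) = 0 := rfl

@[simp] lemma sumWords_cons (w : List α) (l : List (List α)) :
    sumWords (w :: l) = word w + sumWords l := by simp [sumWords]

@[simp] lemma sumWords_append (l m : List (List α)) :
    sumWords (l ++ m) = sumWords l + sumWords m := by simp [sumWords]

/-- Adding a letter in front of a word. -/
def consL (a : α) : Words α →ₗ[ℚ] Words α := linExt fun w => word (a :: w)

@[simp] lemma consL_word (a : α) (w : List α) : consL a (word w) = word (a :: w) := by
  simp [consL]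

lemma sumWords_map_cons (a : α) (l : List (List α)) :
    sumWords (l.map (a :: ·)) = consL a (sumWords l) := by
  induction l with
  | nil => simp
  | cons w l ih => simp [ih]

/-- The linear map on words given by a map on letters. -/
def mapL (f : α → β) : Words α →ₗ[ℚ] Words β := linExt fun w => word (w.map f)

@[simp] lemma mapL_word (f : α → β) (w : List α) : mapL f (word w) = word (w.map f) := by
  simp [mapL]

lemma mapL_consL (f : α → β) (a : α) (x : Words α) :
    mapL f (consL a x) = consL (f a) (mapL f x) := by
  have : mapL f ∘ₗ consL a = consL (f a) ∘ₗ mapL f := hom_ext_word fun w => by simp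
  exact LinearMap.congr_fun this x

/-- The coefficient of the empty word. -/
def eps : Words α →ₗ[ℚ] ℚ := Finsupp.lapply []

@[simp] lemma eps_nil : eps (word ([] : List α)) = 1 := by simp [eps, word]

@[simp] lemma eps_cons (a : α) (w : List α) : eps (word (a :: w)) = 0 := by
  simp [eps, word]

@[simp] lemma eps_consL (a : α) (x : Words α) : eps (consL a x) = 0 := by
  have : eps ∘ₗ consL a = 0 := hom_ext_word fun w => by simp
  exact LinearMap.congr_fun this x

end Words

/-! ### The shuffle algebra -/

section Shuffle

variable {α β : Type*}

@[simp] lemma shuffles_nil_left (v : List α) : shuffles [] v = [v] := by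
  simp [shuffles]

@[simp] lemma shuffles_nil_right (u : List α) : shuffles u [] = [u] := by
  cases u <;> simp [shuffles]

lemma shuffles_cons_cons (a b : α) (u v : List α) : shuffles (a :: u) (b :: v) =
    (shuffles u (b :: v)).map (a :: ·) ++ (shuffles (a :: u) v).map (b :: ·) := by
  rw [shuffles]

lemma perm_of_mem_shuffles {u v w : List α} (h : w ∈ shuffles u v) : w.Perm (u ++ v) := by
  induction u, v using shuffles.induct generalizing w with
  | case1 v => simp_all
  | case2 a u => simp_all
  | case3 a u b v ih1 ih2 =>
    rw [shuffles_cons_cons, List.mem_append, List.mem_map, List.mem_map] at h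
    rcases h with ⟨x, hx, rfl⟩ | ⟨x, hx, rfl⟩
    · simpa using ih1 hx
    · exact ((ih2 hx).cons b).trans (List.perm_middle (l₁ := a :: u)).symm

lemma perm_of_mem_halfShuffles {u v w : List α} (h : w ∈ halfShuffles u v) :
    w.Perm (u ++ v) := by
  cases u with
  | nil => simp [halfShuffles] at h
  | cons a u =>
    simp only [halfShuffles, List.mem_map] at h
    obtain ⟨x, hx, rfl⟩ := h
    simpa using perm_of_mem_shuffles hx

/-- The shuffle product. -/
def sh : Words α →ₗ[ℚ] Words α →ₗ[ℚ] Words α := bilinExt fun u v => sumWords (shuffles u v)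

lemma sh_word (u v : List α) : sh (word u) (word v) = sumWords (shuffles u v) := by simp [sh]

lemma shPrec_word (u v : List α) :
    shPrec (word u) (word v) = sumWords (halfShuffles u v) := by simp [shPrec]

@[simp] lemma sh_nil_left (x : Words α) : sh (word []) x = x := by
  have : sh (word ([] : List α)) = LinearMap.id := hom_ext_word fun w => by simp [sh_word]
  exact LinearMap.congr_fun this x

@[simp] lemma sh_nil_right (x : Words α) : sh x (word []) = x := by
  have : sh.flip (word ([] : List α)) = LinearMap.id := hom_ext_word fun w => by simp [sh_word]
  exact LinearMap.congr_fun this x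

@[simp] lemma shPrec_nil_left (x : Words α) : shPrec (word []) x = 0 := by
  have : shPrec (word []) = (0 : Words α →ₗ[ℚ] Words α) :=
    hom_ext_word fun w => by simp [shPrec_word, halfShuffles]
  exact LinearMap.congr_fun this x

lemma shPrec_consL (a : α) (x y : Words α) : shPrec (consL a x) y = consL a (sh x y) := by
  have : shPrec ∘ₗ consL a = sh.compr₂ (consL a) :=
    hom_ext_word₂ fun u v => by simp [shPrec_word, sh_word, halfShuffles, sumWords_map_cons]
  exact LinearMap.congr_fun₂ this x y

lemma shPrec_cons (a : α) (u : List α) (y : Words α) :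
    shPrec (word (a :: u)) y = consL a (sh (word u) y) := by
  rw [← consL_word, shPrec_consL]

lemma sh_cons_cons (a b : α) (u v : List α) :
    sh (word (a :: u)) (word (b :: v)) =
      consL a (sh (word u) (word (b :: v))) + consL b (sh (word (a :: u)) (word v)) := by
  simp [sh_word, shuffles_cons_cons, sumWords_map_cons]

lemma sh_comm (x y : Words α) : sh x y = sh y x := by
  have : (sh : Words α →ₗ[ℚ] _) = sh.flip := by
    refine hom_ext_word₂ fun u v => ?_
    rw [LinearMap.flip_apply]
    induction u, v using shuffles.induct with
    | case1 v => simp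
    | case2 a u => simp
    | case3 a u b v ih1 ih2 => rw [sh_cons_cons, sh_cons_cons, ih1, ih2, add_comm]
  exact LinearMap.congr_fun₂ this x y

lemma shPrec_nil_right (x : Words α) : shPrec x (word []) = x - eps x • word [] := by
  have : shPrec.flip (word []) = LinearMap.id - (eps.smulRight (word ([] : List α))) :=
    hom_ext_word fun w => by
      cases w with
      | nil => simp
      | cons a w => simp [shPrec_cons]
  exact LinearMap.congr_fun this x

/-- The shuffle product is the sum of the half-shuffles, except that it has a unit. -/
lemma sh_eq (x y : Words α) :
    sh x y = shPrec x y + shSucc x y + (eps x * eps y) • word [] := by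
  have : (sh : Words α →ₗ[ℚ] _) =
      shPrec + shSucc + (eps.smulRight (eps.smulRight (word ([] : List α)))) := by
    refine hom_ext_word₂ fun u v => ?_
    cases u with
    | nil => simp [shSucc, shPrec_nil_right]
    | cons a u =>
      cases v with
      | nil => simp [shSucc, shPrec_nil_right]
      | cons b v =>
        simp only [LinearMap.add_apply, shSucc, LinearMap.flip_apply, LinearMap.smulRight_apply,
          eps_cons, zero_smul, add_zero]
        rw [sh_cons_cons, shPrec_cons, shPrec_cons, sh_comm (word v)]
  simpa [smul_smul] using LinearMap.congr_fun₂ this x y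

lemma eps_shPrec (x y : Words α) : eps (shPrec x y) = 0 := by
  have : (shPrec.compr₂ eps : Words α →ₗ[ℚ] Words α →ₗ[ℚ] ℚ) = 0 := by
    refine hom_ext_word₂ fun u v => ?_
    cases u with
    | nil => simp
    | cons a u => simp [shPrec_cons]
  exact LinearMap.congr_fun₂ this x y

lemma eps_sh (x y : Words α) : eps (sh x y) = eps x * eps y := by
  rw [sh_eq]; simp [shSucc, eps_shPrec]

/-- The shuffle product is associative, by induction on the total length. -/
lemma sh_assoc (x y z : Words α) : sh (sh x y) z = sh x (sh y z) := by
  -- for words, both sides are the sum of the shuffles starting with a letter of each factor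
  have key : ∀ n (u v w : List α), u.length + v.length + w.length ≤ n →
      sh (sh (word u) (word v)) (word w) = sh (word u) (sh (word v) (word w)) := by
    intro n
    induction n with
    | zero =>
      intro u v w h
      obtain rfl : u = [] := List.length_eq_zero_iff.1 (by omega)
      simp
    | succ n ih =>
      intro u v w h
      rcases u with _ | ⟨a, u⟩
      · simp
      rcases v with _ | ⟨b, v⟩
      · simp
      rcases w with _ | ⟨c, w⟩
      · simp
      have e1 := ih u (b :: v) (c :: w) (by simp at h ⊢; omega)
      have e2 := ih (a :: u) v (c :: w) (by simp at h ⊢; omega)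
      have e3 := ih (a :: u) (b :: v) w (by simp at h ⊢; omega)
      have h1 : shPrec (shPrec (word (a :: u)) (word (b :: v))) (word (c :: w)) =
          shPrec (word (a :: u)) (sh (word (b :: v)) (word (c :: w))) := by
        rw [shPrec_cons, shPrec_consL, e1, shPrec_cons]
      have h2 : shPrec (shPrec (word (b :: v)) (word (a :: u))) (word (c :: w)) =
          shPrec (shPrec (word (b :: v)) (word (c :: w))) (word (a :: u)) := by
        rw [shPrec_cons, shPrec_consL, sh_comm (word v), e2, shPrec_cons, shPrec_consL,
          sh_comm (word (a :: u))]
      have h3 : shPrec (word (c :: w)) (sh (word (a :: u)) (word (b :: v))) =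
          shPrec (shPrec (word (c :: w)) (word (b :: v))) (word (a :: u)) := by
        rw [shPrec_cons, sh_comm, e3, shPrec_cons, shPrec_consL, sh_comm (word (a :: u)),
          sh_comm (word (b :: v))]
      rw [sh_eq (sh _ _) (word (c :: w)), sh_eq (word (a :: u)) (sh _ _)]
      simp only [eps_sh, eps_cons, mul_zero, zero_smul, add_zero]
      rw [sh_eq (word (a :: u)) (word (b :: v)), sh_eq (word (b :: v)) (word (c :: w))]
      simp only [eps_cons, mul_zero, zero_smul, add_zero, shSucc, LinearMap.flip_apply,
        map_add] at h1 h2 h3 ⊢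
      rw [sh_eq (word (a :: u)), sh_eq (word (b :: v))] at *
      simp only [eps_cons, mul_zero, zero_smul, add_zero, shSucc, LinearMap.flip_apply, map_add,
        LinearMap.add_apply] at h1 h2 h3 ⊢
      rw [h1, h2, h3]
      abel
  induction x using words_induction with
  | h u =>
    induction y using words_induction with
    | h v =>
      induction z using words_induction with
      | h w => exact key _ u v w le_rfl
      | h0 => simp
      | hadd x x' hx hx' => simp only [map_add, hx, hx']
      | hsmul c x hx => simp only [map_smul, hx]
    | h0 => simp
    | hadd x x' hx hx' => simp only [map_add, LinearMap.add_apply, hx, hx']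
    | hsmul c x hx => simp only [map_smul, LinearMap.smul_apply, hx]
  | h0 => simp
  | hadd x x' hx hx' => simp only [map_add, LinearMap.add_apply, hx, hx']
  | hsmul c x hx => simp only [map_smul, LinearMap.smul_apply, hx]

/-- The first half-shuffle relation, in the form that holds also for the empty word. -/
lemma shPrec_shPrec (x y z : Words α) : shPrec (shPrec x y) z = shPrec x (sh y z) := by
  induction x using words_induction with
  | h w =>
    cases w with
    | nil => simp
    | cons a w => rw [shPrec_cons, shPrec_consL, shPrec_cons, sh_assoc]
  | h0 => simp
  | hadd x x' hx hx' => simp [hx, hx']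
  | hsmul c x hx => simp [hx]

lemma mapL_sh (f : α → β) (x y : Words α) : mapL f (sh x y) = sh (mapL f x) (mapL f y) := by
  have : (sh.compr₂ (mapL f) : Words α →ₗ[ℚ] Words α →ₗ[ℚ] Words β) =
      sh.compl₁₂ (mapL f) (mapL f) := by
    refine hom_ext_word₂ fun u v => ?_
    simp only [LinearMap.compr₂_apply, LinearMap.compl₁₂_apply, mapL_word]
    induction u, v using shuffles.induct with
    | case1 v => simp
    | case2 a u => simp
    | case3 a u b v ih1 ih2 =>
      simp only [List.map_cons] at ih1 ih2 ⊢
      rw [sh_cons_cons, sh_cons_cons, map_add, mapL_consL, mapL_consL, ih1, ih2]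
  exact LinearMap.congr_fun₂ this x y

lemma mapL_shPrec (f : α → β) (x y : Words α) :
    mapL f (shPrec x y) = shPrec (mapL f x) (mapL f y) := by
  induction x using words_induction with
  | h w =>
    cases w with
    | nil => simp
    | cons a w =>
      rw [shPrec_cons, mapL_consL, mapL_sh, mapL_word, mapL_word, List.map_cons, shPrec_cons]
  | h0 => simp
  | hadd x x' hx hx' => simp [hx, hx']
  | hsmul c x hx => simp [hx]

/-! ### Deconcatenation of shuffles -/

lemma deconc_word (w : List α) : deconc (word w) =
    ∑ i ∈ Finset.range (w.length + 1), word (w.take i) ⊗ₜ[ℚ] word (w.drop i) := by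
  simp [deconc]

@[simp] lemma deconc_nil : deconc (word ([] : List α)) = word [] ⊗ₜ word [] := by
  simp [deconc_word]

lemma deconc_consL (a : α) (x : Words α) :
    deconc (consL a x) = word [] ⊗ₜ consL a x + (consL a).rTensor _ (deconc x) := by
  have : deconc ∘ₗ consL a =
      TensorProduct.mk ℚ _ _ (word []) ∘ₗ consL a + (consL a).rTensor _ ∘ₗ deconc := by
    refine hom_ext_word fun w => ?_
    simp only [LinearMap.comp_apply, LinearMap.add_apply, consL_word, deconc_word,
      List.length_cons, TensorProduct.mk_apply]
    rw [Finset.sum_range_succ', add_comm]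
    simp
  exact LinearMap.congr_fun this x

/-- Bilinear maps on tensor products that agree on pure tensors are equal. -/
lemma tmul_hom_ext₂ {A B C D E : Type*} [AddCommGroup A] [AddCommGroup B] [AddCommGroup C]
    [AddCommGroup D] [AddCommGroup E] [Module ℚ A] [Module ℚ B] [Module ℚ C] [Module ℚ D]
    [Module ℚ E] {f g : A ⊗[ℚ] B →ₗ[ℚ] C ⊗[ℚ] D →ₗ[ℚ] E}
    (h : ∀ a b c d, f (a ⊗ₜ b) (c ⊗ₜ d) = g (a ⊗ₜ b) (c ⊗ₜ d)) : f = g :=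
  TensorProduct.ext' fun a b => TensorProduct.ext' fun c d => h a b c d

lemma map₂_flip_flip {A B C A' B' C' : Type*} [AddCommGroup A] [AddCommGroup B] [AddCommGroup C]
    [AddCommGroup A'] [AddCommGroup B'] [AddCommGroup C'] [Module ℚ A] [Module ℚ B] [Module ℚ C]
    [Module ℚ A'] [Module ℚ B'] [Module ℚ C'] (f : A →ₗ[ℚ] B →ₗ[ℚ] C) (g : A' →ₗ[ℚ] B' →ₗ[ℚ] C') :
    TensorProduct.map₂ f.flip g.flip = (TensorProduct.map₂ f g).flip := by
  ext a b c d
  simp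

lemma map₂_add_left {A B C A' B' C' : Type*} [AddCommGroup A] [AddCommGroup B] [AddCommGroup C]
    [AddCommGroup A'] [AddCommGroup B'] [AddCommGroup C'] [Module ℚ A] [Module ℚ B] [Module ℚ C]
    [Module ℚ A'] [Module ℚ B'] [Module ℚ C'] (f f' : A →ₗ[ℚ] B →ₗ[ℚ] C)
    (g : A' →ₗ[ℚ] B' →ₗ[ℚ] C') :
    TensorProduct.map₂ (f + f') g = TensorProduct.map₂ f g + TensorProduct.map₂ f' g := by
  ext a b c d
  simp [TensorProduct.add_tmul]

lemma eps_deconc (x : Words α) : TensorProduct.lid ℚ _ (eps.rTensor _ (deconc x)) = x := by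
  have : (TensorProduct.lid ℚ (Words α)).toLinearMap ∘ₗ eps.rTensor _ ∘ₗ deconc =
      LinearMap.id := by
    refine hom_ext_word fun w => ?_
    cases w with
    | nil => simp
    | cons a w =>
      simp only [LinearMap.comp_apply]
      rw [← consL_word, deconc_consL]
      have h2 : eps ∘ₗ consL a = 0 := LinearMap.ext fun x => by simp
      rw [map_add, ← LinearMap.comp_apply, ← LinearMap.rTensor_comp, h2]
      simp
  exact LinearMap.congr_fun this x

lemma map₂_eps (X Y : Words α ⊗[ℚ] Words α) :
    TensorProduct.map₂ (eps.smulRight (eps.smulRight (word ([] : List α)))) sh X Y =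
      word [] ⊗ₜ sh (TensorProduct.lid ℚ _ (eps.rTensor _ X))
        (TensorProduct.lid ℚ _ (eps.rTensor _ Y)) := by
  induction X using TensorProduct.induction_on with
  | zero => simp
  | add X X' h h' => simp only [map_add, LinearMap.add_apply, h, h', TensorProduct.tmul_add]
  | tmul a b =>
    induction Y using TensorProduct.induction_on with
    | zero => simp
    | add X X' h h' => simp only [map_add, h, h', TensorProduct.tmul_add]
    | tmul c d =>
      simp [TensorProduct.map₂_apply_tmul, TensorProduct.smul_tmul', smul_smul, mul_comm]

lemma sh_eq_add : (sh : Words α →ₗ[ℚ] _) =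
    shPrec + shSucc + eps.smulRight (eps.smulRight (word [])) := by
  refine LinearMap.ext₂ fun x y => ?_
  rw [sh_eq]
  simp [smul_smul]

lemma sh_flip : (sh : Words α →ₗ[ℚ] _).flip = sh := LinearMap.ext₂ fun x y => sh_comm y x

lemma deconc_shPrec_aux (a : α) (u : List α) (y : Words α)
    (h : deconc (sh (word u) y) = TensorProduct.map₂ sh sh (deconc (word u)) (deconc y)) :
    deconc (shPrec (word (a :: u)) y) = word [] ⊗ₜ shPrec (word (a :: u)) y +
      TensorProduct.map₂ shPrec sh (deconc (word (a :: u))) (deconc y) := by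
  rw [shPrec_cons, deconc_consL, h, ← consL_word, deconc_consL, map_add, LinearMap.add_apply]
  have h1 : ∀ z, TensorProduct.map₂ shPrec sh (word [] ⊗ₜ[ℚ] z) (deconc y) = 0 := by
    intro z
    rw [TensorProduct.map₂_apply_tmul]
    have : shPrec (word ([] : List α)) = 0 := LinearMap.ext fun x => by simp
    rw [this]; simp
  have h2 : ∀ X Y : Words α ⊗[ℚ] Words α, (consL a).rTensor _ (TensorProduct.map₂ sh sh X Y) =
      TensorProduct.map₂ shPrec sh ((consL a).rTensor _ X) Y := by
    intro X Y
    have : (TensorProduct.map₂ sh sh).compr₂ ((consL a).rTensor _) =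
        TensorProduct.map₂ shPrec sh ∘ₗ (consL a).rTensor (Words α) := by
      refine tmul_hom_ext₂ fun a b c d => ?_
      simp [shPrec_consL]
    exact LinearMap.congr_fun₂ this X Y
  rw [h1, zero_add, h2]

/-- Deconcatenation is multiplicative for the shuffle product: a cut of a shuffle of `u` and `v`
is a pair of shuffles of the parts of a cut of `u` and a cut of `v`. -/
lemma deconc_sh (x y : Words α) :
    deconc (sh x y) = TensorProduct.map₂ sh sh (deconc x) (deconc y) := by
  have : (sh.compr₂ deconc : Words α →ₗ[ℚ] Words α →ₗ[ℚ] _) =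
      (TensorProduct.map₂ sh sh).compl₁₂ deconc deconc := by
    refine hom_ext_word₂ fun u v => ?_
    simp only [LinearMap.compr₂_apply, LinearMap.compl₁₂_apply]
    have hid : sh (word ([] : List α)) = LinearMap.id := LinearMap.ext (by simp)
    have hone : ∀ X : Words α ⊗[ℚ] Words α,
        TensorProduct.map₂ sh sh (word [] ⊗ₜ[ℚ] word []) X = X := by
      intro X
      rw [TensorProduct.map₂_apply_tmul, hid, TensorProduct.map_id, LinearMap.id_apply]
    induction u, v using shuffles.induct with
    | case1 v => rw [sh_nil_left, deconc_nil, hone]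
    | case2 a u =>
      rw [← sh_flip, map₂_flip_flip, LinearMap.flip_apply, LinearMap.flip_apply, deconc_nil, hone,
        sh_nil_left]
    | case3 a u b v ih1 ih2 =>
      have e1 := deconc_shPrec_aux a u _ ih1
      have ih2' : deconc (sh (word v) (word (a :: u))) =
          TensorProduct.map₂ sh sh (deconc (word v)) (deconc (word (a :: u))) := by
        rw [sh_comm, ih2]
        conv_rhs => rw [← sh_flip, map₂_flip_flip, LinearMap.flip_apply]
      have e2 := deconc_shPrec_aux b v _ ih2'
      have e3 : TensorProduct.map₂ shPrec sh (deconc (word (b :: v))) (deconc (word (a :: u))) =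
          TensorProduct.map₂ shSucc sh (deconc (word (a :: u))) (deconc (word (b :: v))) := by
        have : (sh : Words α →ₗ[ℚ] _) = sh.flip := sh_flip.symm
        conv_rhs => rw [shSucc, this, map₂_flip_flip, LinearMap.flip_apply]
      rw [e3] at e2
      have e4 : TensorProduct.map₂ sh sh (deconc (word (a :: u))) (deconc (word (b :: v))) =
          TensorProduct.map₂ shPrec sh (deconc (word (a :: u))) (deconc (word (b :: v))) +
          TensorProduct.map₂ shSucc sh (deconc (word (a :: u))) (deconc (word (b :: v))) +
          word [] ⊗ₜ sh (word (a :: u)) (word (b :: v)) := by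
        conv_lhs => enter [1, 1, 1]; rw [sh_eq_add]
        rw [map₂_add_left, map₂_add_left, LinearMap.add_apply, LinearMap.add_apply,
          LinearMap.add_apply, LinearMap.add_apply, map₂_eps, eps_deconc, eps_deconc]
      rw [e4, sh_eq]
      simp only [eps_cons, mul_zero, zero_smul, add_zero, map_add, shSucc, LinearMap.flip_apply,
        e1, e2, TensorProduct.tmul_add]
      abel
  exact LinearMap.congr_fun₂ this x y

/-- The cut with an empty left part has to be singled out, since the other ones keep the first
letter of the shuffle in their left part. -/
lemma deconc_shPrec (x y : Words α) :
    deconc (shPrec x y) =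
      word [] ⊗ₜ shPrec x y + TensorProduct.map₂ shPrec sh (deconc x) (deconc y) := by
  induction x using words_induction with
  | h w =>
    cases w with
    | nil =>
      have : shPrec (word ([] : List α)) = 0 := LinearMap.ext fun x => by simp
      rw [deconc_nil, TensorProduct.map₂_apply_tmul, this]
      simp
    | cons a u => exact deconc_shPrec_aux a u y (deconc_sh _ _)
  | h0 => simp
  | hadd x x' hx hx' =>
    simp only [map_add, LinearMap.add_apply, hx, hx', TensorProduct.tmul_add]
    abel
  | hsmul c x hx => simp only [map_smul, LinearMap.smul_apply, hx, smul_add,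
      TensorProduct.tmul_smul]

lemma deconc_mapL (f : α → β) (x : Words α) :
    deconc (mapL f x) = TensorProduct.map (mapL f) (mapL f) (deconc x) := by
  have : deconc ∘ₗ mapL f = TensorProduct.map (mapL f) (mapL f) ∘ₗ deconc := by
    refine hom_ext_word fun w => ?_
    simp [deconc_word, List.map_take, List.map_drop]
  exact LinearMap.congr_fun this x

end Shuffle

/-! ### The half-products of graded permutations -/

section HalfProducts

/-- Adding `k` to the first row, linearly. -/
def shiftL (k : ℕ) : Words Biletter →ₗ[ℚ] Words Biletter := mapL fun b => (b.1 + k, b.2)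

lemma shiftL_word (k : ℕ) (w : List Biletter) : shiftL k (word w) = word (shift k w) := by
  simp [shiftL, shift]

@[simp] lemma shiftL_nil (k : ℕ) : shiftL k (word []) = word [] := by simp [shiftL]

lemma shiftL_shiftL (k l : ℕ) (x : Words Biletter) :
    shiftL k (shiftL l x) = shiftL (k + l) x := by
  have : shiftL k ∘ₗ shiftL l = shiftL (k + l) :=
    hom_ext_word fun w => by
      simp [shiftL, Function.comp_def, add_assoc, add_comm l k]
  exact LinearMap.congr_fun this x

/-- The shifted shuffle product: the sum of the two half-products, except that it has the empty
word as a unit. -/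
def gmul : Words Biletter →ₗ[ℚ] Words Biletter →ₗ[ℚ] Words Biletter :=
  bilinExt fun u v => sumWords (shuffles u (shift u.length v))

/-- The span of the words of length `k`. -/
def lengthEq (k : ℕ) : Submodule ℚ (Words Biletter) :=
  Submodule.span ℚ {x | ∃ w : List Biletter, w.length = k ∧ x = word w}

lemma word_mem_lengthEq (w : List Biletter) : word w ∈ lengthEq w.length :=
  Submodule.subset_span ⟨w, rfl, rfl⟩

lemma sumWords_mem {α : Type*} {D : Submodule ℚ (Words α)} {l : List (List α)}
    (h : ∀ w ∈ l, word w ∈ D) : sumWords l ∈ D := by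
  induction l with
  | nil => simp
  | cons w l ih =>
    rw [sumWords_cons]
    exact D.add_mem (h w (by simp)) (ih fun x hx => h x (by simp [hx]))

lemma eq_of_mem_lengthEq {M : Type*} [AddCommGroup M] [Module ℚ M] {k : ℕ}
    {f g : Words Biletter →ₗ[ℚ] M} (h : ∀ w : List Biletter, w.length = k → f (word w) = g (word w))
    {x : Words Biletter} (hx : x ∈ lengthEq k) : f x = g x := by
  have : lengthEq k ≤ LinearMap.eqLocus f g := by
    refine Submodule.span_le.2 ?_
    rintro _ ⟨w, hw, rfl⟩
    exact h w hw
  exact this hx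

lemma prec_eq {k : ℕ} {x : Words Biletter} (hx : x ∈ lengthEq k) (y : Words Biletter) :
    prec x y = shPrec x (shiftL k y) := by
  refine eq_of_mem_lengthEq (f := prec.flip y) (g := shPrec.flip (shiftL k y)) ?_ hx
  rintro w rfl
  have : prec (word w) = shPrec (word w) ∘ₗ shiftL w.length :=
    hom_ext_word fun v => by simp [prec, shPrec_word, shiftL_word]
  exact LinearMap.congr_fun this y

lemma succ_eq {k : ℕ} {x : Words Biletter} (hx : x ∈ lengthEq k) (y : Words Biletter) :
    succ x y = shPrec (shiftL k y) x := by
  refine eq_of_mem_lengthEq (f := succ.flip y) (g := shPrec (shiftL k y)) ?_ hx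
  rintro w rfl
  have : succ (word w) = shPrec.flip (word w) ∘ₗ shiftL w.length :=
    hom_ext_word fun v => by simp [succ, shPrec_word, shiftL_word]
  exact LinearMap.congr_fun this y

lemma gmul_eq {k : ℕ} {x : Words Biletter} (hx : x ∈ lengthEq k) (y : Words Biletter) :
    gmul x y = sh x (shiftL k y) := by
  refine eq_of_mem_lengthEq (f := gmul.flip y) (g := sh.flip (shiftL k y)) ?_ hx
  rintro w rfl
  have : gmul (word w) = sh (word w) ∘ₗ shiftL w.length :=
    hom_ext_word fun v => by simp [gmul, sh_word, shiftL_word]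
  exact LinearMap.congr_fun this y

lemma prec_word (u v : List Biletter) :
    prec (word u) (word v) = sumWords (halfShuffles u (shift u.length v)) := by simp [prec]

lemma succ_word (u v : List Biletter) :
    succ (word u) (word v) = sumWords (halfShuffles (shift u.length v) u) := by simp [succ]

lemma gmul_word (u v : List Biletter) :
    gmul (word u) (word v) = sumWords (shuffles u (shift u.length v)) := by simp [gmul]

@[simp] lemma length_shift (k : ℕ) (w : List Biletter) : (shift k w).length = w.length := by
  simp [shift]

lemma prec_mem_lengthEq (u v : List Biletter) :
    prec (word u) (word v) ∈ lengthEq (u.length + v.length) := by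
  rw [prec_word]
  refine sumWords_mem fun w hw => ?_
  have := (perm_of_mem_halfShuffles hw).length_eq
  rw [List.length_append, length_shift] at this
  exact this ▸ word_mem_lengthEq w

lemma succ_mem_lengthEq (u v : List Biletter) :
    succ (word u) (word v) ∈ lengthEq (u.length + v.length) := by
  rw [succ_word]
  refine sumWords_mem fun w hw => ?_
  have := (perm_of_mem_halfShuffles hw).length_eq
  rw [List.length_append, length_shift, add_comm] at this
  exact this ▸ word_mem_lengthEq w

lemma gmul_mem_lengthEq (u v : List Biletter) :
    gmul (word u) (word v) ∈ lengthEq (u.length + v.length) := by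
  rw [gmul_word]
  refine sumWords_mem fun w hw => ?_
  have := (perm_of_mem_shuffles hw).length_eq
  rw [List.length_append, length_shift] at this
  exact this ▸ word_mem_lengthEq w

/-- The first dendriform relation, valid with the unit included. -/
lemma prec_prec (x y z : Words Biletter) : prec (prec x y) z = prec x (gmul y z) := by
  induction x using words_induction with
  | h u =>
    induction y using words_induction with
    | h v =>
      rw [prec_eq (prec_mem_lengthEq u v), prec_eq (word_mem_lengthEq u),
        prec_eq (word_mem_lengthEq u), gmul_eq (word_mem_lengthEq v), shPrec_shPrec,
        ← shiftL_shiftL]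
      conv_rhs => rw [shiftL, mapL_sh]
      rfl
    | h0 => simp
    | hadd x x' hx hx' => simp only [map_add, LinearMap.add_apply, hx, hx']
    | hsmul c x hx => simp only [map_smul, LinearMap.smul_apply, hx]
  | h0 => simp
  | hadd x x' hx hx' => simp only [map_add, LinearMap.add_apply, hx, hx']
  | hsmul c x hx => simp only [map_smul, LinearMap.smul_apply, hx]

/-- The second dendriform relation, valid with the unit included. -/
lemma succ_prec (x y z : Words Biletter) : prec (succ x y) z = succ x (prec y z) := by
  induction x using words_induction with
  | h u =>
    induction y using words_induction with
    | h v =>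
      rw [prec_eq (succ_mem_lengthEq u v), succ_eq (word_mem_lengthEq u),
        succ_eq (word_mem_lengthEq u), prec_eq (word_mem_lengthEq v), shPrec_shPrec,
        ← shiftL_shiftL, sh_comm, ← shPrec_shPrec]
      conv_rhs => rw [shiftL, mapL_shPrec]
      rfl
    | h0 => simp
    | hadd x x' hx hx' => simp only [map_add, LinearMap.add_apply, hx, hx']
    | hsmul c x hx => simp only [map_smul, LinearMap.smul_apply, hx]
  | h0 => simp
  | hadd x x' hx hx' => simp only [map_add, LinearMap.add_apply, hx, hx']
  | hsmul c x hx => simp only [map_smul, LinearMap.smul_apply, hx]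

/-- The third dendriform relation, valid with the unit included. -/
lemma succ_succ (x y z : Words Biletter) : succ (gmul x y) z = succ x (succ y z) := by
  induction x using words_induction with
  | h u =>
    induction y using words_induction with
    | h v =>
      rw [succ_eq (gmul_mem_lengthEq u v), succ_eq (word_mem_lengthEq u),
        succ_eq (word_mem_lengthEq v), gmul_eq (word_mem_lengthEq u),
        ← shiftL_shiftL, sh_comm, ← shPrec_shPrec]
      conv_rhs => rw [shiftL, mapL_shPrec]
      rfl
    | h0 => simp
    | hadd x x' hx hx' => simp only [map_add, LinearMap.add_apply, hx, hx']
    | hsmul c x hx => simp only [map_smul, LinearMap.smul_apply, hx]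
  | h0 => simp
  | hadd x x' hx hx' => simp only [map_add, LinearMap.add_apply, hx, hx']
  | hsmul c x hx => simp only [map_smul, LinearMap.smul_apply, hx]

lemma nil_mem_lengthEq : word [] ∈ lengthEq 0 := word_mem_lengthEq []

lemma shiftL_zero (x : Words Biletter) : shiftL 0 x = x := by
  have : shiftL 0 = LinearMap.id := hom_ext_word fun w => by simp [shiftL]
  exact LinearMap.congr_fun this x

@[simp] lemma gmul_nil_left (x : Words Biletter) : gmul (word []) x = x := by
  rw [gmul_eq nil_mem_lengthEq, shiftL_zero, sh_nil_left]

@[simp] lemma gmul_nil_right (x : Words Biletter) : gmul x (word []) = x := by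
  induction x using words_induction with
  | h w => rw [gmul_eq (word_mem_lengthEq w)]; simp
  | h0 => simp
  | hadd x x' hx hx' => simp [hx, hx']
  | hsmul c x hx => simp [hx]

@[simp] lemma prec_nil_left (x : Words Biletter) : prec (word []) x = 0 := by
  rw [prec_eq nil_mem_lengthEq, shPrec_nil_left]

lemma prec_nil_right (x : Words Biletter) : prec x (word []) = x - eps x • word [] := by
  induction x using words_induction with
  | h w => rw [prec_eq (word_mem_lengthEq w), shiftL_nil, shPrec_nil_right]
  | h0 => simp
  | hadd x x' hx hx' => simp only [map_add, LinearMap.add_apply, hx, hx', add_smul]; abel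
  | hsmul c x hx => simp only [map_smul, LinearMap.smul_apply, hx, smul_sub, smul_assoc]

lemma succ_nil_left (x : Words Biletter) : succ (word []) x = x - eps x • word [] := by
  rw [succ_eq nil_mem_lengthEq, shiftL_zero, shPrec_nil_right]

@[simp] lemma succ_nil_right (x : Words Biletter) : succ x (word []) = 0 := by
  induction x using words_induction with
  | h w => rw [succ_eq (word_mem_lengthEq w), shiftL_nil, shPrec_nil_left]
  | h0 => simp
  | hadd x x' hx hx' => simp [hx, hx']
  | hsmul c x hx => simp [hx]

lemma eps_mapL {α β : Type*} (f : α → β) (x : Words α) : eps (mapL f x) = eps x := by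
  have : eps ∘ₗ mapL f = eps := hom_ext_word fun w => by cases w <;> simp
  exact LinearMap.congr_fun this x

lemma gmul_eq_add (x y : Words Biletter) :
    gmul x y = prec x y + succ x y + (eps x * eps y) • word [] := by
  induction x using words_induction with
  | h w =>
    rw [gmul_eq (word_mem_lengthEq w), prec_eq (word_mem_lengthEq w),
      succ_eq (word_mem_lengthEq w), sh_eq, shiftL, eps_mapL]
    rfl
  | h0 => simp
  | hadd x x' hx hx' => simp only [map_add, LinearMap.add_apply, hx, hx', add_smul, add_mul]; abel
  | hsmul c x hx =>
    simp only [map_smul, LinearMap.smul_apply, hx, smul_add, smul_eq_mul, mul_assoc, mul_smul]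

lemma eps_prec (x y : Words Biletter) : eps (prec x y) = 0 := by
  induction x using words_induction with
  | h w => rw [prec_eq (word_mem_lengthEq w), eps_shPrec]
  | h0 => simp
  | hadd x x' hx hx' => simp [hx, hx']
  | hsmul c x hx => simp [hx]

lemma eps_succ (x y : Words Biletter) : eps (succ x y) = 0 := by
  induction x using words_induction with
  | h w => rw [succ_eq (word_mem_lengthEq w), eps_shPrec]
  | h0 => simp
  | hadd x x' hx hx' => simp [hx, hx']
  | hsmul c x hx => simp [hx]

end HalfProducts

/-! ### Graded permutations as words -/

section Words

/-- The word `w` is the biword of a graded permutation: its first row is a permutation of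
`1, …, k` and the entries of its second row are positive. -/
def IsGradedPerm (w : List Biletter) : Prop :=
  (w.map Prod.fst).Perm (List.range' 1 w.length) ∧ ∀ b ∈ w, 1 ≤ b.2

lemma isGradedPerm_biword {k : ℕ} (σ : Equiv.Perm (Fin k)) (d : Fin k → ℕ+) :
    IsGradedPerm (biword σ d) := by
  constructor
  · have h : (biword σ d).map Prod.fst = (List.ofFn σ).map fun i : Fin k => (i : ℕ) + 1 := by
      simp [biword, List.map_ofFn, Function.comp_def]
    have h2 : List.range' 1 (biword σ d).length =
        (List.ofFn (id : Fin k → Fin k)).map fun i : Fin k => (i : ℕ) + 1 := by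
      apply List.ext_getElem <;> simp [biword, add_comm]
    rw [h, h2]
    exact (Equiv.Perm.ofFn_comp_perm σ id).map _
  · intro b hb
    obtain ⟨i, rfl⟩ := List.mem_ofFn.1 hb
    exact (d i).2

lemma IsGradedPerm.nodup {w : List Biletter} (h : IsGradedPerm w) : (w.map Prod.fst).Nodup :=
  h.1.nodup_iff.2 List.nodup_range'

lemma IsGradedPerm.mem_range {w : List Biletter} (h : IsGradedPerm w) {b : Biletter} (hb : b ∈ w) :
    1 ≤ b.1 ∧ b.1 ≤ w.length := by
  have := h.1.mem_iff.1 (List.mem_map_of_mem hb)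
  rw [List.mem_range'_1] at this
  omega

lemma IsGradedPerm.exists_one {w : List Biletter} (h : IsGradedPerm w) (h0 : w ≠ []) :
    ∃ b ∈ w, b.1 = 1 := by
  have : 1 ∈ w.map Prod.fst := by
    rw [h.1.mem_iff, List.mem_range'_1]
    have := List.length_pos_iff.2 h0
    omega
  simpa using this

lemma IsGradedPerm.perm {w w' : List Biletter} (h : IsGradedPerm w) (hp : w'.Perm w) :
    IsGradedPerm w' :=
  ⟨(hp.map _).trans (hp.length_eq ▸ h.1), fun b hb => h.2 b (hp.mem_iff.1 hb)⟩

lemma isGradedPerm_nil : IsGradedPerm [] := ⟨by simp, by simp⟩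

lemma IsGradedPerm.exists_biword {w : List Biletter} (h : IsGradedPerm w) :
    ∃ (σ : Equiv.Perm (Fin w.length)) (d : Fin w.length → ℕ+), w = biword σ d := by
  have hr : ∀ i : Fin w.length, 1 ≤ (w[i]).1 ∧ (w[i]).1 ≤ w.length := fun i =>
    h.mem_range (List.getElem_mem _)
  let f : Fin w.length → Fin w.length := fun i => ⟨(w[i]).1 - 1, by have := hr i; omega⟩
  have hf : Function.Injective f := by
    intro i j hij
    have h1 : (w[i]).1 = (w[j]).1 := by
      have := congrArg Fin.val hij
      simp only [f] at this
      have := hr i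
      have := hr j
      omega
    have := (List.Nodup.getElem_inj_iff h.nodup (i := i) (j := j)
      (hi := by simp) (hj := by simp)).1 (by simpa using h1)
    exact Fin.ext this
  refine ⟨Equiv.ofBijective f (Finite.injective_iff_bijective.1 hf),
    fun i => ⟨(w[i]).2, h.2 _ (List.getElem_mem _)⟩, ?_⟩
  apply List.ext_getElem
  · simp [biword]
  · intro i h1 h2
    have := hr ⟨i, h1⟩
    simp only [biword, Equiv.ofBijective_apply, PNat.mk_coe, List.getElem_ofFn, f]
    refine Prod.ext ?_ rfl
    simp only [Fin.getElem_fin] at this ⊢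
    omega

lemma gradedPerms_eq :
    gradedPerms = Submodule.span ℚ {x | ∃ w, IsGradedPerm w ∧ x = word w} := by
  rw [gradedPerms]
  congr 1
  ext x
  constructor
  · rintro ⟨k, σ, d, rfl⟩
    exact ⟨_, isGradedPerm_biword σ d, rfl⟩
  · rintro ⟨w, hw, rfl⟩
    obtain ⟨σ, d, h⟩ := hw.exists_biword
    exact ⟨_, σ, d, congrArg word h⟩

lemma gradedPermsPlus_eq :
    gradedPermsPlus = Submodule.span ℚ {x | ∃ w, IsGradedPerm w ∧ w ≠ [] ∧ x = word w} := by
  rw [gradedPermsPlus]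
  congr 1
  ext x
  constructor
  · rintro ⟨k, σ, d, hk, rfl⟩
    refine ⟨_, isGradedPerm_biword σ d, ?_, rfl⟩
    rw [← List.length_pos_iff]
    simpa [biword, Nat.pos_iff_ne_zero, Nat.one_le_iff_ne_zero] using hk
  · rintro ⟨w, hw, h0, rfl⟩
    obtain ⟨σ, d, h⟩ := hw.exists_biword
    exact ⟨_, σ, d, List.length_pos_iff.2 h0, congrArg word h⟩

lemma word_mem_gradedPerms {w : List Biletter} (h : IsGradedPerm w) : word w ∈ gradedPerms := by
  rw [gradedPerms_eq]; exact Submodule.subset_span ⟨w, h, rfl⟩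

lemma word_mem_gradedPermsPlus {w : List Biletter} (h : IsGradedPerm w) (h0 : w ≠ []) :
    word w ∈ gradedPermsPlus := by
  rw [gradedPermsPlus_eq]; exact Submodule.subset_span ⟨w, h, h0, rfl⟩

lemma gradedPerms_induction {P : (x : Words Biletter) → x ∈ gradedPerms → Prop}
    (h : ∀ w (hw : IsGradedPerm w), P (word w) (word_mem_gradedPerms hw)) (h0 : P 0 (zero_mem _))
    (hadd : ∀ x y hx hy, P x hx → P y hy → P (x + y) (add_mem hx hy))
    (hsmul : ∀ (c : ℚ) x hx, P x hx → P (c • x) (Submodule.smul_mem _ c hx))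
    {x : Words Biletter} (hx : x ∈ gradedPerms) : P x hx := by
  have h' : ∃ hx, P x hx := by
    have hx' := hx
    rw [gradedPerms_eq] at hx'
    clear hx
    induction hx' using Submodule.span_induction with
    | mem x hx => obtain ⟨w, hw, rfl⟩ := hx; exact ⟨_, h w hw⟩
    | zero => exact ⟨_, h0⟩
    | add x y _ _ ihx ihy =>
      obtain ⟨_, h1⟩ := ihx
      obtain ⟨_, h2⟩ := ihy
      exact ⟨_, hadd x y _ _ h1 h2⟩
    | smul c x _ ihx =>
      obtain ⟨_, h1⟩ := ihx
      exact ⟨_, hsmul c x _ h1⟩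
  exact h'.2

lemma gradedPermsPlus_induction {P : (x : Words Biletter) → x ∈ gradedPermsPlus → Prop}
    (h : ∀ w (hw : IsGradedPerm w) (hw0 : w ≠ []), P (word w) (word_mem_gradedPermsPlus hw hw0))
    (h0 : P 0 (zero_mem _))
    (hadd : ∀ x y hx hy, P x hx → P y hy → P (x + y) (add_mem hx hy))
    (hsmul : ∀ (c : ℚ) x hx, P x hx → P (c • x) (Submodule.smul_mem _ c hx))
    {x : Words Biletter} (hx : x ∈ gradedPermsPlus) : P x hx := by
  have h' : ∃ hx, P x hx := by
    have hx' := hx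
    rw [gradedPermsPlus_eq] at hx'
    clear hx
    induction hx' using Submodule.span_induction with
    | mem x hx => obtain ⟨w, hw, h1, rfl⟩ := hx; exact ⟨_, h w hw h1⟩
    | zero => exact ⟨_, h0⟩
    | add x y _ _ ihx ihy =>
      obtain ⟨_, h1⟩ := ihx
      obtain ⟨_, h2⟩ := ihy
      exact ⟨_, hadd x y _ _ h1 h2⟩
    | smul c x _ ihx =>
      obtain ⟨_, h1⟩ := ihx
      exact ⟨_, hsmul c x _ h1⟩
  exact h'.2

lemma gradedPermsPlus_le : gradedPermsPlus ≤ gradedPerms := by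
  rw [gradedPermsPlus_eq, gradedPerms_eq]
  exact Submodule.span_mono fun x ⟨w, hw, _, hx⟩ => ⟨w, hw, hx⟩

lemma eps_of_mem_gradedPermsPlus {x : Words Biletter} (hx : x ∈ gradedPermsPlus) : eps x = 0 := by
  induction hx using gradedPermsPlus_induction with
  | h w hw h0 =>
    cases w with
    | nil => exact absurd rfl h0
    | cons a w => simp
  | h0 => simp
  | hadd x y _ _ hx hy => simp [hx, hy]
  | hsmul c x _ hx => simp [hx]

lemma mem_gradedPermsPlus_iff {x : Words Biletter} (hx : x ∈ gradedPerms) :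
    x ∈ gradedPermsPlus ↔ eps x = 0 := by
  refine ⟨eps_of_mem_gradedPermsPlus, fun h => ?_⟩
  have : x - eps x • word [] ∈ gradedPermsPlus := by
    clear h
    induction hx using gradedPerms_induction with
    | h w hw =>
      cases w with
      | nil => simp
      | cons a w => simpa using word_mem_gradedPermsPlus hw (by simp)
    | h0 => simp
    | hadd x y _ _ hx hy =>
      have := add_mem hx hy
      rwa [sub_add_sub_comm, ← add_smul, ← map_add] at this
    | hsmul c x _ hx =>
      have := Submodule.smul_mem _ c hx
      rwa [smul_sub, ← mul_smul, ← smul_eq_mul, ← map_smul] at this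
  simpa [h] using this

lemma IsGradedPerm.append_shift {u v : List Biletter} (hu : IsGradedPerm u) (hv : IsGradedPerm v) :
    IsGradedPerm (u ++ shift u.length v) := by
  constructor
  · rw [List.map_append, List.length_append, length_shift,
      ← List.range'_append (step := 1)]
    refine hu.1.append ?_
    have : (shift u.length v).map Prod.fst = (v.map Prod.fst).map (· + u.length) := by
      simp [shift]
    rw [this]
    have h2 : List.range' (1 + 1 * u.length) v.length =
        (List.range' 1 v.length).map (· + u.length) := by
      apply List.ext_getElem <;> simp
      intro i _ ; omega
    rw [h2]
    exact hv.1.map _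
  · intro b hb
    rcases List.mem_append.1 hb with hb | hb
    · exact hu.2 b hb
    · simp only [shift, List.mem_map] at hb
      obtain ⟨c, hc, rfl⟩ := hb
      exact hv.2 c hc

lemma gmul_mem {x y : Words Biletter} (hx : x ∈ gradedPerms) (hy : y ∈ gradedPerms) :
    gmul x y ∈ gradedPerms := by
  induction hx using gradedPerms_induction with
  | h u hu =>
    induction hy using gradedPerms_induction with
    | h v hv =>
      rw [gmul_word]
      exact sumWords_mem fun w hw =>
        word_mem_gradedPerms ((hu.append_shift hv).perm (perm_of_mem_shuffles hw))
    | h0 => simp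
    | hadd x y _ _ hx hy => rw [map_add]; exact add_mem hx hy
    | hsmul c x _ hx => rw [map_smul]; exact Submodule.smul_mem _ c hx
  | h0 => simp
  | hadd x y _ _ hx hy => rw [map_add]; exact add_mem hx hy
  | hsmul c x _ hx => rw [map_smul]; exact Submodule.smul_mem _ c hx

lemma prec_mem {x y : Words Biletter} (hx : x ∈ gradedPerms) (hy : y ∈ gradedPerms) :
    prec x y ∈ gradedPermsPlus := by
  rw [mem_gradedPermsPlus_iff _]
  · exact eps_prec x y
  induction hx using gradedPerms_induction with
  | h u hu =>
    induction hy using gradedPerms_induction with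
    | h v hv =>
      rw [prec_word]
      exact sumWords_mem fun w hw =>
        word_mem_gradedPerms ((hu.append_shift hv).perm (perm_of_mem_halfShuffles hw))
    | h0 => simp
    | hadd x y _ _ hx hy => rw [map_add]; exact add_mem hx hy
    | hsmul c x _ hx => rw [map_smul]; exact Submodule.smul_mem _ c hx
  | h0 => simp
  | hadd x y _ _ hx hy => rw [map_add]; exact add_mem hx hy
  | hsmul c x _ hx => rw [map_smul]; exact Submodule.smul_mem _ c hx

lemma succ_mem {x y : Words Biletter} (hx : x ∈ gradedPerms) (hy : y ∈ gradedPerms) :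
    succ x y ∈ gradedPermsPlus := by
  rw [mem_gradedPermsPlus_iff _]
  · exact eps_succ x y
  have : succ x y = gmul x y - prec x y - (eps x * eps y) • word [] := by
    rw [gmul_eq_add]; abel
  rw [this]
  exact sub_mem (sub_mem (gmul_mem hx hy) (gradedPermsPlus_le (prec_mem hx hy)))
    (Submodule.smul_mem _ _ (word_mem_gradedPerms isGradedPerm_nil))

/-! ### Standardization -/

/-- Replacing the first entry of a biletter by its rank in `w`. -/
def rankIn (w : List Biletter) (b : Biletter) : Biletter := (w.countP (·.1 ≤ b.1), b.2)

lemma std_eq (w : List Biletter) : std w = w.map (rankIn w) := rfl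

@[simp] lemma std_nil : std [] = [] := rfl

@[simp] lemma length_std (w : List Biletter) : (std w).length = w.length := by simp [std]

lemma rankIn_perm {w w' : List Biletter} (h : w.Perm w') : rankIn w = rankIn w' := by
  ext b
  · exact h.countP_eq _
  · rfl

lemma rankIn_le_iff {w : List Biletter} {a b : Biletter} (ha : a ∈ w) :
    (rankIn w a).1 ≤ (rankIn w b).1 ↔ a.1 ≤ b.1 := by
  constructor
  · intro h
    by_contra hlt
    push Not at hlt
    have : w.countP (·.1 ≤ b.1) < w.countP (·.1 ≤ a.1) := by
      clear h
      induction w with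
      | nil => simp at ha
      | cons c w ih =>
        rw [List.countP_cons, List.countP_cons]
        have hle : w.countP (·.1 ≤ b.1) ≤ w.countP (·.1 ≤ a.1) :=
          List.countP_mono_left fun x _ hx => by simp at hx ⊢; omega
        rcases List.mem_cons.1 ha with rfl | ha
        · simp [show ¬ a.1 ≤ b.1 by omega]; omega
        · have := ih ha
          simp only [decide_eq_true_eq]
          split_ifs with h1 h2 <;> omega
    exact absurd h (by simp only [rankIn]; omega)
  · intro h
    exact List.countP_mono_left fun x _ hx => by simp at hx ⊢; omega

/-- Standardization only depends on the relative order of the first entries. -/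
lemma std_map {w : List Biletter} {g : Biletter → Biletter}
    (h : ∀ a ∈ w, ∀ b ∈ w, (g a).1 ≤ (g b).1 ↔ a.1 ≤ b.1) (h2 : ∀ a ∈ w, (g a).2 = a.2) :
    std (w.map g) = std w := by
  simp only [std, List.map_map]
  refine List.map_congr_left fun b hb => Prod.ext ?_ (h2 b hb)
  simp only [Function.comp, List.countP_map]
  exact List.countP_congr fun a ha => by simpa using h a ha b hb

lemma std_sublist_std {w x : List Biletter} (h : x ⊆ w) : std (x.map (rankIn w)) = std x :=
  std_map (fun _ ha _ _ => rankIn_le_iff (h ha)) fun _ _ => rfl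

lemma countP_range' (n m : ℕ) (h : m ≤ n) : (List.range' 1 n).countP (· ≤ m) = m := by
  induction n with
  | zero => simp; omega
  | succ n ih =>
    rw [List.range'_concat, List.countP_append]
    rcases Nat.lt_or_ge n m with h' | h'
    · obtain rfl : m = n + 1 := by omega
      have : (List.range' 1 n).countP (· ≤ n + 1) = (List.range' 1 n).length :=
        List.countP_eq_length.2 fun a ha => by
          rw [List.mem_range'_1] at ha; simp; omega
      rw [this]; simp; omega
    · rw [ih h']; simp; omega

lemma std_of_isGradedPerm {w : List Biletter} (h : IsGradedPerm w) : std w = w := by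
  conv_rhs => rw [← List.map_id w]
  refine List.map_congr_left fun b hb => Prod.ext ?_ rfl
  have h1 := h.mem_range hb
  have : w.countP (·.1 ≤ b.1) = (w.map Prod.fst).countP (· ≤ b.1) := by
    rw [List.countP_map]; rfl
  simp only [this, h.1.countP_eq, countP_range' _ _ h1.2, id]

lemma isGradedPerm_std {w : List Biletter} (h : (w.map Prod.fst).Nodup) (h2 : ∀ b ∈ w, 1 ≤ b.2) :
    IsGradedPerm (std w) := by
  constructor
  · refine List.Subperm.perm_of_length_le (List.subperm_of_subset ?_ ?_) (by simp)
    · rw [std_eq, List.map_map]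
      refine List.Nodup.map_on ?_ h.of_map
      intro a ha b hb hab
      simp only [Function.comp] at hab
      have h1 := (rankIn_le_iff (b := b) ha).1 hab.le
      have h3 := (rankIn_le_iff (b := a) hb).1 hab.ge
      exact List.inj_on_of_nodup_map h ha hb (le_antisymm h1 h3)
    · intro n hn
      rw [std_eq, List.map_map, List.mem_map] at hn
      obtain ⟨b, hb, rfl⟩ := hn
      rw [List.mem_range'_1, length_std]
      have h1 : 0 < w.countP (·.1 ≤ b.1) := List.countP_pos_iff.2 ⟨b, hb, by simp⟩
      have h3 : w.countP (·.1 ≤ b.1) ≤ w.length := List.countP_le_length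
      simp only [Function.comp, rankIn]
      omega
  · intro b hb
    simp only [std, List.mem_map] at hb
    obtain ⟨c, hc, rfl⟩ := hb
    exact h2 c hc

/-- Standardization, linearly. -/
def stdL : Words Biletter →ₗ[ℚ] Words Biletter := linExt fun w => word (std w)

@[simp] lemma stdL_word (w : List Biletter) : stdL (word w) = word (std w) := by simp [stdL]

lemma stdL_sumWords {l : List (List Biletter)} {z : List Biletter} (h : ∀ w ∈ l, w.Perm z) :
    stdL (sumWords l) = mapL (rankIn z) (sumWords l) := by
  induction l with
  | nil => simp
  | cons w l ih =>
    rw [sumWords_cons, map_add, map_add, ih fun x hx => h x (by simp [hx]), stdL_word, mapL_word,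
      std_eq, rankIn_perm (h w (by simp))]

lemma map_rankIn_left {u v : List Biletter} {k : ℕ} (hu : ∀ b ∈ u, b.1 ≤ k)
    (hv : ∀ b ∈ v, 1 ≤ b.1) : u.map (rankIn (u ++ shift k v)) = std u := by
  refine List.map_congr_left fun b hb => Prod.ext ?_ rfl
  simp only [rankIn, List.countP_append]
  have : (shift k v).countP (·.1 ≤ b.1) = 0 := by
    rw [List.countP_eq_zero]
    intro c hc
    simp only [shift, List.mem_map] at hc
    obtain ⟨c, hc, rfl⟩ := hc
    have := hu b hb
    have := hv c hc
    simp; omega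
  omega

lemma map_rankIn_right {u v : List Biletter} {k : ℕ} (hu : ∀ b ∈ u, b.1 ≤ k) :
    (shift k v).map (rankIn (u ++ shift k v)) = shift (std u).length (std v) := by
  simp only [shift, std, List.map_map, List.length_map]
  refine List.map_congr_left fun b hb => Prod.ext ?_ rfl
  simp only [Function.comp, rankIn, List.countP_append, List.countP_map]
  have h1 : u.countP (fun c => decide (c.1 ≤ b.1 + k)) = u.length :=
    List.countP_eq_length.2 fun c hc => by have := hu c hc; simp; omega
  have h2 : v.countP ((fun c : Biletter => decide (c.1 ≤ b.1 + k)) ∘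
      fun c : Biletter => (c.1 + k, c.2)) = v.countP (fun c => decide (c.1 ≤ b.1)) :=
    List.countP_congr fun c _ => by simp
  rw [h1, h2, add_comm]

lemma stdL_sh {u v : List Biletter} {k : ℕ} (hu : ∀ b ∈ u, b.1 ≤ k)
    (hv : ∀ b ∈ v, 1 ≤ b.1) :
    stdL (sh (word u) (shiftL k (word v))) = gmul (word (std u)) (word (std v)) := by
  rw [shiftL_word, sh_word, stdL_sumWords fun w hw => perm_of_mem_shuffles hw, ← sh_word, mapL_sh,
    mapL_word, mapL_word, map_rankIn_left hu hv, map_rankIn_right hu,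
    gmul_eq (word_mem_lengthEq _), shiftL_word]

lemma stdL_shPrec {u v : List Biletter} {k : ℕ} (hu : ∀ b ∈ u, b.1 ≤ k)
    (hv : ∀ b ∈ v, 1 ≤ b.1) :
    stdL (shPrec (word u) (shiftL k (word v))) = prec (word (std u)) (word (std v)) := by
  rw [shiftL_word, shPrec_word, stdL_sumWords fun w hw => perm_of_mem_halfShuffles hw,
    ← shPrec_word, mapL_shPrec, mapL_word, mapL_word, map_rankIn_left hu hv,
    map_rankIn_right hu, prec_eq (word_mem_lengthEq _), shiftL_word]

lemma stdL_shSucc {u v : List Biletter} {k : ℕ} (hu : ∀ b ∈ u, b.1 ≤ k)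
    (hv : ∀ b ∈ v, 1 ≤ b.1) :
    stdL (shPrec (shiftL k (word v)) (word u)) = succ (word (std u)) (word (std v)) := by
  rw [shiftL_word, shPrec_word, stdL_sumWords fun w hw =>
      (perm_of_mem_halfShuffles hw).trans List.perm_append_comm,
    ← shPrec_word, mapL_shPrec, mapL_word, mapL_word, map_rankIn_left hu hv,
    map_rankIn_right hu, succ_eq (word_mem_lengthEq _), shiftL_word]

end Words

/-! ### Tensor squares -/

section TensorSquare

variable {V : Type*} [AddCommGroup V] [Module ℚ V] {D : Submodule ℚ V}

lemma tmul_mem_tensorSquare {a b : V} (ha : a ∈ D) (hb : b ∈ D) : a ⊗ₜ b ∈ tensorSquare D :=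
  ⟨⟨a, ha⟩ ⊗ₜ ⟨b, hb⟩, by simp⟩

lemma tensorSquare_le {E : Submodule ℚ (V ⊗[ℚ] V)} :
    tensorSquare D ≤ E ↔ ∀ a ∈ D, ∀ b ∈ D, a ⊗ₜ b ∈ E := by
  refine ⟨fun h a ha b hb => h (tmul_mem_tensorSquare ha hb), fun h => ?_⟩
  rintro _ ⟨z, rfl⟩
  induction z using TensorProduct.induction_on with
  | zero => simp
  | tmul a b => simpa using h a a.2 b b.2
  | add x y hx hy => rw [map_add]; exact E.add_mem hx hy

/-- Linear maps that agree on pure tensors of elements of `D` agree on the tensor square. -/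
lemma eq_on_tensorSquare {M : Type*} [AddCommGroup M] [Module ℚ M] {f g : V ⊗[ℚ] V →ₗ[ℚ] M}
    (h : ∀ a ∈ D, ∀ b ∈ D, f (a ⊗ₜ b) = g (a ⊗ₜ b)) {z : V ⊗[ℚ] V} (hz : z ∈ tensorSquare D) :
    f z = g z :=
  (tensorSquare_le (E := LinearMap.eqLocus f g)).2 h hz

/-- A linear map sends the tensor square into `E` if it does so for pure tensors. -/
lemma map_mem_of_tensorSquare {M : Type*} [AddCommGroup M] [Module ℚ M]
    {f : V ⊗[ℚ] V →ₗ[ℚ] M} {E : Submodule ℚ M} (h : ∀ a ∈ D, ∀ b ∈ D, f (a ⊗ₜ b) ∈ E)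
    {z : V ⊗[ℚ] V} (hz : z ∈ tensorSquare D) : f z ∈ E :=
  (tensorSquare_le (E := E.comap f)).2 h hz

end TensorSquare

/-! ### The coproducts of graded permutations, with unit -/

section Coproducts

/-- The full coproduct: the sum over all cuts, with standardized parts. -/
def cop : Words Biletter →ₗ[ℚ] Words Biletter ⊗[ℚ] Words Biletter :=
  TensorProduct.map stdL stdL ∘ₗ deconc

/-- The standardized cut `x | y` if the entry `1` is in the right part (`c = true`) or is not in
the right part (`c = false`), and `0` otherwise. -/
def markedCut (c : Bool) (x y : List Biletter) : Words Biletter ⊗[ℚ] Words Biletter :=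
  if decide (∃ b ∈ y, b.1 = 1) = c then word (std x) ⊗ₜ word (std y) else 0

/-- The half-coproducts with the trivial cuts included: the sum over the cuts with the entry `1`
in the right part (`c = true`) or not in the right part (`c = false`). The empty word has only the
second kind of cut. -/
def halfCop (c : Bool) : Words Biletter →ₗ[ℚ] Words Biletter ⊗[ℚ] Words Biletter :=
  TensorProduct.lift (bilinExt (markedCut c)) ∘ₗ deconc

lemma halfCop_word (c : Bool) (w : List Biletter) : halfCop c (word w) =
    ∑ i ∈ Finset.range (w.length + 1), markedCut c (w.take i) (w.drop i) := by
  simp [halfCop, deconc_word]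

lemma halfCop_add (x : Words Biletter) : halfCop false x + halfCop true x = cop x := by
  have : halfCop false + halfCop true = cop := by
    refine hom_ext_word fun w => ?_
    rw [LinearMap.add_apply, halfCop_word, halfCop_word, ← Finset.sum_add_distrib, cop,
      LinearMap.comp_apply, deconc_word, map_sum]
    refine Finset.sum_congr rfl fun i _ => ?_
    simp only [markedCut, TensorProduct.map_tmul, stdL_word]
    split_ifs <;> simp_all
  exact LinearMap.congr_fun this x

@[simp] lemma halfCop_nil (c : Bool) :
    halfCop c (word []) = if c then 0 else word [] ⊗ₜ word [] := by
  cases c <;> simp [halfCop_word, markedCut]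

lemma lift_markedCut (c : Bool) (X : Words Biletter) (l : List (List Biletter)) (q : Prop)
    [Decidable q] (h : ∀ y ∈ l, (∃ b ∈ y, b.1 = 1) ↔ q) :
    TensorProduct.lift (bilinExt (markedCut c)) (X ⊗ₜ sumWords l) =
      if decide q = c then stdL X ⊗ₜ stdL (sumWords l) else 0 := by
  induction l with
  | nil => simp
  | cons y l ih =>
    rw [sumWords_cons, TensorProduct.tmul_add, map_add, map_add,
      ih fun y hy => h y (by simp [hy]), TensorProduct.tmul_add]
    have : TensorProduct.lift (bilinExt (markedCut c)) (X ⊗ₜ word y) =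
        if decide q = c then stdL X ⊗ₜ stdL (word y) else 0 := by
      have hy : (∃ b ∈ y, b.1 = 1) ↔ q := h y (by simp)
      clear ih h
      induction X using words_induction with
      | h x => simp [markedCut, hy]
      | h0 => simp
      | hadd x x' hx hx' =>
        rw [TensorProduct.add_tmul, map_add, hx, hx', map_add, TensorProduct.add_tmul]
        split_ifs <;> simp
      | hsmul r x hx =>
        rw [← TensorProduct.smul_tmul', map_smul, hx, map_smul, ← TensorProduct.smul_tmul']
        split_ifs <;> simp
    rw [this]
    split_ifs <;> simp

lemma lift_markedCut_nil (c : Bool) {z : Words Biletter} (hz : z ∈ gradedPermsPlus) :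
    TensorProduct.lift (bilinExt (markedCut c)) (word [] ⊗ₜ z) =
      if c then word [] ⊗ₜ z else 0 := by
  induction hz using gradedPermsPlus_induction with
  | h w hw h0 =>
    have := lift_markedCut c (word []) [w] True (by simpa using hw.exists_one h0)
    simp only [sumWords_cons, sumWords_nil, add_zero, decide_true, stdL_word, std_nil,
      std_of_isGradedPerm hw] at this
    rw [this]
    cases c <;> simp
  | h0 => simp
  | hadd x y _ _ hx hy => rw [TensorProduct.tmul_add, map_add, hx, hy]; split_ifs <;> simp
  | hsmul r x _ hx => rw [TensorProduct.tmul_smul, map_smul, hx]; split_ifs <;> simp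

/-- The half-coproducts of a half-product, computed on shuffles before standardization. -/
lemma lift_markedCut_map₂ (c : Bool) {u v : List Biletter} (hu : IsGradedPerm u) (hu0 : u ≠ [])
    (hv : IsGradedPerm v) (h H : Words Biletter →ₗ[ℚ] Words Biletter →ₗ[ℚ] Words Biletter)
    (hH : ∀ {x y : List Biletter} {k : ℕ}, (∀ b ∈ x, b.1 ≤ k) → (∀ b ∈ y, 1 ≤ b.1) →
      stdL (h (word x) (shiftL k (word y))) = H (word (std x)) (word (std y))) :
    TensorProduct.lift (bilinExt (markedCut c)) (TensorProduct.map₂ h sh (deconc (word u))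
      (deconc (shiftL u.length (word v)))) =
      TensorProduct.map₂ H gmul (halfCop c (word u)) (cop (word v)) := by
  have e1 : deconc (shiftL u.length (word v)) = ∑ j ∈ Finset.range (v.length + 1),
      shiftL u.length (word (v.take j)) ⊗ₜ[ℚ] shiftL u.length (word (v.drop j)) := by
    rw [shiftL, deconc_mapL, deconc_word, map_sum]
    simp
  have e2 : cop (word v) = ∑ j ∈ Finset.range (v.length + 1),
      word (std (v.take j)) ⊗ₜ[ℚ] word (std (v.drop j)) := by
    rw [cop, LinearMap.comp_apply, deconc_word, map_sum]
    simp
  rw [e1, e2, halfCop_word, deconc_word]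
  simp only [map_sum, LinearMap.sum_apply]
  refine Finset.sum_congr rfl fun j _ => Finset.sum_congr rfl fun i _ => ?_
  rw [TensorProduct.map₂_apply_tmul, TensorProduct.map_tmul]
  have b1 : ∀ b ∈ u.take i, b.1 ≤ u.length := fun b hb =>
    (hu.mem_range (List.mem_of_mem_take hb)).2
  have b2 : ∀ b ∈ u.drop i, b.1 ≤ u.length := fun b hb =>
    (hu.mem_range (List.mem_of_mem_drop hb)).2
  have c1 : ∀ b ∈ v.take j, 1 ≤ b.1 := fun b hb => (hv.mem_range (List.mem_of_mem_take hb)).1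
  have c2 : ∀ b ∈ v.drop j, 1 ≤ b.1 := fun b hb => (hv.mem_range (List.mem_of_mem_drop hb)).1
  have key := lift_markedCut c (h (word (u.take i)) (shiftL u.length (word (v.take j))))
    (shuffles (u.drop i) (shift u.length (v.drop j))) (∃ b ∈ u.drop i, b.1 = 1) (by
      intro y hy
      have hp := perm_of_mem_shuffles hy
      constructor
      · rintro ⟨b, hb, h1⟩
        rcases List.mem_append.1 (hp.mem_iff.1 hb) with hb | hb
        · exact ⟨b, hb, h1⟩
        · simp only [shift, List.mem_map] at hb
          obtain ⟨d, hd, rfl⟩ := hb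
          have := c2 d hd
          have := List.length_pos_iff.2 hu0
          simp only at h1
          omega
      · rintro ⟨b, hb, h1⟩
        exact ⟨b, hp.mem_iff.2 (List.mem_append_left _ hb), h1⟩)
  rw [← sh_word, ← shiftL_word, hH b1 c1, stdL_sh b2 c2] at key
  rw [key, markedCut]
  split_ifs <;>
    first
    | contradiction
    | rw [TensorProduct.map₂_apply_tmul, TensorProduct.map_tmul]
    | simp

/-- The half-coproducts are compatible with `≺`. -/
lemma halfCop_prec (c : Bool) {x y : Words Biletter} (hx : x ∈ gradedPermsPlus)
    (hy : y ∈ gradedPerms) : halfCop c (prec x y) =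
      (if c then word [] ⊗ₜ prec x y else 0) +
        TensorProduct.map₂ prec gmul (halfCop c x) (cop y) := by
  have h0 := prec_mem (gradedPermsPlus_le hx) hy
  have : ∀ z, (if c then word [] ⊗ₜ z else 0 : Words Biletter ⊗[ℚ] Words Biletter) =
      (if c then TensorProduct.mk ℚ _ _ (word []) else 0) z := by intro z; split_ifs <;> rfl
  rw [this]
  clear h0
  induction hx using gradedPermsPlus_induction with
  | h u hu hu0 =>
    induction hy using gradedPerms_induction with
    | h v hv =>
      have h0 := prec_mem (word_mem_gradedPerms hu) (word_mem_gradedPerms hv)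
      rw [← this, ← lift_markedCut_nil c h0, ← lift_markedCut_map₂ c hu hu0 hv shPrec prec
        stdL_shPrec, halfCop, LinearMap.comp_apply, prec_eq (word_mem_lengthEq u), deconc_shPrec,
        map_add]
    | h0 => simp
    | hadd x y _ _ hx hy => simp only [map_add, hx, hy]; abel
    | hsmul c x _ hx => simp only [map_smul, hx, smul_add]
  | h0 => simp
  | hadd x y _ _ hx hy => simp only [map_add, LinearMap.add_apply, hx, hy]; abel
  | hsmul c x _ hx => simp only [map_smul, LinearMap.smul_apply, hx, smul_add]

/-- The half-coproducts are compatible with `≻`. -/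
lemma halfCop_succ (c : Bool) {x y : Words Biletter} (hx : x ∈ gradedPermsPlus)
    (hy : y ∈ gradedPerms) : halfCop c (succ x y) =
      (if c then word [] ⊗ₜ succ x y else 0) +
        TensorProduct.map₂ succ gmul (halfCop c x) (cop y) := by
  have : ∀ z, (if c then word [] ⊗ₜ z else 0 : Words Biletter ⊗[ℚ] Words Biletter) =
      (if c then TensorProduct.mk ℚ _ _ (word []) else 0) z := by intro z; split_ifs <;> rfl
  rw [this]
  induction hx using gradedPermsPlus_induction with
  | h u hu hu0 =>
    induction hy using gradedPerms_induction with
    | h v hv =>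
      have h0 := succ_mem (word_mem_gradedPerms hu) (word_mem_gradedPerms hv)
      have e : TensorProduct.map₂ shSucc sh (deconc (word u))
          (deconc (shiftL u.length (word v))) =
          TensorProduct.map₂ shPrec sh (deconc (shiftL u.length (word v))) (deconc (word u)) := by
        rw [shSucc, ← sh_flip, map₂_flip_flip, LinearMap.flip_apply, sh_flip]
      rw [← this, ← lift_markedCut_nil c h0, ← lift_markedCut_map₂ c hu hu0 hv shSucc succ
        stdL_shSucc, e, halfCop, LinearMap.comp_apply, succ_eq (word_mem_lengthEq u),
        deconc_shPrec, map_add]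
    | h0 => simp
    | hadd x y _ _ hx hy => simp only [map_add, hx, hy]; abel
    | hsmul c x _ hx => simp only [map_smul, hx, smul_add]
  | h0 => simp
  | hadd x y _ _ hx hy => simp only [map_add, LinearMap.add_apply, hx, hy]; abel
  | hsmul c x _ hx => simp only [map_smul, LinearMap.smul_apply, hx, smul_add]

/-! ### The reduced half-coproducts -/

lemma dprec_word (w : List Biletter) : dprec (word w) = ∑ i ∈ Finset.Ico 1 w.length,
    if 1 ∈ (w.take i).map Prod.fst then word (std (w.take i)) ⊗ₜ[ℚ] word (std (w.drop i))
    else 0 := by simp [dprec]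

lemma dsucc_word (w : List Biletter) : dsucc (word w) = ∑ i ∈ Finset.Ico 1 w.length,
    if 1 ∈ (w.drop i).map Prod.fst then word (std (w.take i)) ⊗ₜ[ℚ] word (std (w.drop i))
    else 0 := by simp [dsucc]

lemma sum_range_ends {M : Type*} [AddCommMonoid M] (f : ℕ → M) {n : ℕ} (h : 0 < n) :
    ∑ i ∈ Finset.range (n + 1), f i = f 0 + ∑ i ∈ Finset.Ico 1 n, f i + f n := by
  rw [Finset.sum_range_succ, Finset.range_eq_Ico, Finset.sum_eq_sum_Ico_succ_bot h]

lemma halfCop_false {x : Words Biletter} (hx : x ∈ gradedPermsPlus) :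
    halfCop false x = x ⊗ₜ word [] + dprec x := by
  induction hx using gradedPermsPlus_induction with
  | h w hw h0 =>
    have h1 := hw.exists_one h0
    rw [halfCop_word, sum_range_ends _ (List.length_pos_iff.2 h0), dprec_word]
    have e0 : markedCut false (w.take 0) (w.drop 0) = 0 := by
      rw [markedCut, if_neg (by simpa using h1)]
    have e1 : markedCut false (w.take w.length) (w.drop w.length) = word w ⊗ₜ word [] := by
      simp [markedCut, std_of_isGradedPerm hw]
    rw [e0, e1, zero_add, add_comm]
    congr 1
    refine Finset.sum_congr rfl fun i _ => ?_
    have hn : ((w.take i).map Prod.fst ++ (w.drop i).map Prod.fst).Nodup := by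
      rw [← List.map_append, List.take_append_drop]; exact hw.nodup
    have hm : 1 ∈ (w.take i).map Prod.fst ++ (w.drop i).map Prod.fst := by
      rw [← List.map_append, List.take_append_drop]; simpa using h1
    have hd := List.disjoint_of_nodup_append hn
    have : (∃ b ∈ w.drop i, b.1 = 1) ↔ 1 ∈ (w.drop i).map Prod.fst := List.mem_map.symm
    simp only [markedCut, this]
    rcases List.mem_append.1 hm with h | h
    · have h' : 1 ∉ (w.drop i).map Prod.fst := fun h' => hd h h'
      rw [if_pos h, if_pos (by simpa using h')]
    · have h' : 1 ∉ (w.take i).map Prod.fst := fun h' => hd h' h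
      rw [if_neg h', if_neg (by simpa using h)]
  | h0 => simp
  | hadd x y _ _ hx hy => simp only [map_add, hx, hy, TensorProduct.add_tmul]; abel
  | hsmul c x _ hx => simp only [map_smul, hx, smul_add, TensorProduct.smul_tmul']

lemma halfCop_true {x : Words Biletter} (hx : x ∈ gradedPermsPlus) :
    halfCop true x = word [] ⊗ₜ x + dsucc x := by
  induction hx using gradedPermsPlus_induction with
  | h w hw h0 =>
    rw [halfCop_word, sum_range_ends _ (List.length_pos_iff.2 h0), dsucc_word]
    have e0 : markedCut true (w.take 0) (w.drop 0) = word [] ⊗ₜ word w := by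
      have := hw.exists_one h0
      simp only [Prod.exists, exists_and_right, exists_eq_right] at this
      simp [markedCut, std_of_isGradedPerm hw, this]
    have e1 : markedCut true (w.take w.length) (w.drop w.length) = 0 := by
      simp [markedCut]
    rw [e0, e1, add_zero]
    congr 1
    refine Finset.sum_congr rfl fun i _ => ?_
    have : (∃ b ∈ w.drop i, b.1 = 1) ↔ 1 ∈ (w.drop i).map Prod.fst := List.mem_map.symm
    simp only [markedCut, this, decide_eq_true_eq]
  | h0 => simp
  | hadd x y _ _ hx hy => simp only [map_add, hx, hy, TensorProduct.tmul_add]; abel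
  | hsmul c x _ hx => simp only [map_smul, hx, smul_add, TensorProduct.tmul_smul]

lemma cop_eq {x : Words Biletter} (hx : x ∈ gradedPermsPlus) :
    cop x = x ⊗ₜ word [] + word [] ⊗ₜ x + (dprec x + dsucc x) := by
  rw [← halfCop_add, halfCop_false hx, halfCop_true hx]
  abel

lemma IsGradedPerm.std_take {w : List Biletter} (h : IsGradedPerm w) (i : ℕ) :
    IsGradedPerm (std (w.take i)) :=
  isGradedPerm_std (h.nodup.sublist ((List.take_sublist i w).map _))
    fun b hb => h.2 b (List.mem_of_mem_take hb)

lemma IsGradedPerm.std_drop {w : List Biletter} (h : IsGradedPerm w) (i : ℕ) :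
    IsGradedPerm (std (w.drop i)) :=
  isGradedPerm_std (h.nodup.sublist ((List.drop_sublist i w).map _))
    fun b hb => h.2 b (List.mem_of_mem_drop hb)

/-- The span of the graded permutations `(σ, d)` of positive length at most `n`. -/
def gradedPermsLE (n : ℕ) : Submodule ℚ (Words Biletter) :=
  Submodule.span ℚ {x | ∃ w, IsGradedPerm w ∧ w ≠ [] ∧ w.length ≤ n ∧ x = word w}

lemma word_mem_gradedPermsLE {w : List Biletter} (h : IsGradedPerm w) (h0 : w ≠ []) {n : ℕ}
    (hn : w.length ≤ n) : word w ∈ gradedPermsLE n :=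
  Submodule.subset_span ⟨w, h, h0, hn, rfl⟩

lemma gradedPermsLE_le (n : ℕ) : gradedPermsLE n ≤ gradedPermsPlus := by
  refine Submodule.span_le.2 ?_
  rintro _ ⟨w, h, h0, _, rfl⟩
  exact word_mem_gradedPermsPlus h h0

lemma dprec_mem_tensorSquare {x : Words Biletter} (hx : x ∈ gradedPermsPlus) :
    dprec x ∈ tensorSquare gradedPermsPlus := by
  induction hx using gradedPermsPlus_induction with
  | h w hw h0 =>
    rw [dprec_word]
    refine Submodule.sum_mem _ fun i hi => ?_
    rw [Finset.mem_Ico] at hi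
    split_ifs
    · exact tmul_mem_tensorSquare
        (word_mem_gradedPermsPlus (hw.std_take i) (by
          rw [← List.length_pos_iff, length_std, List.length_take]; omega))
        (word_mem_gradedPermsPlus (hw.std_drop i) (by
          rw [← List.length_pos_iff, length_std, List.length_drop]; omega))
    · exact zero_mem _
  | h0 => simp
  | hadd x y _ _ hx hy => rw [map_add]; exact add_mem hx hy
  | hsmul c x _ hx => rw [map_smul]; exact Submodule.smul_mem _ _ hx

lemma dsucc_mem_tensorSquare {x : Words Biletter} (hx : x ∈ gradedPermsPlus) :
    dsucc x ∈ tensorSquare gradedPermsPlus := by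
  induction hx using gradedPermsPlus_induction with
  | h w hw h0 =>
    rw [dsucc_word]
    refine Submodule.sum_mem _ fun i hi => ?_
    rw [Finset.mem_Ico] at hi
    split_ifs
    · exact tmul_mem_tensorSquare
        (word_mem_gradedPermsPlus (hw.std_take i) (by
          rw [← List.length_pos_iff, length_std, List.length_take]; omega))
        (word_mem_gradedPermsPlus (hw.std_drop i) (by
          rw [← List.length_pos_iff, length_std, List.length_drop]; omega))
    · exact zero_mem _
  | h0 => simp
  | hadd x y _ _ hx hy => rw [map_add]; exact add_mem hx hy
  | hsmul c x _ hx => rw [map_smul]; exact Submodule.smul_mem _ _ hx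

end Coproducts

/-! ### Compatibility of half-products and half-coproducts -/

section Compatibility

lemma gmul_of_mem {x y : Words Biletter} (hx : x ∈ gradedPermsPlus) :
    gmul x y = prec x y + succ x y := by
  rw [gmul_eq_add, eps_of_mem_gradedPermsPlus hx]; simp

lemma prec_one {x : Words Biletter} (hx : x ∈ gradedPermsPlus) : prec x (word []) = x := by
  rw [prec_nil_right, eps_of_mem_gradedPermsPlus hx]; simp

lemma one_succ {x : Words Biletter} (hx : x ∈ gradedPermsPlus) : succ (word []) x = x := by
  rw [succ_nil_left, eps_of_mem_gradedPermsPlus hx]; simp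

lemma map_congr_tensorSquare {V : Type*} [AddCommGroup V] [Module ℚ V] {D : Submodule ℚ V}
    {f f' g g' : V →ₗ[ℚ] V} (hf : ∀ a ∈ D, f a = f' a) (hg : ∀ a ∈ D, g a = g' a)
    {z : V ⊗[ℚ] V} (hz : z ∈ tensorSquare D) :
    TensorProduct.map f g z = TensorProduct.map f' g' z :=
  eq_on_tensorSquare (fun a ha b hb => by simp [hf a ha, hg b hb]) hz

lemma map₂_apply_tmul_right {V : Type*} [AddCommGroup V] [Module ℚ V]
    (f g : V →ₗ[ℚ] V →ₗ[ℚ] V) (X : V ⊗[ℚ] V) (b d : V) :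
    TensorProduct.map₂ f g X (b ⊗ₜ d) = TensorProduct.map (f.flip b) (g.flip d) X := by
  have h := map₂_flip_flip f g
  rw [← TensorProduct.map₂_apply_tmul, h]
  rfl

lemma map₂_gmul (f : Words Biletter →ₗ[ℚ] Words Biletter →ₗ[ℚ] Words Biletter)
    {X Y : Words Biletter ⊗[ℚ] Words Biletter} (hX : X ∈ tensorSquare gradedPermsPlus) :
    TensorProduct.map₂ f gmul X Y = TensorProduct.map₂ f (prec + succ) X Y := by
  have : (TensorProduct.map₂ f gmul).flip Y X = (TensorProduct.map₂ f (prec + succ)).flip Y X := by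
    refine eq_on_tensorSquare (fun a _ b hb => ?_) hX
    simp only [LinearMap.flip_apply, TensorProduct.map₂_apply_tmul]
    congr 2
    exact LinearMap.ext fun y => gmul_of_mem hb
  exact this

variable {a b : Words Biletter}

lemma gmul_nil : gmul (word []) = LinearMap.id := LinearMap.ext fun x => by simp

lemma gmul_flip_nil : gmul.flip (word []) = LinearMap.id := LinearMap.ext fun x => by simp

/-- The compatibilities of `dprec` and `dsucc` with the half-products are those of `halfCop`, with
the terms `1 ⊗ x` and `x ⊗ 1` of the unital coproducts expanded. -/
lemma dprec_prec (ha : a ∈ gradedPermsPlus) (hb : b ∈ gradedPermsPlus) : dprec (prec a b) =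
    TensorProduct.map₂ prec (prec + succ) (dprec a) (dprec b + dsucc b) +
    ((prec + succ).flip b).lTensor _ (dprec a) + (prec a).rTensor _ (dprec b + dsucc b) +
    (prec.flip b).rTensor _ (dprec a) + a ⊗ₜ b := by
  have hb' := gradedPermsPlus_le hb
  have h := halfCop_prec false ha hb'
  have hd := dprec_mem_tensorSquare ha
  rw [halfCop_false (prec_mem (gradedPermsPlus_le ha) hb'), halfCop_false ha, cop_eq hb] at h
  simp only [Bool.false_eq_true, if_false, zero_add] at h
  simp only [map_add _ (_ ⊗ₜ[ℚ] _) (dprec a), map_add _ (_ + _) (dprec b + dsucc b),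
    map_add _ (b ⊗ₜ[ℚ] _) _,
    LinearMap.add_apply, map₂_apply_tmul_right, TensorProduct.map_tmul, LinearMap.flip_apply,
    gmul_nil_right, prec_one ha, gmul_nil_left] at h
  rw [TensorProduct.map₂_apply_tmul, gmul_nil, map₂_gmul prec hd,
    map_congr_tensorSquare (f := prec.flip (word [])) (g := gmul.flip b) (f' := LinearMap.id)
      (g' := (prec + succ).flip b) (fun x hx => by simp [prec_one hx])
      (fun x hx => by simp [gmul_of_mem hx]) hd,
    gmul_flip_nil] at h
  rw [LinearMap.lTensor, LinearMap.rTensor, LinearMap.rTensor]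
  have h' := congrArg (fun z => z - prec a b ⊗ₜ[ℚ] word []) h
  simp only [add_sub_cancel_left] at h'
  rw [h']
  abel

lemma dsucc_prec (ha : a ∈ gradedPermsPlus) (hb : b ∈ gradedPermsPlus) : dsucc (prec a b) =
    TensorProduct.map₂ prec (prec + succ) (dsucc a) (dprec b + dsucc b) +
    ((prec + succ).flip b).lTensor _ (dsucc a) + (prec.flip b).rTensor _ (dsucc a) := by
  have hb' := gradedPermsPlus_le hb
  have h := halfCop_prec true ha hb'
  have hd := dsucc_mem_tensorSquare ha
  have h0 : prec (word []) = 0 := LinearMap.ext fun x => by simp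
  rw [halfCop_true (prec_mem (gradedPermsPlus_le ha) hb'), halfCop_true ha, cop_eq hb] at h
  simp only [if_true, add_right_inj] at h
  simp only [map_add _ (_ ⊗ₜ[ℚ] _) (dsucc a), map_add _ (_ + _) (dprec b + dsucc b),
    map_add _ (b ⊗ₜ[ℚ] _) _, prec_nil_left, TensorProduct.zero_tmul,
    LinearMap.add_apply, map₂_apply_tmul_right, TensorProduct.map_tmul, LinearMap.flip_apply] at h
  rw [TensorProduct.map₂_apply_tmul, map₂_gmul prec hd, h0, gmul_flip_nil,
    TensorProduct.map_zero_left, LinearMap.zero_apply,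
    map_congr_tensorSquare (f := prec.flip (word [])) (g := gmul.flip b) (f' := LinearMap.id)
      (g' := (prec + succ).flip b) (fun x hx => by simp [prec_one hx])
      (fun x hx => by simp [gmul_of_mem hx]) hd] at h
  rw [LinearMap.lTensor, LinearMap.rTensor, h]
  abel

lemma dprec_succ (ha : a ∈ gradedPermsPlus) (hb : b ∈ gradedPermsPlus) : dprec (succ a b) =
    TensorProduct.map₂ succ (prec + succ) (dprec a) (dprec b + dsucc b) +
    (succ a).rTensor _ (dprec b + dsucc b) + (succ.flip b).rTensor _ (dprec a) := by
  have hb' := gradedPermsPlus_le hb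
  have h := halfCop_succ false ha hb'
  have hd := dprec_mem_tensorSquare ha
  have h0 : succ.flip (word []) = 0 := LinearMap.ext fun x => by simp
  rw [halfCop_false (succ_mem (gradedPermsPlus_le ha) hb'), halfCop_false ha, cop_eq hb] at h
  simp only [Bool.false_eq_true, if_false, zero_add] at h
  simp only [map_add _ (_ ⊗ₜ[ℚ] _) (dprec a), map_add _ (_ + _) (dprec b + dsucc b),
    map_add _ (b ⊗ₜ[ℚ] _) _, succ_nil_right, TensorProduct.zero_tmul,
    LinearMap.add_apply, map₂_apply_tmul_right, TensorProduct.map_tmul, LinearMap.flip_apply,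
    gmul_nil_left] at h
  rw [TensorProduct.map₂_apply_tmul, gmul_nil, map₂_gmul succ hd, h0, gmul_flip_nil,
    TensorProduct.map_zero_left, LinearMap.zero_apply] at h
  rw [LinearMap.rTensor, LinearMap.rTensor]
  have h' := congrArg (fun z => z - succ a b ⊗ₜ[ℚ] word []) h
  simp only [add_sub_cancel_left] at h'
  rw [h']
  abel

lemma dsucc_succ (ha : a ∈ gradedPermsPlus) (hb : b ∈ gradedPermsPlus) : dsucc (succ a b) =
    TensorProduct.map₂ succ (prec + succ) (dsucc a) (dprec b + dsucc b) +
    ((prec + succ) a).lTensor _ (dprec b + dsucc b) + (succ.flip b).rTensor _ (dsucc a) +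
    b ⊗ₜ a := by
  have hb' := gradedPermsPlus_le hb
  have h := halfCop_succ true ha hb'
  have hd := dsucc_mem_tensorSquare ha
  have hd' := add_mem (dprec_mem_tensorSquare hb) (dsucc_mem_tensorSquare hb)
  have h0 : succ.flip (word []) = 0 := LinearMap.ext fun x => by simp
  rw [halfCop_true (succ_mem (gradedPermsPlus_le ha) hb'), halfCop_true ha, cop_eq hb] at h
  simp only [if_true, add_right_inj] at h
  simp only [map_add _ (_ ⊗ₜ[ℚ] _) (dsucc a), map_add _ (_ + _) (dprec b + dsucc b),
    map_add _ (b ⊗ₜ[ℚ] _) _, succ_nil_right, TensorProduct.zero_tmul, one_succ hb,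
    LinearMap.add_apply, map₂_apply_tmul_right, TensorProduct.map_tmul, LinearMap.flip_apply,
    gmul_nil_right] at h
  rw [TensorProduct.map₂_apply_tmul, map₂_gmul succ hd, h0, gmul_flip_nil,
    TensorProduct.map_zero_left, LinearMap.zero_apply,
    map_congr_tensorSquare (f := succ (word [])) (g := gmul a) (f' := LinearMap.id)
      (g' := (prec + succ) a) (fun x hx => by simp [one_succ hx])
      (fun x hx => by simp [gmul_of_mem ha]) hd'] at h
  rw [LinearMap.lTensor, LinearMap.rTensor, h]
  abel

end Compatibility

/-! ### Coassociativity -/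

section Coassociativity

/-- The least entry of the first row, `⊤` for the empty word. -/
def minFst : List Biletter → ℕ∞
  | [] => ⊤
  | b :: w => min (b.1 : ℕ∞) (minFst w)

lemma minFst_append (x y : List Biletter) : minFst (x ++ y) = min (minFst x) (minFst y) := by
  induction x with
  | nil => simp [minFst]
  | cons b x ih => simp [minFst, ih, min_assoc]

lemma lt_minFst {m : ℕ} {x : List Biletter} : (m : ℕ∞) < minFst x ↔ ∀ b ∈ x, m < b.1 := by
  induction x with
  | nil => simp [minFst]
  | cons b x ih => rw [minFst, lt_min_iff, ih]; simp

lemma minFst_le {x : List Biletter} {b : Biletter} (hb : b ∈ x) : minFst x ≤ b.1 := by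
  by_contra h
  push Not at h
  exact lt_irrefl _ (lt_minFst.1 h b hb)

lemma exists_minFst {x : List Biletter} (h : x ≠ []) : ∃ b ∈ x, minFst x = b.1 := by
  induction x with
  | nil => exact absurd rfl h
  | cons b x ih =>
    rcases eq_or_ne x [] with rfl | hx
    · exact ⟨b, by simp, by simp [minFst]⟩
    · obtain ⟨c, hc, h⟩ := ih hx
      rcases le_total (b.1 : ℕ∞) (minFst x) with h' | h'
      · exact ⟨b, by simp, by simp [minFst, h']⟩
      · exact ⟨c, by simp [hc], by rw [minFst, min_eq_right h', h]⟩

lemma minFst_ne {x y : List Biletter} (h : ((x ++ y).map Prod.fst).Nodup) (hx : x ≠ [])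
    (hy : y ≠ []) : minFst x ≠ minFst y := by
  obtain ⟨b, hb, h1⟩ := exists_minFst hx
  obtain ⟨c, hc, h2⟩ := exists_minFst hy
  rw [h1, h2]
  rw [List.map_append] at h
  intro h3
  exact List.disjoint_of_nodup_append h (List.mem_map_of_mem hb)
    (by rw [Nat.cast_inj.1 h3]; exact List.mem_map_of_mem hc)

/-- The letter of rank `1` is in the part containing the least entry. -/
lemma exists_rank_one_iff {w x y : List Biletter} (hw : w.Perm (x ++ y))
    (hn : (w.map Prod.fst).Nodup) :
    1 ∈ (x.map (rankIn w)).map Prod.fst ↔ minFst x < minFst y := by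
  have hcount : ∀ b : Biletter, w.countP (·.1 ≤ b.1) =
      x.countP (·.1 ≤ b.1) + y.countP (·.1 ≤ b.1) := fun b => by
    rw [hw.countP_eq, List.countP_append]
  simp only [List.map_map, List.mem_map, Function.comp, rankIn]
  constructor
  · rintro ⟨b, hb, h1⟩
    refine lt_of_le_of_lt (minFst_le hb) (lt_minFst.2 fun c hc => ?_)
    by_contra hle
    push Not at hle
    have h2 : 0 < x.countP (·.1 ≤ b.1) := List.countP_pos_iff.2 ⟨b, hb, by simp⟩
    have h3 : 0 < y.countP (·.1 ≤ b.1) := List.countP_pos_iff.2 ⟨c, hc, by simpa using hle⟩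
    rw [hcount] at h1
    omega
  · intro h
    have hx : x ≠ [] := by rintro rfl; simp [minFst] at h
    obtain ⟨b, hb, h1⟩ := exists_minFst hx
    refine ⟨b, hb, ?_⟩
    rw [hcount]
    have h2 : y.countP (·.1 ≤ b.1) = 0 := by
      rw [List.countP_eq_zero]
      intro c hc
      rw [h1] at h
      have := lt_minFst.1 h c hc
      simp; omega
    have h3 : x.countP (·.1 ≤ b.1) = (x.map Prod.fst).count b.1 := by
      rw [List.count, List.countP_map]
      refine List.countP_congr fun c hc => ?_
      have h4 := minFst_le hc
      rw [h1, Nat.cast_le] at h4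
      simp only [decide_eq_true_eq, Function.comp, beq_iff_eq]
      omega
    have hnx : (x.map Prod.fst).Nodup := by
      have := (hw.map Prod.fst).nodup_iff.1 hn
      rw [List.map_append] at this
      exact this.of_append_left
    rw [h2, h3, List.count_eq_one_of_mem hnx (List.mem_map_of_mem hb)]

open Classical in
/-- The sum of the standardized cuts of `w` into two nonempty parts with the property `P`. -/
def cutSum (P : List Biletter → List Biletter → Prop) (w : List Biletter) :
    Words Biletter ⊗[ℚ] Words Biletter :=
  ∑ i ∈ Finset.Ico 1 w.length,
    if P (w.take i) (w.drop i) then word (std (w.take i)) ⊗ₜ[ℚ] word (std (w.drop i)) else 0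

lemma std_take_std (w : List Biletter) (i : ℕ) : std ((std w).take i) = std (w.take i) := by
  rw [std_eq w, ← List.map_take]
  exact std_sublist_std (List.take_subset i w)

lemma std_drop_std (w : List Biletter) (i : ℕ) : std ((std w).drop i) = std (w.drop i) := by
  rw [std_eq w, ← List.map_drop]
  exact std_sublist_std (List.drop_subset i w)

lemma dprec_std {w : List Biletter} (hn : (w.map Prod.fst).Nodup) :
    dprec (word (std w)) = cutSum (fun x y => minFst x < minFst y) w := by
  rw [dprec_word, length_std, cutSum]
  refine Finset.sum_congr rfl fun i _ => ?_
  rw [std_take_std, std_drop_std]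
  have h := exists_rank_one_iff (x := w.take i) (y := w.drop i)
    (by rw [List.take_append_drop]) hn
  rw [List.map_take, ← std_eq] at h
  split_ifs <;> tauto

lemma dsucc_std {w : List Biletter} (hn : (w.map Prod.fst).Nodup) :
    dsucc (word (std w)) = cutSum (fun x y => minFst y < minFst x) w := by
  rw [dsucc_word, length_std, cutSum]
  refine Finset.sum_congr rfl fun i _ => ?_
  rw [std_take_std, std_drop_std]
  have h := exists_rank_one_iff (x := w.drop i) (y := w.take i)
    (List.Perm.trans (by rw [List.take_append_drop]) List.perm_append_comm) hn
  rw [List.map_drop, ← std_eq] at h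
  split_ifs <;> tauto

lemma dprec_add_dsucc_std {w : List Biletter} (hn : (w.map Prod.fst).Nodup) :
    (dprec + dsucc) (word (std w)) = cutSum (fun _ _ => True) w := by
  rw [LinearMap.add_apply, dprec_std hn, dsucc_std hn, cutSum, cutSum, cutSum,
    ← Finset.sum_add_distrib]
  refine Finset.sum_congr rfl fun i hi => ?_
  rw [Finset.mem_Ico] at hi
  have h : minFst (w.take i) ≠ minFst (w.drop i) := by
    refine minFst_ne (by rwa [List.take_append_drop]) ?_ ?_
    · rw [← List.length_pos_iff, List.length_take]; omega
    · rw [← List.length_pos_iff, List.length_drop]; omega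
  rcases lt_or_gt_of_ne h with h | h
  · simp [h, h.le]
  · simp [h, h.le]

/-- Double cuts: cutting the left part of a cut, or the right part, gives the same sums of triples
when the conditions on the three parts agree. -/
lemma cutSum_coassoc {w : List Biletter} {P P' Q Q' : List Biletter → List Biletter → Prop}
    {δ δ' : Words Biletter →ₗ[ℚ] Words Biletter ⊗[ℚ] Words Biletter}
    (hn : (w.map Prod.fst).Nodup)
    (hδ : ∀ {x : List Biletter}, (x.map Prod.fst).Nodup → δ (word (std x)) = cutSum P' x)
    (hδ' : ∀ {x : List Biletter}, (x.map Prod.fst).Nodup → δ' (word (std x)) = cutSum Q' x)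
    (h : ∀ x y z, x ≠ [] → y ≠ [] → z ≠ [] → ((x ++ y ++ z).map Prod.fst).Nodup →
      (P (x ++ y) z ∧ P' x y ↔ Q x (y ++ z) ∧ Q' y z)) :
    TensorProduct.assoc ℚ _ _ _ (δ.rTensor _ (cutSum P w)) = δ'.lTensor _ (cutSum Q w) := by
  classical
  set T : ℕ → ℕ → Words Biletter ⊗[ℚ] (Words Biletter ⊗[ℚ] Words Biletter) := fun i j =>
    if P (w.take j) (w.drop j) ∧ P' (w.take i) ((w.drop i).take (j - i)) then
      word (std (w.take i)) ⊗ₜ (word (std ((w.drop i).take (j - i))) ⊗ₜ word (std (w.drop j)))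
    else 0 with hT
  have e1 : TensorProduct.assoc ℚ _ _ _ (δ.rTensor _ (cutSum P w)) =
      ∑ j ∈ Finset.Ico 1 w.length, ∑ i ∈ Finset.Ico 1 j, T i j := by
    rw [cutSum, map_sum, map_sum]
    refine Finset.sum_congr rfl fun j hj => ?_
    rw [Finset.mem_Ico] at hj
    by_cases hP : P (w.take j) (w.drop j)
    · rw [if_pos hP, LinearMap.rTensor_tmul,
        hδ (hn.sublist ((List.take_sublist j w).map _)), cutSum, List.length_take,
        min_eq_left (by omega), TensorProduct.sum_tmul, map_sum]
      refine Finset.sum_congr rfl fun i hi => ?_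
      rw [Finset.mem_Ico] at hi
      have t1 : (w.take j).take i = w.take i := by rw [List.take_take, min_eq_left (by omega)]
      have t2 : (w.take j).drop i = (w.drop i).take (j - i) := by
        rw [List.drop_take]
      rw [t1, t2, hT]
      simp only [hP, true_and]
      split_ifs <;> simp
    · simp [hP, hT]
  have e2 : δ'.lTensor _ (cutSum Q w) =
      ∑ i ∈ Finset.Ico 1 w.length, ∑ j ∈ Finset.Ico (i + 1) w.length, T i j := by
    rw [cutSum, map_sum]
    refine Finset.sum_congr rfl fun i hi => ?_
    rw [Finset.mem_Ico] at hi
    have hTij : ∀ k, 1 ≤ k → k < w.length - i → T i (k + i) =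
        if Q (w.take i) (w.drop i) ∧ Q' ((w.drop i).take k) ((w.drop i).drop k) then
          word (std (w.take i)) ⊗ₜ[ℚ]
            (word (std ((w.drop i).take k)) ⊗ₜ[ℚ] word (std ((w.drop i).drop k))) else 0 := by
      intro k hk1 hk2
      have d1 : w.drop (k + i) = (w.drop i).drop k := by rw [List.drop_drop, add_comm]
      have d2 : w.take (k + i) = w.take i ++ (w.drop i).take k := by
        rw [add_comm, List.take_add]
      have d3 : (w.drop i).take k ++ (w.drop i).drop k = w.drop i := List.take_append_drop _ _
      simp only [hT, Nat.add_sub_cancel]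
      rw [d1, d2]
      refine if_congr ?_ rfl rfl
      have := h (w.take i) ((w.drop i).take k) ((w.drop i).drop k)
        (by rw [← List.length_pos_iff, List.length_take]; omega)
        (by rw [← List.length_pos_iff, List.length_take, List.length_drop]; omega)
        (by rw [← List.length_pos_iff, List.length_drop, List.length_drop]; omega)
        (by rwa [List.append_assoc, d3, List.take_append_drop])
      rwa [d3] at this
    have hshift : ∑ j ∈ Finset.Ico (i + 1) w.length, T i j =
        ∑ k ∈ Finset.Ico 1 (w.length - i), T i (k + i) := by
      rw [Finset.sum_Ico_add' (fun j => T i j), add_comm 1 i, Nat.sub_add_cancel (by omega)]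
    rw [hshift]
    by_cases hQ : Q (w.take i) (w.drop i)
    · rw [if_pos hQ, LinearMap.lTensor_tmul,
        hδ' (hn.sublist ((List.drop_sublist i w).map _)), cutSum, List.length_drop,
        TensorProduct.tmul_sum]
      refine Finset.sum_congr rfl fun k hk => ?_
      rw [Finset.mem_Ico] at hk
      rw [hTij k hk.1 hk.2]
      simp only [hQ, true_and]
      split_ifs <;> simp
    · rw [if_neg hQ, map_zero]
      refine (Finset.sum_eq_zero fun k hk => ?_).symm
      rw [Finset.mem_Ico] at hk
      rw [hTij k hk.1 hk.2, if_neg (fun hh => hQ hh.1)]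
  rw [e1, e2, ← Finset.sum_Ico_Ico_comm']

lemma eq_of_mem_gradedPermsPlus {M : Type*} [AddCommGroup M] [Module ℚ M]
    {f g : Words Biletter →ₗ[ℚ] M}
    (h : ∀ w, IsGradedPerm w → f (word w) = g (word w)) {x : Words Biletter}
    (hx : x ∈ gradedPermsPlus) : f x = g x := by
  induction hx using gradedPermsPlus_induction with
  | h w hw _ => exact h w hw
  | h0 => simp
  | hadd x y _ _ hx hy => rw [map_add, map_add, hx, hy]
  | hsmul c x _ hx => rw [map_smul, map_smul, hx]

/-- Both sides sum over the cuts into three parts with the least entry in the first one. -/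
lemma dprec_dprec {a : Words Biletter} (ha : a ∈ gradedPermsPlus) :
    TensorProduct.assoc ℚ _ _ _ (dprec.rTensor _ (dprec a)) =
      (dprec + dsucc).lTensor _ (dprec a) := by
  refine eq_of_mem_gradedPermsPlus (f := (TensorProduct.assoc ℚ _ _ _).toLinearMap ∘ₗ
    dprec.rTensor _ ∘ₗ dprec) (g := (dprec + dsucc).lTensor _ ∘ₗ dprec) (fun w hw => ?_) ha
  have := dprec_std hw.nodup
  rw [std_of_isGradedPerm hw] at this
  simp only [LinearMap.comp_apply, this]
  refine cutSum_coassoc hw.nodup dprec_std dprec_add_dsucc_std fun x y z hx hy hz hn => ?_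
  rw [minFst_append, minFst_append, min_lt_iff, lt_min_iff]
  constructor
  · rintro ⟨h | h, h'⟩
    · exact ⟨⟨h', h⟩, trivial⟩
    · exact ⟨⟨h', h'.trans h⟩, trivial⟩
  · rintro ⟨⟨h, h'⟩, -⟩
    exact ⟨Or.inl h', h⟩

/-- Both sides sum over the cuts into three parts with the least entry in the second one. -/
lemma dsucc_dprec {a : Words Biletter} (ha : a ∈ gradedPermsPlus) :
    TensorProduct.assoc ℚ _ _ _ (dsucc.rTensor _ (dprec a)) = dprec.lTensor _ (dsucc a) := by
  refine eq_of_mem_gradedPermsPlus (f := (TensorProduct.assoc ℚ _ _ _).toLinearMap ∘ₗ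
    dsucc.rTensor _ ∘ₗ dprec) (g := dprec.lTensor _ ∘ₗ dsucc) (fun w hw => ?_) ha
  have h1 := dprec_std hw.nodup
  have h2 := dsucc_std hw.nodup
  rw [std_of_isGradedPerm hw] at h1 h2
  simp only [LinearMap.comp_apply, h1, h2]
  refine cutSum_coassoc hw.nodup dsucc_std dprec_std fun x y z hx hy hz hn => ?_
  rw [minFst_append, minFst_append, min_lt_iff, min_lt_iff]
  constructor
  · rintro ⟨h | h, h'⟩
    · exact ⟨Or.inl h', h'.trans h⟩
    · exact ⟨Or.inl h', h⟩
  · rintro ⟨h | h, h'⟩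
    · exact ⟨Or.inr h', h⟩
    · exact ⟨Or.inr h', h'.trans h⟩

/-- Both sides sum over the cuts into three parts with the least entry in the third one. -/
lemma dsucc_dsucc {a : Words Biletter} (ha : a ∈ gradedPermsPlus) :
    TensorProduct.assoc ℚ _ _ _ ((dprec + dsucc).rTensor _ (dsucc a)) =
      dsucc.lTensor _ (dsucc a) := by
  refine eq_of_mem_gradedPermsPlus (f := (TensorProduct.assoc ℚ _ _ _).toLinearMap ∘ₗ
    (dprec + dsucc).rTensor _ ∘ₗ dsucc) (g := dsucc.lTensor _ ∘ₗ dsucc) (fun w hw => ?_) ha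
  have h2 := dsucc_std hw.nodup
  rw [std_of_isGradedPerm hw] at h2
  simp only [LinearMap.comp_apply, h2]
  refine cutSum_coassoc hw.nodup dprec_add_dsucc_std dsucc_std fun x y z hx hy hz hn => ?_
  rw [minFst_append, minFst_append, lt_min_iff, min_lt_iff]
  constructor
  · rintro ⟨⟨h, h'⟩, -⟩
    exact ⟨Or.inr h, h'⟩
  · rintro ⟨h | h, h'⟩
    · exact ⟨⟨h'.trans h, h'⟩, trivial⟩
    · exact ⟨⟨h, h'⟩, trivial⟩

end Coassociativity

/-! ### The opposite bidendriform structure -/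

section Opposite

variable {V : Type*} [AddCommGroup V] [Module ℚ V]

/-- The reversal `a ⊗ (b ⊗ c) ↦ c ⊗ (b ⊗ a)`. -/
def reverse₃ : V ⊗[ℚ] (V ⊗[ℚ] V) →ₗ[ℚ] V ⊗[ℚ] (V ⊗[ℚ] V) :=
  (TensorProduct.assoc ℚ V V V).toLinearMap ∘ₗ
    (TensorProduct.comm ℚ V (V ⊗[ℚ] V)).toLinearMap ∘ₗ
      (TensorProduct.comm ℚ V V).toLinearMap.lTensor V

lemma assoc_rTensor_comm (δ : V →ₗ[ℚ] V ⊗[ℚ] V) (z : V ⊗[ℚ] V) :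
    TensorProduct.assoc ℚ V V V (((TensorProduct.comm ℚ V V).toLinearMap ∘ₗ δ).rTensor V
      (TensorProduct.comm ℚ V V z)) = reverse₃ (δ.lTensor V z) := by
  induction z using TensorProduct.induction_on with
  | zero => simp
  | tmul a b => simp [reverse₃]
  | add x y hx hy => simp only [map_add, hx, hy]

lemma reverse₃_assoc (z : (V ⊗[ℚ] V) ⊗[ℚ] V) :
    reverse₃ (TensorProduct.assoc ℚ V V V z) = (TensorProduct.comm ℚ V V).toLinearMap.lTensor V
      (TensorProduct.comm ℚ _ V z) := by
  induction z using TensorProduct.induction_on with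
  | zero => simp
  | add x y hx hy => simp only [map_add, hx, hy]
  | tmul a b =>
    induction a using TensorProduct.induction_on with
    | zero => simp
    | add x y hx hy => simp only [map_add, hx, hy, TensorProduct.add_tmul]
    | tmul a c => simp [reverse₃]

lemma lTensor_comm (δ : V →ₗ[ℚ] V ⊗[ℚ] V) (z : V ⊗[ℚ] V) :
    ((TensorProduct.comm ℚ V V).toLinearMap ∘ₗ δ).lTensor V (TensorProduct.comm ℚ V V z) =
      reverse₃ (TensorProduct.assoc ℚ V V V (δ.rTensor V z)) := by
  rw [reverse₃_assoc]
  induction z using TensorProduct.induction_on with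
  | zero => simp
  | tmul a b => simp
  | add x y hx hy => simp only [map_add, hx, hy]

lemma comm_map₂ (f g : V →ₗ[ℚ] V →ₗ[ℚ] V) (X Y : V ⊗[ℚ] V) :
    TensorProduct.comm ℚ V V (TensorProduct.map₂ f g X Y) =
      TensorProduct.map₂ g.flip f.flip (TensorProduct.comm ℚ V V Y)
        (TensorProduct.comm ℚ V V X) := by
  have : (TensorProduct.map₂ f g).compr₂ (TensorProduct.comm ℚ V V).toLinearMap =
      (TensorProduct.map₂ g.flip f.flip).flip.compl₁₂ (TensorProduct.comm ℚ V V).toLinearMap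
        (TensorProduct.comm ℚ V V).toLinearMap := tmul_hom_ext₂ fun a b c d => by simp
  exact LinearMap.congr_fun₂ this X Y

lemma comm_rTensor (f : V →ₗ[ℚ] V) (X : V ⊗[ℚ] V) :
    TensorProduct.comm ℚ V V (f.rTensor V X) = f.lTensor V (TensorProduct.comm ℚ V V X) := by
  induction X using TensorProduct.induction_on with
  | zero => simp
  | tmul a b => simp
  | add x y hx hy => simp only [map_add, hx, hy]

lemma comm_lTensor (f : V →ₗ[ℚ] V) (X : V ⊗[ℚ] V) :
    TensorProduct.comm ℚ V V (f.lTensor V X) = f.rTensor V (TensorProduct.comm ℚ V V X) := by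
  induction X using TensorProduct.induction_on with
  | zero => simp
  | tmul a b => simp
  | add x y hx hy => simp only [map_add, hx, hy]

lemma comm_mem_tensorSquare {D : Submodule ℚ V} {X : V ⊗[ℚ] V} (hX : X ∈ tensorSquare D) :
    TensorProduct.comm ℚ V V X ∈ tensorSquare D :=
  map_mem_of_tensorSquare (f := (TensorProduct.comm ℚ V V).toLinearMap)
    (fun a ha b hb => by simpa using tmul_mem_tensorSquare hb ha) hX

lemma prec_prec_of_mem {b : Words Biletter} (a c : Words Biletter) (hb : b ∈ gradedPermsPlus) :
    prec (prec a b) c = prec a (prec b c + succ b c) := by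
  rw [prec_prec, gmul_of_mem hb]

lemma succ_succ_of_mem {a : Words Biletter} (b c : Words Biletter) (ha : a ∈ gradedPermsPlus) :
    succ (prec a b + succ a b) c = succ a (succ b c) := by
  rw [← gmul_of_mem ha, succ_succ]

/-- `D` is a subspace of `S_+` stable under the half-products and the half-coproducts. -/
structure IsStable (D : Submodule ℚ (Words Biletter)) : Prop where
  le : D ≤ gradedPermsPlus
  prec_mem : ∀ a ∈ D, ∀ b ∈ D, prec a b ∈ D
  succ_mem : ∀ a ∈ D, ∀ b ∈ D, succ a b ∈ D
  dprec_mem : ∀ a ∈ D, dprec a ∈ tensorSquare D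
  dsucc_mem : ∀ a ∈ D, dsucc a ∈ tensorSquare D

lemma isStable_gradedPermsPlus : IsStable gradedPermsPlus where
  le := le_rfl
  prec_mem _ ha _ hb := prec_mem (gradedPermsPlus_le ha) (gradedPermsPlus_le hb)
  succ_mem _ ha _ hb := succ_mem (gradedPermsPlus_le ha) (gradedPermsPlus_le hb)
  dprec_mem _ := dprec_mem_tensorSquare
  dsucc_mem _ := dsucc_mem_tensorSquare

/-- A stable subspace is a bidendriform bialgebra for the opposite operations: transposition turns
each compatibility and each coassociativity into the one for the other half-product. -/
lemma IsStable.isBidendriformOp {D : Submodule ℚ (Words Biletter)} (h : IsStable D) :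
    IsBidendriformOp D := by
  have hD := h.le
  have hadd : succ.flip + prec.flip = (prec + succ).flip :=
    LinearMap.ext₂ fun x y => add_comm _ _
  have hcomm : (TensorProduct.comm ℚ (Words Biletter) (Words Biletter)).toLinearMap ∘ₗ dsucc +
      (TensorProduct.comm ℚ (Words Biletter) (Words Biletter)).toLinearMap ∘ₗ dprec =
      (TensorProduct.comm ℚ (Words Biletter) (Words Biletter)).toLinearMap ∘ₗ (dprec + dsucc) := by
    rw [LinearMap.comp_add, add_comm]
  constructor
  · exact fun a ha b hb => h.succ_mem b hb a ha
  · exact fun a ha b hb => h.prec_mem b hb a ha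
  · exact fun a ha => comm_mem_tensorSquare (h.dsucc_mem a ha)
  · exact fun a ha => comm_mem_tensorSquare (h.dprec_mem a ha)
  · intro a ha b hb c hc
    simp only [LinearMap.flip_apply]
    rw [add_comm, succ_succ_of_mem _ _ (hD hc)]
  · intro a _ b _ c _
    simp only [LinearMap.flip_apply]
    rw [succ_prec]
  · intro a ha b hb c hc
    simp only [LinearMap.flip_apply]
    rw [add_comm, prec_prec_of_mem _ _ (hD hb)]
  · intro a ha
    rw [hcomm]
    simp only [LinearMap.comp_apply (g := dsucc), LinearEquiv.coe_coe]
    rw [assoc_rTensor_comm, lTensor_comm, dsucc_dsucc (hD ha)]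
  · intro a ha
    simp only [LinearMap.comp_apply (g := dsucc), LinearMap.comp_apply (g := dprec),
      LinearEquiv.coe_coe]
    rw [assoc_rTensor_comm, lTensor_comm, dsucc_dprec (hD ha)]
  · intro a ha
    rw [hcomm]
    simp only [LinearMap.comp_apply (g := dprec), LinearEquiv.coe_coe]
    rw [assoc_rTensor_comm, lTensor_comm, dprec_dprec (hD ha)]
  all_goals
    intro a ha b hb
    have hca : ∀ x, (TensorProduct.comm ℚ (Words Biletter) (Words Biletter)) (dsucc x) +
      (TensorProduct.comm ℚ (Words Biletter) (Words Biletter)) (dprec x) =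
      (TensorProduct.comm ℚ (Words Biletter) (Words Biletter)) (dprec x + dsucc x) := fun x => by
        rw [map_add, add_comm]
    have hadd2 : succ.flip a + prec.flip a = (prec + succ).flip a := by
      rw [← hadd]; rfl
    simp only [LinearMap.comp_apply, LinearEquiv.coe_coe, hca, hadd, hadd2, LinearMap.flip_apply,
      LinearMap.flip_flip]
  · rw [dprec_prec (hD hb) (hD ha)]
    simp only [map_add _ (_ + _) (b ⊗ₜ[ℚ] a), map_add _ (_ + _) (LinearMap.rTensor _ _ _),
      map_add _ (TensorProduct.map₂ _ _ _ _) _, comm_map₂, comm_rTensor, comm_lTensor,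
      TensorProduct.comm_tmul]
    abel
  · rw [dprec_succ (hD hb) (hD ha)]
    simp only [map_add _ (_ + _) (LinearMap.rTensor _ _ _),
      map_add _ (TensorProduct.map₂ _ _ _ _) _, comm_map₂, comm_rTensor]
  · rw [dsucc_prec (hD hb) (hD ha)]
    simp only [map_add _ (_ + _) (LinearMap.rTensor _ _ _),
      map_add _ (TensorProduct.map₂ _ _ _ _) _, comm_map₂, comm_rTensor, comm_lTensor]
  · rw [dsucc_succ (hD hb) (hD ha)]
    simp only [map_add _ (_ + _) (a ⊗ₜ[ℚ] b), map_add _ (_ + _) (LinearMap.rTensor _ _ _),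
      map_add _ (TensorProduct.map₂ _ _ _ _) _, comm_map₂, comm_rTensor, comm_lTensor,
      TensorProduct.comm_tmul]

end Opposite

/-! ### The dendriform descent algebra -/

section Closure

variable {V : Type*} [AddCommGroup V] [Module ℚ V] {f g : V → V → V} {s : Set V}

lemma subset_dendClosure : s ⊆ dendClosure f g s := fun _ hx =>
  (Submodule.mem_sInf).2 fun _ hD => hD.1 hx

lemma dendClosure_le {D : Submodule ℚ V} (hs : s ⊆ D)
    (h : ∀ a ∈ D, ∀ b ∈ D, f a b ∈ D ∧ g a b ∈ D) : dendClosure f g s ≤ D :=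
  sInf_le ⟨hs, h⟩

lemma dendClosure_stable {a b : V} (ha : a ∈ dendClosure f g s) (hb : b ∈ dendClosure f g s) :
    f a b ∈ dendClosure f g s ∧ g a b ∈ dendClosure f g s := by
  simp only [dendClosure, Submodule.mem_sInf] at ha hb ⊢
  exact ⟨fun D hD => (hD.2 a (ha D hD) b (hb D hD)).1, fun D hD => (hD.2 a (ha D hD) b (hb D hD)).2⟩

end Closure

section Descent

/-- The biword of the identity permutation with second row `l`. -/
def idWord (l : List ℕ) : List Biletter := l.mapIdx fun i d => (i + 1, d)

@[simp] lemma length_idWord (l : List ℕ) : (idWord l).length = l.length := by simp [idWord]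

@[simp] lemma idWord_nil : idWord [] = [] := rfl

lemma isGradedPerm_idWord {l : List ℕ} (h : ∀ d ∈ l, 0 < d) : IsGradedPerm (idWord l) := by
  constructor
  · have : (idWord l).map Prod.fst = List.range' 1 (idWord l).length := by
      apply List.ext_getElem
      · simp
      · intro i h1 h2
        simp [idWord, add_comm]
    rw [this]
  · intro b hb
    rw [idWord, List.mem_mapIdx] at hb
    obtain ⟨i, hi, rfl⟩ := hb
    exact h _ (List.getElem_mem _)

/-- The compositions of `n`, as lists. -/
def compLists (n : ℕ) : Finset (List ℕ) :=
  Finset.univ.map ⟨fun c : Composition n => c.blocks, fun _ _ h => Composition.ext h⟩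

lemma mem_compLists {n : ℕ} {l : List ℕ} : l ∈ compLists n ↔ (∀ d ∈ l, 0 < d) ∧ l.sum = n := by
  simp only [compLists, Finset.mem_map, Finset.mem_univ, true_and]
  constructor
  · rintro ⟨c, rfl⟩
    exact ⟨fun d hd => c.blocks_pos hd, c.blocks_sum⟩
  · rintro ⟨h1, h2⟩
    exact ⟨⟨l, fun {d} hd => h1 d hd, h2⟩, rfl⟩

lemma p_eq (n : ℕ) : p n = ∑ l ∈ compLists n, word (idWord l) := by
  rw [compLists, Finset.sum_map, p]
  refine Finset.sum_congr rfl fun c _ => congrArg word ?_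
  apply List.ext_getElem
  · simp only [List.length_ofFn, length_idWord]
    rfl
  · intro i h1 h2
    simp only [List.getElem_ofFn, idWord, List.getElem_mapIdx]
    rfl

lemma p_zero : p 0 = word [] := by
  have : compLists 0 = {[]} := by
    ext l
    rw [mem_compLists, Finset.mem_singleton]
    constructor
    · rintro ⟨h1, h2⟩
      cases l with
      | nil => rfl
      | cons a l =>
        have := h1 a (by simp)
        simp only [List.sum_cons] at h2
        omega
    · rintro rfl
      simp
  rw [p_eq, this]
  simp

lemma p_mem {n : ℕ} (hn : 1 ≤ n) : p n ∈ gradedPermsPlus := by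
  rw [p_eq]
  refine Submodule.sum_mem _ fun l hl => ?_
  rw [mem_compLists] at hl
  refine word_mem_gradedPermsPlus (isGradedPerm_idWord hl.1) ?_
  rw [← List.length_pos_iff, length_idWord, List.length_pos_iff]
  rintro rfl
  simp at hl
  omega

lemma std_take_idWord {l : List ℕ} (h : ∀ d ∈ l, 0 < d) (i : ℕ) :
    std ((idWord l).take i) = idWord (l.take i) := by
  have : (idWord l).take i = idWord (l.take i) := by
    apply List.ext_getElem <;> simp [idWord]
  rw [this, std_of_isGradedPerm (isGradedPerm_idWord fun d hd => h d (List.mem_of_mem_take hd))]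

lemma std_drop_idWord {l : List ℕ} (h : ∀ d ∈ l, 0 < d) (i : ℕ) :
    std ((idWord l).drop i) = idWord (l.drop i) := by
  have : (idWord l).drop i = (idWord (l.drop i)).map fun b => (b.1 + i, b.2) := by
    apply List.ext_getElem
    · simp
    · intro j h1 h2
      simp [idWord]
      omega
  rw [this, std_map (by simp) (by simp),
    std_of_isGradedPerm (isGradedPerm_idWord fun d hd => h d (List.mem_of_mem_drop hd))]

lemma one_mem_take_idWord {l : List ℕ} {i : ℕ} (hi : i ∈ Finset.Ico 1 l.length) :
    1 ∈ ((idWord l).take i).map Prod.fst := by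
  rw [Finset.mem_Ico] at hi
  rw [List.mem_map]
  refine ⟨(idWord l)[0]'(by simp; omega), ?_, by simp [idWord]⟩
  rw [List.mem_take_iff_getElem]
  exact ⟨0, by simp; omega, rfl⟩

lemma one_notMem_drop_idWord {l : List ℕ} {i : ℕ} (hi : i ∈ Finset.Ico 1 l.length) :
    1 ∉ ((idWord l).drop i).map Prod.fst := by
  rw [Finset.mem_Ico] at hi
  rw [List.mem_map]
  rintro ⟨b, hb, h⟩
  rw [List.mem_drop_iff_getElem] at hb
  obtain ⟨j, hj, rfl⟩ := hb
  simp [idWord] at h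
  omega

/-- The entry `1` is the first one in a biword of an identity permutation. -/
lemma dsucc_p (n : ℕ) : dsucc (p n) = 0 := by
  rw [p_eq, map_sum]
  refine Finset.sum_eq_zero fun l _ => ?_
  rw [dsucc_word]
  refine Finset.sum_eq_zero fun i hi => ?_
  rw [if_neg (one_notMem_drop_idWord (by simpa using hi))]

/-- Cutting a biword of an identity permutation amounts to cutting the composition in its second
row. -/
lemma dprec_p (n : ℕ) : dprec (p n) = ∑ i ∈ Finset.Ico 1 n, p i ⊗ₜ[ℚ] p (n - i) := by
  have e1 : dprec (p n) = ∑ l ∈ compLists n, ∑ i ∈ Finset.Ico 1 l.length,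
      word (idWord (l.take i)) ⊗ₜ[ℚ] word (idWord (l.drop i)) := by
    rw [p_eq, map_sum]
    refine Finset.sum_congr rfl fun l hl => ?_
    rw [mem_compLists] at hl
    rw [dprec_word, length_idWord]
    refine Finset.sum_congr rfl fun i hi => ?_
    rw [if_pos (one_mem_take_idWord hi), std_take_idWord hl.1, std_drop_idWord hl.1]
  have e2 : ∑ i ∈ Finset.Ico 1 n, p i ⊗ₜ[ℚ] p (n - i) =
      ∑ i ∈ Finset.Ico 1 n, ∑ l ∈ compLists i ×ˢ compLists (n - i),
        word (idWord l.1) ⊗ₜ[ℚ] word (idWord l.2) := by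
    refine Finset.sum_congr rfl fun i _ => ?_
    rw [p_eq, p_eq, TensorProduct.sum_tmul, Finset.sum_product]
    exact Finset.sum_congr rfl fun l _ => TensorProduct.tmul_sum _ _ _
  have hpos : ∀ l : List ℕ, l ≠ [] → (∀ d ∈ l, 0 < d) → 0 < l.sum := by
    intro l hl h
    cases l with
    | nil => exact absurd rfl hl
    | cons a l =>
      have := h a (by simp)
      simp only [List.sum_cons]
      omega
  rw [e1, e2, Finset.sum_sigma', Finset.sum_sigma']
  refine Finset.sum_bij'
    (fun x _ => (⟨(x.1.take x.2).sum, (x.1.take x.2, x.1.drop x.2)⟩ : Σ _ : ℕ, List ℕ × List ℕ))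
    (fun x _ => (⟨x.2.1 ++ x.2.2, x.2.1.length⟩ : Σ _ : List ℕ, ℕ)) ?_ ?_ ?_ ?_ ?_
  · rintro ⟨l, i⟩ h
    simp only [Finset.mem_sigma, mem_compLists, Finset.mem_Ico, Finset.mem_product] at h ⊢
    obtain ⟨⟨h1, h2⟩, h3, h4⟩ := h
    have h5 : (l.take i).sum + (l.drop i).sum = n := by rw [List.sum_take_add_sum_drop, h2]
    have h6 : ∀ d ∈ l.take i, 0 < d := fun d hd => h1 d (List.mem_of_mem_take hd)
    have h7 : ∀ d ∈ l.drop i, 0 < d := fun d hd => h1 d (List.mem_of_mem_drop hd)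
    have h8 := hpos _ (by rw [← List.length_pos_iff, List.length_take]; omega) h6
    have h9 := hpos _ (by rw [← List.length_pos_iff, List.length_drop]; omega) h7
    refine ⟨⟨h8, by omega⟩, ⟨h6, trivial⟩, h7, by omega⟩
  · rintro ⟨m, l, l'⟩ h
    simp only [Finset.mem_sigma, mem_compLists, Finset.mem_Ico, Finset.mem_product] at h ⊢
    obtain ⟨⟨h1, h2⟩, ⟨h3, h4⟩, h5, h6⟩ := h
    refine ⟨⟨fun d hd => ?_, by rw [List.sum_append]; omega⟩, ?_, ?_⟩
    · rcases List.mem_append.1 hd with hd | hd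
      · exact h3 d hd
      · exact h5 d hd
    · rw [Nat.one_le_iff_ne_zero, Ne, List.length_eq_zero_iff]
      rintro rfl
      simp at h4
      omega
    · rw [List.length_append, Nat.lt_add_right_iff_pos, List.length_pos_iff]
      rintro rfl
      simp at h6
      omega
  · rintro ⟨l, i⟩ h
    simp only [Finset.mem_sigma, mem_compLists, Finset.mem_Ico] at h
    simp only [List.take_append_drop, List.length_take, Sigma.mk.injEq, heq_eq_eq, true_and]
    omega
  · rintro ⟨m, l, l'⟩ h
    simp only [Finset.mem_sigma, mem_compLists, Finset.mem_Ico, Finset.mem_product] at h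
    simp [h.2.1.2]
  · rintro ⟨l, i⟩ _
    rfl

lemma p_mem_descd (n : ℕ) : p n ∈ descd := subset_dendClosure ⟨n, rfl⟩

lemma p_mem_gradedPerms (n : ℕ) : p n ∈ gradedPerms := by
  rcases Nat.eq_zero_or_pos n with rfl | hn
  · rw [p_zero]; exact word_mem_gradedPerms isGradedPerm_nil
  · exact gradedPermsPlus_le (p_mem hn)

lemma descd_le : descd ≤ gradedPerms :=
  dendClosure_le (by rintro _ ⟨n, rfl⟩; exact p_mem_gradedPerms n) fun _ ha _ hb =>
    ⟨gradedPermsPlus_le (prec_mem ha hb), gradedPermsPlus_le (succ_mem ha hb)⟩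

/-- The dendriform algebra generated by the `p n` with `n ≥ 1`. -/
def posClosure : Submodule ℚ (Words Biletter) :=
  dendClosure (fun a b => prec a b) (fun a b => succ a b) {x | ∃ n, 1 ≤ n ∧ x = p n}

lemma posClosure_le_plus : posClosure ≤ gradedPermsPlus :=
  dendClosure_le (by rintro _ ⟨n, hn, rfl⟩; exact p_mem hn) fun _ ha _ hb =>
    ⟨prec_mem (gradedPermsPlus_le ha) (gradedPermsPlus_le hb),
      succ_mem (gradedPermsPlus_le ha) (gradedPermsPlus_le hb)⟩

lemma posClosure_le : posClosure ≤ descdPlus :=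
  le_inf (dendClosure_le (by rintro _ ⟨n, hn, rfl⟩; exact p_mem_descd n) fun _ ha _ hb =>
    dendClosure_stable ha hb) posClosure_le_plus

lemma descd_le_sup : descd ≤ Submodule.span ℚ {p 0} ⊔ posClosure := by
  refine dendClosure_le ?_ ?_
  · rintro _ ⟨n, rfl⟩
    rcases Nat.eq_zero_or_pos n with rfl | hn
    · exact Submodule.mem_sup_left (Submodule.subset_span rfl)
    · exact Submodule.mem_sup_right (subset_dendClosure ⟨n, hn, rfl⟩)
  · intro a' ha' b' hb'
    obtain ⟨x, hx, a, ha, rfl⟩ := Submodule.mem_sup.1 ha'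
    obtain ⟨y, hy, b, hb, rfl⟩ := Submodule.mem_sup.1 hb'
    obtain ⟨r, rfl⟩ := Submodule.mem_span_singleton.1 hx
    obtain ⟨s, rfl⟩ := Submodule.mem_span_singleton.1 hy
    have h : prec a b ∈ posClosure ∧ succ a b ∈ posClosure :=
      dendClosure_stable (f := fun a b => prec a b) (g := fun a b => succ a b) ha hb
    have e1 : prec (r • p 0 + a) (s • p 0 + b) = s • a + prec a b := by
      simp [p_zero, prec_one (posClosure_le_plus ha)]
    have e2 : succ (r • p 0 + a) (s • p 0 + b) = r • b + succ a b := by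
      simp [p_zero, succ_nil_left,
        eps_of_mem_gradedPermsPlus (posClosure_le_plus hb)]
    constructor
    · simp only [e1]
      exact Submodule.mem_sup_right (add_mem (Submodule.smul_mem _ _ ha) h.1)
    · simp only [e2]
      exact Submodule.mem_sup_right (add_mem (Submodule.smul_mem _ _ hb) h.2)

/-- An element of `descd` is a multiple of `p 0` plus an element of `posClosure`, and the multiple
is detected by the coefficient of the empty word. -/
lemma descdPlus_eq : descdPlus = posClosure := by
  refine le_antisymm ?_ posClosure_le
  rintro x ⟨hx, hx'⟩
  obtain ⟨y, hy, a, ha, rfl⟩ := Submodule.mem_sup.1 (descd_le_sup hx)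
  obtain ⟨r, rfl⟩ := Submodule.mem_span_singleton.1 hy
  have h := eps_of_mem_gradedPermsPlus hx'
  rw [map_add, eps_of_mem_gradedPermsPlus (posClosure_le_plus ha), map_smul, p_zero] at h
  simp only [eps_nil, smul_eq_mul, mul_one, add_zero] at h
  simpa [h] using ha

lemma descd_eq : descd = Submodule.span ℚ {p 0} ⊔ descdPlus := by
  refine le_antisymm (descdPlus_eq ▸ descd_le_sup) (sup_le ?_ inf_le_left)
  rw [Submodule.span_singleton_le_iff_mem]
  exact p_mem_descd 0

lemma descdPlus_le : descdPlus ≤ gradedPermsPlus := inf_le_right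

lemma prec_mem_descdPlus {a b : Words Biletter} (ha : a ∈ descdPlus) (hb : b ∈ descdPlus) :
    prec a b ∈ descdPlus := by
  rw [descdPlus_eq] at *
  exact (dendClosure_stable ha hb).1

lemma succ_mem_descdPlus {a b : Words Biletter} (ha : a ∈ descdPlus) (hb : b ∈ descdPlus) :
    succ a b ∈ descdPlus := by
  rw [descdPlus_eq] at *
  exact (dendClosure_stable ha hb).2

lemma map_mem_tensorSquare {V : Type*} [AddCommGroup V] [Module ℚ V] {D : Submodule ℚ V}
    {f g : V →ₗ[ℚ] V} (hf : ∀ a ∈ D, f a ∈ D) (hg : ∀ a ∈ D, g a ∈ D) {z : V ⊗[ℚ] V}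
    (hz : z ∈ tensorSquare D) : TensorProduct.map f g z ∈ tensorSquare D :=
  map_mem_of_tensorSquare (fun a ha b hb => by
    simpa using tmul_mem_tensorSquare (hf a ha) (hg b hb)) hz

lemma map₂_mem_tensorSquare {V : Type*} [AddCommGroup V] [Module ℚ V] {D : Submodule ℚ V}
    {f g : V →ₗ[ℚ] V →ₗ[ℚ] V} (hf : ∀ a ∈ D, ∀ b ∈ D, f a b ∈ D)
    (hg : ∀ a ∈ D, ∀ b ∈ D, g a b ∈ D) {y z : V ⊗[ℚ] V} (hy : y ∈ tensorSquare D)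
    (hz : z ∈ tensorSquare D) : TensorProduct.map₂ f g y z ∈ tensorSquare D := by
  refine map_mem_of_tensorSquare (f := (TensorProduct.map₂ f g).flip z) (fun a ha b hb => ?_) hy
  rw [LinearMap.flip_apply, TensorProduct.map₂_apply_tmul]
  exact map_mem_tensorSquare (hf a ha) (hg b hb) hz

lemma add_mem_descdPlus : ∀ a ∈ descdPlus, ∀ b ∈ descdPlus, (prec + succ) a b ∈ descdPlus :=
  fun _ ha _ hb => add_mem (prec_mem_descdPlus ha hb) (succ_mem_descdPlus ha hb)

lemma dprec_prec_mem {a b : Words Biletter} (ha : a ∈ descdPlus) (hb : b ∈ descdPlus)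
    (ha' : dprec a ∈ tensorSquare descdPlus)
    (hb' : dprec b + dsucc b ∈ tensorSquare descdPlus) :
    dprec (prec a b) ∈ tensorSquare descdPlus := by
  rw [dprec_prec (descdPlus_le ha) (descdPlus_le hb)]
  refine add_mem (add_mem (add_mem (add_mem ?_ ?_) ?_) ?_) (tmul_mem_tensorSquare ha hb)
  · exact map₂_mem_tensorSquare (fun _ h _ => prec_mem_descdPlus h) add_mem_descdPlus ha' hb'
  · exact map_mem_tensorSquare (f := LinearMap.id) (g := (prec + succ).flip b) (fun _ h => h)
      (fun x hx => add_mem_descdPlus x hx b hb) ha'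
  · exact map_mem_tensorSquare (f := prec a) (g := LinearMap.id) (fun _ => prec_mem_descdPlus ha)
      (fun _ h => h) hb'
  · exact map_mem_tensorSquare (f := prec.flip b) (g := LinearMap.id)
      (fun x hx => prec_mem_descdPlus hx hb) (fun _ h => h) ha'

lemma dsucc_prec_mem {a b : Words Biletter} (ha : a ∈ descdPlus) (hb : b ∈ descdPlus)
    (ha' : dsucc a ∈ tensorSquare descdPlus)
    (hb' : dprec b + dsucc b ∈ tensorSquare descdPlus) :
    dsucc (prec a b) ∈ tensorSquare descdPlus := by
  rw [dsucc_prec (descdPlus_le ha) (descdPlus_le hb)]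
  refine add_mem (add_mem ?_ ?_) ?_
  · exact map₂_mem_tensorSquare (fun _ h _ => prec_mem_descdPlus h) add_mem_descdPlus ha' hb'
  · exact map_mem_tensorSquare (f := LinearMap.id) (g := (prec + succ).flip b) (fun _ h => h)
      (fun x hx => add_mem_descdPlus x hx b hb) ha'
  · exact map_mem_tensorSquare (f := prec.flip b) (g := LinearMap.id)
      (fun x hx => prec_mem_descdPlus hx hb) (fun _ h => h) ha'

lemma dprec_succ_mem {a b : Words Biletter} (ha : a ∈ descdPlus) (hb : b ∈ descdPlus)
    (ha' : dprec a ∈ tensorSquare descdPlus)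
    (hb' : dprec b + dsucc b ∈ tensorSquare descdPlus) :
    dprec (succ a b) ∈ tensorSquare descdPlus := by
  rw [dprec_succ (descdPlus_le ha) (descdPlus_le hb)]
  refine add_mem (add_mem ?_ ?_) ?_
  · exact map₂_mem_tensorSquare (fun _ h _ => succ_mem_descdPlus h) add_mem_descdPlus ha' hb'
  · exact map_mem_tensorSquare (f := succ a) (g := LinearMap.id) (fun _ => succ_mem_descdPlus ha)
      (fun _ h => h) hb'
  · exact map_mem_tensorSquare (f := succ.flip b) (g := LinearMap.id)
      (fun x hx => succ_mem_descdPlus hx hb) (fun _ h => h) ha'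

lemma dsucc_succ_mem {a b : Words Biletter} (ha : a ∈ descdPlus) (hb : b ∈ descdPlus)
    (ha' : dsucc a ∈ tensorSquare descdPlus)
    (hb' : dprec b + dsucc b ∈ tensorSquare descdPlus) :
    dsucc (succ a b) ∈ tensorSquare descdPlus := by
  rw [dsucc_succ (descdPlus_le ha) (descdPlus_le hb)]
  refine add_mem (add_mem (add_mem ?_ ?_) ?_) (tmul_mem_tensorSquare hb ha)
  · exact map₂_mem_tensorSquare (fun _ h _ => succ_mem_descdPlus h) add_mem_descdPlus ha' hb'
  · exact map_mem_tensorSquare (f := LinearMap.id) (g := (prec + succ) a) (fun _ h => h)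
      (add_mem_descdPlus a ha) hb'
  · exact map_mem_tensorSquare (f := succ.flip b) (g := LinearMap.id)
      (fun x hx => succ_mem_descdPlus hx hb) (fun _ h => h) ha'

/-- The half-coproducts preserve the dendriform descent algebra: they do so on the generators, and
the compatibilities propagate this to products. -/
lemma coprod_mem_descdPlus {a : Words Biletter} (ha : a ∈ descdPlus) :
    dprec a ∈ tensorSquare descdPlus ∧ dsucc a ∈ tensorSquare descdPlus := by
  have key : posClosure ≤ descdPlus ⊓
      ((tensorSquare descdPlus).comap dprec ⊓ (tensorSquare descdPlus).comap dsucc) := by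
    refine dendClosure_le ?_ ?_
    · rintro _ ⟨n, hn, rfl⟩
      have hp : ∀ m, 1 ≤ m → p m ∈ descdPlus := fun m hm => ⟨p_mem_descd m, p_mem hm⟩
      refine ⟨hp n hn, ?_, ?_⟩
      · show dprec (p n) ∈ tensorSquare descdPlus
        rw [dprec_p]
        refine Submodule.sum_mem _ fun i hi => ?_
        rw [Finset.mem_Ico] at hi
        exact tmul_mem_tensorSquare (hp i hi.1) (hp _ (by omega))
      · show dsucc (p n) ∈ tensorSquare descdPlus
        rw [dsucc_p]
        exact zero_mem _
    · intro a ha b hb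
      simp only [Submodule.mem_inf, Submodule.mem_comap] at ha hb ⊢
      have hbd := add_mem hb.2.1 hb.2.2
      exact ⟨⟨prec_mem_descdPlus ha.1 hb.1, dprec_prec_mem ha.1 hb.1 ha.2.1 hbd,
          dsucc_prec_mem ha.1 hb.1 ha.2.2 hbd⟩,
        succ_mem_descdPlus ha.1 hb.1, dprec_succ_mem ha.1 hb.1 ha.2.1 hbd,
          dsucc_succ_mem ha.1 hb.1 ha.2.2 hbd⟩
  exact (key (descdPlus_eq ▸ ha)).2

lemma isStable_descdPlus : IsStable descdPlus where
  le := descdPlus_le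
  prec_mem _ ha _ hb := prec_mem_descdPlus ha hb
  succ_mem _ ha _ hb := succ_mem_descdPlus ha hb
  dprec_mem _ ha := (coprod_mem_descdPlus ha).1
  dsucc_mem _ ha := (coprod_mem_descdPlus ha).2

end Descent

/-! ### The action on shuffle algebras -/

section Action

variable {X : Type*} {wt : X → ℕ+}

/-- The biword `w` acts nontrivially on the word `x`: the lengths agree, and the second row gives
the weights of the letters of `x` at the positions listed in the first row. -/
def IsMatch (wt : X → ℕ+) (w : List Biletter) (x : List X) : Prop :=
  w.length = x.length ∧ ∀ b ∈ w, (x[b.1 - 1]?).map (fun y => (wt y : ℕ)) = some b.2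

/-- The letters of `x` at the positions listed in the first row of `w`. -/
def act (x : List X) (w : List Biletter) : List X := w.filterMap fun b => x[b.1 - 1]?

open Classical in
lemma toEnd_word (w : List Biletter) (x : List X) :
    toEnd wt (word w) (word x) = if IsMatch wt w x then word (act x w) else 0 := by
  simp only [toEnd, linExt_word]
  by_cases h : IsMatch wt w x
  · rw [if_pos h]; exact if_pos h
  · rw [if_neg h]; exact if_neg h

lemma IsMatch.perm {w w' : List Biletter} {x : List X} (h : IsMatch wt w x) (hp : w'.Perm w) :
    IsMatch wt w' x :=
  ⟨hp.length_eq.trans h.1, fun b hb => h.2 b (hp.mem_iff.1 hb)⟩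

lemma IsMatch.isSome {w : List Biletter} {x : List X} (h : IsMatch wt w x) :
    ∀ b ∈ w, (x[b.1 - 1]?).isSome := fun b hb => by
  have := h.2 b hb
  cases hx : x[b.1 - 1]? with
  | none => simp [hx] at this
  | some y => rfl

open Classical in
lemma toEnd_sumWords {l : List (List Biletter)} {w : List Biletter} (hl : ∀ z ∈ l, z.Perm w)
    (x : List X) : toEnd wt (sumWords l) (word x) =
      if IsMatch wt w x then sumWords (l.map (act x)) else 0 := by
  induction l with
  | nil => simp [sumWords_nil]
  | cons z l ih =>
    have hz := hl z (by simp)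
    rw [sumWords_cons, map_add, LinearMap.add_apply, ih fun y hy => hl y (by simp [hy]), toEnd_word]
    by_cases h : IsMatch wt w x
    · rw [if_pos h, if_pos (h.perm hz), if_pos h, List.map_cons, sumWords_cons]
    · rw [if_neg h, if_neg fun h' => h (h'.perm hz.symm), if_neg h, add_zero]

lemma filterMap_shuffles {α β : Type*} {g : α → Option β} (u v : List α)
    (hu : ∀ a ∈ u, (g a).isSome) (hv : ∀ a ∈ v, (g a).isSome) :
    (shuffles u v).map (List.filterMap g) = shuffles (u.filterMap g) (v.filterMap g) := by
  induction u generalizing v with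
  | nil => simp [shuffles_nil_left]
  | cons a u ihu =>
    obtain ⟨a', ha'⟩ := Option.isSome_iff_exists.1 (hu a (by simp))
    induction v with
    | nil => simp [shuffles_nil_right]
    | cons b v ihv =>
      obtain ⟨b', hb'⟩ := Option.isSome_iff_exists.1 (hv b (by simp))
      have h1 := ihu (b :: v) (fun a ha => hu a (by simp [ha])) hv
      have h2 := ihv fun a ha => hv a (by simp [ha])
      rw [List.filterMap_cons_some ha'] at h2 ⊢
      rw [List.filterMap_cons_some hb'] at h1 ⊢
      rw [shuffles_cons_cons, shuffles_cons_cons, ← h1, ← h2]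
      simp [Function.comp_def, ha', hb']

lemma filterMap_halfShuffles {α β : Type*} {g : α → Option β} (u v : List α)
    (hu : ∀ a ∈ u, (g a).isSome) (hv : ∀ a ∈ v, (g a).isSome) :
    (halfShuffles u v).map (List.filterMap g) = halfShuffles (u.filterMap g) (v.filterMap g) := by
  cases u with
  | nil => simp [halfShuffles]
  | cons a u =>
    obtain ⟨a', ha'⟩ := Option.isSome_iff_exists.1 (hu a (by simp))
    rw [List.filterMap_cons_some ha', halfShuffles, halfShuffles,
      ← filterMap_shuffles u v (fun a ha => hu a (by simp [ha])) hv]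
    simp [Function.comp_def, ha']

lemma IsMatch.map_act_halfShuffles {w u v : List Biletter} {x : List X} (h : IsMatch wt w x)
    (hw : (u ++ v).Perm w) :
    (halfShuffles u v).map (act x) = halfShuffles (act x u) (act x v) :=
  filterMap_halfShuffles u v (fun b hb => h.isSome b (hw.mem_iff.1 (by simp [hb])))
    fun b hb => h.isSome b (hw.mem_iff.1 (by simp [hb]))

lemma act_take {u : List Biletter} (hu : IsGradedPerm u) (x : List X) :
    act (x.take u.length) u = act x u := by
  refine List.filterMap_congr fun b hb => ?_
  have := hu.mem_range hb
  rw [List.getElem?_take_of_lt (by omega)]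

lemma act_drop {v : List Biletter} (hv : IsGradedPerm v) (k : ℕ) (x : List X) :
    act (x.drop k) v = act x (shift k v) := by
  rw [act, act, shift, List.filterMap_map]
  refine List.filterMap_congr fun b hb => ?_
  have := hv.mem_range hb
  rw [List.getElem?_drop, Function.comp_apply]
  exact congrArg (x[·]?) (by show k + (b.1 - 1) = b.1 + k - 1; omega)

lemma isMatch_append {u v : List Biletter} (hu : IsGradedPerm u) (hv : IsGradedPerm v)
    (x : List X) : IsMatch wt (u ++ shift u.length v) x ↔
      IsMatch wt u (x.take u.length) ∧ IsMatch wt v (x.drop u.length) := by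
  have h1 : ∀ b ∈ u, (x.take u.length)[b.1 - 1]? = x[b.1 - 1]? := fun b hb => by
    have := hu.mem_range hb
    rw [List.getElem?_take_of_lt (by omega)]
  have h2 : ∀ b ∈ v, (x.drop u.length)[b.1 - 1]? = x[b.1 + u.length - 1]? := fun b hb => by
    have := hv.mem_range hb
    rw [List.getElem?_drop]
    exact congrArg (x[·]?) (by omega)
  simp only [IsMatch, List.length_append, length_shift, List.length_take, List.length_drop]
  constructor
  · rintro ⟨hl, hm⟩
    refine ⟨⟨by omega, fun b hb => ?_⟩, by omega, fun b hb => ?_⟩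
    · rw [h1 b hb]; exact hm b (by simp [hb])
    · rw [h2 b hb]
      exact hm (b.1 + u.length, b.2)
        (List.mem_append_right _ (List.mem_map.2 ⟨b, hb, rfl⟩))
  · rintro ⟨⟨hl, hm⟩, hl', hm'⟩
    refine ⟨by omega, fun b hb => ?_⟩
    rcases List.mem_append.1 hb with hb | hb
    · rw [← h1 b hb]; exact hm b hb
    · obtain ⟨a, ha, rfl⟩ := List.mem_map.1 hb
      have := hm' a ha
      rwa [h2 a ha] at this

open Classical in
/-- In a convolution of the actions of two biwords only one cut of the argument contributes. -/
lemma lift_map_toEnd (B : Words X →ₗ[ℚ] Words X →ₗ[ℚ] Words X) {u v : List Biletter}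
    (hu : IsGradedPerm u) (hv : IsGradedPerm v) (x : List X) :
    TensorProduct.lift B (TensorProduct.map (toEnd wt (word u)) (toEnd wt (word v))
      (deconc (word x))) = if IsMatch wt (u ++ shift u.length v) x then
        B (word (act x u)) (word (act x (shift u.length v))) else 0 := by
  rw [deconc_word, map_sum, map_sum]
  simp only [TensorProduct.map_tmul, TensorProduct.lift.tmul]
  have h0 : ∀ i, i ∈ Finset.range (x.length + 1) → i ≠ u.length →
      B (toEnd wt (word u) (word (x.take i))) (toEnd wt (word v) (word (x.drop i))) = 0 := by
    intro i hi hiu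
    rw [toEnd_word, if_neg, map_zero, LinearMap.zero_apply]
    rintro ⟨h, -⟩
    rw [Finset.mem_range] at hi
    rw [List.length_take] at h
    omega
  by_cases hx : u.length ∈ Finset.range (x.length + 1)
  · rw [Finset.sum_eq_single_of_mem _ hx h0, toEnd_word, toEnd_word, act_take hu, act_drop hv]
    by_cases h1 : IsMatch wt u (x.take u.length)
    · by_cases h2 : IsMatch wt v (x.drop u.length)
      · rw [if_pos h1, if_pos h2, if_pos ((isMatch_append hu hv x).2 ⟨h1, h2⟩)]
      · rw [if_neg h2, map_zero, if_neg fun h => h2 ((isMatch_append hu hv x).1 h).2]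
    · rw [if_neg h1, map_zero, LinearMap.zero_apply,
        if_neg fun h => h1 ((isMatch_append hu hv x).1 h).1]
  · rw [Finset.sum_eq_zero fun i hi => h0 i hi fun h => hx (h ▸ hi), if_neg]
    rintro ⟨h, -⟩
    rw [Finset.mem_range] at hx
    rw [List.length_append] at h
    omega

lemma convPrec_add_left (f g h : Module.End ℚ (Words X)) :
    convPrec (f + g) h = convPrec f h + convPrec g h := by
  simp only [convPrec, TensorProduct.map_add_left, LinearMap.add_comp, LinearMap.comp_add]

lemma convPrec_add_right (f g h : Module.End ℚ (Words X)) :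
    convPrec f (g + h) = convPrec f g + convPrec f h := by
  simp only [convPrec, TensorProduct.map_add_right, LinearMap.add_comp, LinearMap.comp_add]

lemma convPrec_smul_left (c : ℚ) (f g : Module.End ℚ (Words X)) :
    convPrec (c • f) g = c • convPrec f g := by
  simp only [convPrec, TensorProduct.map_smul_left, LinearMap.smul_comp, LinearMap.comp_smul]

lemma convPrec_smul_right (c : ℚ) (f g : Module.End ℚ (Words X)) :
    convPrec f (c • g) = c • convPrec f g := by
  simp only [convPrec, TensorProduct.map_smul_right, LinearMap.smul_comp, LinearMap.comp_smul]

lemma convSucc_add_left (f g h : Module.End ℚ (Words X)) :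
    convSucc (f + g) h = convSucc f h + convSucc g h := by
  simp only [convSucc, TensorProduct.map_add_left, LinearMap.add_comp, LinearMap.comp_add]

lemma convSucc_add_right (f g h : Module.End ℚ (Words X)) :
    convSucc f (g + h) = convSucc f g + convSucc f h := by
  simp only [convSucc, TensorProduct.map_add_right, LinearMap.add_comp, LinearMap.comp_add]

lemma convSucc_smul_left (c : ℚ) (f g : Module.End ℚ (Words X)) :
    convSucc (c • f) g = c • convSucc f g := by
  simp only [convSucc, TensorProduct.map_smul_left, LinearMap.smul_comp, LinearMap.comp_smul]

lemma convSucc_smul_right (c : ℚ) (f g : Module.End ℚ (Words X)) :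
    convSucc f (c • g) = c • convSucc f g := by
  simp only [convSucc, TensorProduct.map_smul_right, LinearMap.smul_comp, LinearMap.comp_smul]

lemma toEnd_prec_word {u v : List Biletter} (hu : IsGradedPerm u) (hv : IsGradedPerm v) :
    toEnd wt (prec (word u) (word v)) = convPrec (toEnd wt (word u)) (toEnd wt (word v)) := by
  classical
  refine hom_ext_word fun x => ?_
  rw [prec_word, toEnd_sumWords fun z hz => perm_of_mem_halfShuffles hz, convPrec,
    LinearMap.comp_apply, LinearMap.comp_apply, lift_map_toEnd _ hu hv]
  by_cases h : IsMatch wt (u ++ shift u.length v) x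
  · rw [if_pos h, if_pos h, h.map_act_halfShuffles (List.Perm.refl _), shPrec_word]
  · rw [if_neg h, if_neg h]

lemma toEnd_succ_word {u v : List Biletter} (hu : IsGradedPerm u) (hv : IsGradedPerm v) :
    toEnd wt (succ (word u) (word v)) = convSucc (toEnd wt (word u)) (toEnd wt (word v)) := by
  classical
  refine hom_ext_word fun x => ?_
  rw [succ_word, toEnd_sumWords fun z hz => (perm_of_mem_halfShuffles hz).trans
    List.perm_append_comm, convSucc, LinearMap.comp_apply, LinearMap.comp_apply,
    lift_map_toEnd _ hu hv]
  by_cases h : IsMatch wt (u ++ shift u.length v) x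
  · rw [if_pos h, if_pos h, h.map_act_halfShuffles List.perm_append_comm, shSucc,
      LinearMap.flip_apply, shPrec_word]
  · rw [if_neg h, if_neg h]

lemma toEnd_prec {a b : Words Biletter} (ha : a ∈ gradedPerms) (hb : b ∈ gradedPerms) :
    toEnd wt (prec a b) = convPrec (toEnd wt a) (toEnd wt b) := by
  induction ha using gradedPerms_induction with
  | h0 => simp [convPrec]
  | hadd x y _ _ hx hy => simp only [map_add, LinearMap.add_apply, hx, hy, convPrec_add_left]
  | hsmul c x _ hx => simp only [map_smul, LinearMap.smul_apply, hx, convPrec_smul_left]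
  | h u hu =>
    induction hb using gradedPerms_induction with
    | h0 => simp [convPrec]
    | hadd x y _ _ hx hy => simp only [map_add, hx, hy, convPrec_add_right]
    | hsmul c x _ hx => simp only [map_smul, hx, convPrec_smul_right]
    | h v hv => exact toEnd_prec_word hu hv

lemma toEnd_succ {a b : Words Biletter} (ha : a ∈ gradedPerms) (hb : b ∈ gradedPerms) :
    toEnd wt (succ a b) = convSucc (toEnd wt a) (toEnd wt b) := by
  induction ha using gradedPerms_induction with
  | h0 => simp [convSucc]
  | hadd x y _ _ hx hy => simp only [map_add, LinearMap.add_apply, hx, hy, convSucc_add_left]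
  | hsmul c x _ hx => simp only [map_smul, LinearMap.smul_apply, hx, convSucc_smul_left]
  | h u hu =>
    induction hb using gradedPerms_induction with
    | h0 => simp [convSucc]
    | hadd x y _ _ hx hy => simp only [map_add, hx, hy, convSucc_add_right]
    | hsmul c x _ hx => simp only [map_smul, hx, convSucc_smul_right]
    | h v hv => exact toEnd_succ_word hu hv

lemma isMatch_idWord {l : List ℕ} {x : List X} :
    IsMatch wt (idWord l) x ↔ l = x.map fun y => (wt y : ℕ) := by
  constructor
  · rintro ⟨h1, h2⟩
    rw [length_idWord] at h1
    refine List.ext_getElem (by simpa using h1) fun i hi hi' => ?_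
    have := h2 (i + 1, l[i]) (List.mem_mapIdx.2 ⟨i, hi, rfl⟩)
    rw [Nat.add_sub_cancel, List.getElem?_eq_getElem (by omega)] at this
    simpa using this.symm
  · rintro rfl
    refine ⟨by simp, fun b hb => ?_⟩
    obtain ⟨i, hi, rfl⟩ := List.mem_mapIdx.1 hb
    rw [List.length_map] at hi
    simp [List.getElem?_eq_getElem hi]

lemma act_idWord {l : List ℕ} {x : List X} (h : l.length = x.length) : act x (idWord l) = x := by
  have : (idWord l).map (fun b => x[b.1 - 1]?) = x.map some := by
    refine List.ext_getElem (by simpa using h) fun i hi hi' => ?_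
    rw [List.length_map] at hi'
    simp [idWord, List.getElem?_eq_getElem hi']
  have e : act x (idWord l) = ((idWord l).map (fun b => x[b.1 - 1]?)).filterMap id := by
    rw [List.filterMap_map]; rfl
  rw [e, this, List.filterMap_map]
  simp

lemma toEnd_p (n : ℕ) : toEnd wt (p n) = weightProj wt n := by
  classical
  refine hom_ext_word fun x => ?_
  rw [p_eq, map_sum, LinearMap.sum_apply, weightProj, linExt_word]
  have h : ∀ l ∈ compLists n, toEnd wt (word (idWord l)) (word x) =
      if l = x.map fun y => (wt y : ℕ) then word x else 0 := fun l _ => by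
    rw [toEnd_word]
    by_cases hl : l = x.map fun y => (wt y : ℕ)
    · rw [if_pos hl, if_pos (isMatch_idWord.2 hl), act_idWord (by simp [hl])]
    · rw [if_neg hl, if_neg fun h => hl (isMatch_idWord.1 h)]
  rw [Finset.sum_congr rfl h, Finset.sum_ite_eq']
  have hpos : ∀ d ∈ x.map fun y => (wt y : ℕ), 0 < d := by simp
  by_cases hn : (x.map fun y => (wt y : ℕ)).sum = n
  · rw [if_pos hn, if_pos (mem_compLists.2 ⟨hpos, hn⟩)]
  · rw [if_neg hn, if_neg fun h => hn (mem_compLists.1 h).2]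

lemma map_descd : descd.map (toEnd wt) =
    dendClosure convPrec convSucc (Set.range (weightProj wt)) := by
  refine le_antisymm ?_ (dendClosure_le ?_ ?_)
  · rw [Submodule.map_le_iff_le_comap]
    have key : descd ≤ gradedPerms ⊓
        (dendClosure convPrec convSucc (Set.range (weightProj wt))).comap (toEnd wt) := by
      refine dendClosure_le ?_ ?_
      · rintro _ ⟨n, rfl⟩
        refine ⟨p_mem_gradedPerms n, ?_⟩
        show toEnd wt (p n) ∈ dendClosure convPrec convSucc (Set.range (weightProj wt))
        rw [toEnd_p]
        exact subset_dendClosure ⟨n, rfl⟩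
      · rintro a ⟨ha, ha'⟩ b ⟨hb, hb'⟩
        refine ⟨⟨gradedPermsPlus_le (prec_mem ha hb), ?_⟩,
          gradedPermsPlus_le (succ_mem ha hb), ?_⟩
        · show toEnd wt (prec a b) ∈ dendClosure convPrec convSucc (Set.range (weightProj wt))
          rw [toEnd_prec ha hb]
          exact (dendClosure_stable ha' hb').1
        · show toEnd wt (succ a b) ∈ dendClosure convPrec convSucc (Set.range (weightProj wt))
          rw [toEnd_succ ha hb]
          exact (dendClosure_stable ha' hb').2
    exact key.trans inf_le_right
  · rintro _ ⟨n, rfl⟩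
    exact ⟨p n, p_mem_descd n, toEnd_p n⟩
  · rintro _ ⟨a, ha, rfl⟩ _ ⟨b, hb, rfl⟩
    have h : prec a b ∈ descd ∧ succ a b ∈ descd :=
      dendClosure_stable (f := fun a b => prec a b) (g := fun a b => succ a b) ha hb
    exact ⟨⟨_, h.1, toEnd_prec (descd_le ha) (descd_le hb)⟩,
      _, h.2, toEnd_succ (descd_le ha) (descd_le hb)⟩

lemma IsMatch.map_act {w : List Biletter} {x : List X} (h : IsMatch wt w x) :
    (act x w).map some = w.map fun b => x[b.1 - 1]? := by
  have h' := h.isSome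
  clear h
  induction w with
  | nil => rfl
  | cons b w ih =>
    obtain ⟨y, hy⟩ := Option.isSome_iff_exists.1 (h' b (by simp))
    have := ih fun b hb => h' b (by simp [hb])
    rw [act, List.filterMap_cons_some (f := fun b : Biletter => x[b.1 - 1]?) hy, List.map_cons,
      List.map_cons, hy]
    exact congrArg _ this

/-- On a word without repeated letters, the result of the action determines the biword. -/
lemma IsMatch.eq_of_act_eq {w w' : List Biletter} {x : List X} (hx : x.Nodup)
    (h : IsMatch wt w x) (h' : IsMatch wt w' x) (hw : IsGradedPerm w) (hw' : IsGradedPerm w')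
    (he : act x w' = act x w) : w' = w := by
  have hm : w'.map (fun b => x[b.1 - 1]?) = w.map fun b => x[b.1 - 1]? := by
    rw [← h.map_act, ← h'.map_act, he]
  refine List.ext_getElem (h'.1.trans h.1.symm) fun i hi hi' => ?_
  have e : x[w'[i].1 - 1]? = x[w[i].1 - 1]? := by
    have := congrArg (fun l => l[i]?) hm
    simpa [hi, hi'] using this
  have r := hw.mem_range (List.getElem_mem hi')
  have r' := hw'.mem_range (List.getElem_mem hi)
  have h1 : w'[i].1 - 1 = w[i].1 - 1 :=
    (List.getElem?_inj (by rw [← h'.1]; omega) hx).1 e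
  refine Prod.ext (by omega) ?_
  have e2 := h'.2 _ (List.getElem_mem hi)
  rw [e, h.2 _ (List.getElem_mem hi')] at e2
  exact (Option.some_injective _ e2).symm

/-- With infinitely many letters of each weight, every biword acts nontrivially on some word
without repeated letters. -/
lemma exists_isMatch (hX : ∀ n, {x | wt x = n}.Infinite) {w : List Biletter}
    (hw : IsGradedPerm w) : ∃ x : List X, x.Nodup ∧ IsMatch wt w x := by
  have hd : ∀ j : ℕ, ∃ d : ℕ+, ∀ b ∈ w, b.1 = j + 1 → b.2 = d := by
    intro j
    by_cases h : ∃ b ∈ w, b.1 = j + 1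
    · obtain ⟨b, hb, hj⟩ := h
      refine ⟨⟨b.2, hw.2 b hb⟩, fun b' hb' hj' => ?_⟩
      rw [List.inj_on_of_nodup_map hw.nodup hb' hb (hj'.trans hj.symm)]
      rfl
    · exact ⟨1, fun b hb hj => absurd ⟨b, hb, hj⟩ h⟩
  choose D hD using hd
  have hwt : ∀ n j, wt ((hX n).natEmbedding _ j : X) = n := fun n j =>
    ((hX n).natEmbedding _ j).2
  refine ⟨(List.range w.length).map fun j => ((hX (D j)).natEmbedding _ j : X), ?_, by simp, ?_⟩
  · refine List.Nodup.map_on (fun i _ j _ h => ?_) List.nodup_range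
    have e : D i = D j := by rw [← hwt (D i) i, ← hwt (D j) j, h]
    rw [e] at h
    exact ((hX (D j)).natEmbedding _).injective (Subtype.ext h)
  · intro b hb
    have r := hw.mem_range hb
    rw [List.getElem?_map, List.getElem?_range (by omega)]
    simp only [Option.map_some, hwt]
    rw [hD (b.1 - 1) b hb (by omega)]

lemma apply_of_not_isGradedPerm {z : Words Biletter} (hz : z ∈ gradedPerms) {w : List Biletter}
    (hw : ¬ IsGradedPerm w) : z w = 0 := by
  induction hz using gradedPerms_induction with
  | h0 => rfl
  | hadd x y _ _ hx hy => rw [Finsupp.add_apply, hx, hy, add_zero]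
  | hsmul c x _ hx => rw [Finsupp.smul_apply, hx, smul_zero]
  | h u hu => exact Finsupp.single_eq_of_ne fun h => hw (h ▸ hu)

/-- The coefficient of a biword is a coefficient of the image of a word without repeated letters. -/
lemma toEnd_injOn (hX : ∀ n, {x | wt x = n}.Infinite) :
    Set.InjOn (toEnd wt) (gradedPerms : Set (Words Biletter)) := by
  classical
  have key : ∀ z ∈ gradedPerms, toEnd wt z = 0 → z = 0 := by
    intro z hz h
    ext w
    by_cases hw : IsGradedPerm w
    · obtain ⟨x, hx, hm⟩ := exists_isMatch hX hw
      -- the coefficient of `w` is read off from the action on the word `x`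
      have hc : toEnd wt z (word x) (act x w) = z w := by
        clear h
        induction hz using gradedPerms_induction with
        | h0 => simp
        | hadd a b _ _ ha hb =>
          rw [map_add, LinearMap.add_apply, Finsupp.add_apply, ha, hb, Finsupp.add_apply]
        | hsmul c a _ ha =>
          rw [map_smul, LinearMap.smul_apply, Finsupp.smul_apply, ha, Finsupp.smul_apply]
        | h u hu =>
          rw [toEnd_word]
          by_cases huw : u = w
          · subst huw
            rw [if_pos hm, word, word, Finsupp.single_eq_same, Finsupp.single_eq_same]
          · rw [word, word, Finsupp.single_eq_of_ne fun h => huw h.symm]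
            by_cases hu' : IsMatch wt u x
            · rw [if_pos hu', Finsupp.single_eq_of_ne
                fun h => huw (hm.eq_of_act_eq hx hu' hw hu h.symm)]
            · rw [if_neg hu', Finsupp.zero_apply]
      rw [← hc, h]
      rfl
    · exact apply_of_not_isGradedPerm hz hw
  intro a ha b hb hab
  exact sub_eq_zero.1 (key _ (sub_mem ha hb) (by rw [map_sub, hab, sub_self]))

end Action

/-! ### The length filtration -/

section Filtration

lemma gradedPermsLE_mono {m n : ℕ} (h : m ≤ n) : gradedPermsLE m ≤ gradedPermsLE n := by
  refine Submodule.span_mono ?_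
  rintro _ ⟨w, hw, h0, hl, rfl⟩
  exact ⟨w, hw, h0, hl.trans h, rfl⟩

lemma gradedPermsLE_zero : gradedPermsLE 0 = ⊥ := by
  refine Submodule.span_eq_bot.2 ?_
  rintro _ ⟨w, -, h0, hl, rfl⟩
  exact absurd (List.length_eq_zero_iff.1 (Nat.le_zero.1 hl)) h0

lemma exists_mem_gradedPermsLE {x : Words Biletter} (hx : x ∈ gradedPermsPlus) :
    ∃ n, x ∈ gradedPermsLE n := by
  induction hx using gradedPermsPlus_induction with
  | h w hw h0 => exact ⟨_, word_mem_gradedPermsLE hw h0 le_rfl⟩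
  | h0 => exact ⟨0, zero_mem _⟩
  | hadd x y _ _ hx hy =>
    obtain ⟨m, hm⟩ := hx
    obtain ⟨n, hn⟩ := hy
    exact ⟨max m n, add_mem (gradedPermsLE_mono (le_max_left m n) hm)
      (gradedPermsLE_mono (le_max_right m n) hn)⟩
  | hsmul c x _ hx =>
    obtain ⟨m, hm⟩ := hx
    exact ⟨m, Submodule.smul_mem _ _ hm⟩

lemma gradedPermsLE_induction {n : ℕ} {E : Submodule ℚ (Words Biletter)}
    (h : ∀ w, IsGradedPerm w → w ≠ [] → w.length ≤ n → word w ∈ E) : gradedPermsLE n ≤ E := by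
  refine Submodule.span_le.2 ?_
  rintro _ ⟨w, hw, h0, hl, rfl⟩
  exact h w hw h0 hl

/-- The tensors of total length at most `n`. -/
def tensorLE (n : ℕ) : Submodule ℚ (Words Biletter ⊗[ℚ] Words Biletter) :=
  Submodule.span ℚ {z | ∃ i j, i + j ≤ n ∧ ∃ x ∈ gradedPermsLE i, ∃ y ∈ gradedPermsLE j,
    z = x ⊗ₜ[ℚ] y}

lemma tensorLE_succ_le (n : ℕ) : tensorLE (n + 1) ≤ tensorSquare (gradedPermsLE n) := by
  refine Submodule.span_le.2 ?_
  rintro _ ⟨i, j, hij, x, hx, y, hy, rfl⟩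
  rcases Nat.eq_zero_or_pos i with rfl | hi
  · rw [gradedPermsLE_zero, Submodule.mem_bot] at hx
    rw [hx, TensorProduct.zero_tmul]
    exact zero_mem _
  rcases Nat.eq_zero_or_pos j with rfl | hj
  · rw [gradedPermsLE_zero, Submodule.mem_bot] at hy
    rw [hy, TensorProduct.tmul_zero]
    exact zero_mem _
  exact tmul_mem_tensorSquare (gradedPermsLE_mono (by omega) hx)
    (gradedPermsLE_mono (by omega) hy)

lemma cut_mem_tensorLE {w : List Biletter} (hw : IsGradedPerm w) {n : ℕ} (hl : w.length ≤ n)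
    {i : ℕ} (hi : i ∈ Finset.Ico 1 w.length) :
    word (std (w.take i)) ⊗ₜ[ℚ] word (std (w.drop i)) ∈ tensorLE n := by
  rw [Finset.mem_Ico] at hi
  refine Submodule.subset_span ⟨i, w.length - i, by omega, _,
    word_mem_gradedPermsLE (hw.std_take i) ?_ ?_, _,
    word_mem_gradedPermsLE (hw.std_drop i) ?_ ?_, rfl⟩
  · rw [← List.length_pos_iff, length_std, List.length_take]; omega
  · rw [length_std, List.length_take]; omega
  · rw [← List.length_pos_iff, length_std, List.length_drop]; omega
  · rw [length_std, List.length_drop]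

lemma dprec_mem_tensorLE {n : ℕ} {x : Words Biletter} (hx : x ∈ gradedPermsLE n) :
    dprec x ∈ tensorLE n := by
  refine gradedPermsLE_induction (E := (tensorLE n).comap dprec) (fun w hw _ hl => ?_) hx
  rw [Submodule.mem_comap, dprec_word]
  refine Submodule.sum_mem _ fun i hi => ?_
  split_ifs
  · exact cut_mem_tensorLE hw hl hi
  · exact zero_mem _

lemma dsucc_mem_tensorLE {n : ℕ} {x : Words Biletter} (hx : x ∈ gradedPermsLE n) :
    dsucc x ∈ tensorLE n := by
  refine gradedPermsLE_induction (E := (tensorLE n).comap dsucc) (fun w hw _ hl => ?_) hx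
  rw [Submodule.mem_comap, dsucc_word]
  refine Submodule.sum_mem _ fun i hi => ?_
  split_ifs
  · exact cut_mem_tensorLE hw hl hi
  · exact zero_mem _

lemma prec_mem_gradedPermsLE {i j : ℕ} {x y : Words Biletter} (hx : x ∈ gradedPermsLE i)
    (hy : y ∈ gradedPermsLE j) : prec x y ∈ gradedPermsLE (i + j) := by
  refine gradedPermsLE_induction (E := (gradedPermsLE (i + j)).comap (prec.flip y))
    (fun u hu hu0 hul => ?_) hx
  rw [Submodule.mem_comap, LinearMap.flip_apply]
  refine gradedPermsLE_induction (E := (gradedPermsLE (i + j)).comap (prec (word u)))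
    (fun v hv hv0 hvl => ?_) hy
  rw [Submodule.mem_comap, prec_word]
  refine sumWords_mem fun w hw => ?_
  have hp := perm_of_mem_halfShuffles hw
  have hl := hp.length_eq
  rw [List.length_append, length_shift] at hl
  refine word_mem_gradedPermsLE ((hu.append_shift hv).perm hp) ?_ (by omega)
  rw [← List.length_pos_iff]
  rw [← List.length_pos_iff] at hu0
  omega

lemma succ_mem_gradedPermsLE {i j : ℕ} {x y : Words Biletter} (hx : x ∈ gradedPermsLE i)
    (hy : y ∈ gradedPermsLE j) : succ x y ∈ gradedPermsLE (i + j) := by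
  refine gradedPermsLE_induction (E := (gradedPermsLE (i + j)).comap (succ.flip y))
    (fun u hu hu0 hul => ?_) hx
  rw [Submodule.mem_comap, LinearMap.flip_apply]
  refine gradedPermsLE_induction (E := (gradedPermsLE (i + j)).comap (succ (word u)))
    (fun v hv hv0 hvl => ?_) hy
  rw [Submodule.mem_comap, succ_word]
  refine sumWords_mem fun w hw => ?_
  have hp := (perm_of_mem_halfShuffles hw).trans List.perm_append_comm
  have hl := hp.length_eq
  rw [List.length_append, length_shift] at hl
  refine word_mem_gradedPermsLE ((hu.append_shift hv).perm hp) ?_ (by omega)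
  rw [← List.length_pos_iff]
  rw [← List.length_pos_iff] at hu0
  omega

end Filtration

/-! ### Projections onto kernels of coproducts -/

section Projection

lemma lift_mem_of_tensorSquare {V M : Type*} [AddCommGroup V] [Module ℚ V] [AddCommGroup M]
    [Module ℚ M] {D : Submodule ℚ V} {E : Submodule ℚ M} {f : V →ₗ[ℚ] V →ₗ[ℚ] M}
    (h : ∀ a ∈ D, ∀ b ∈ D, f a b ∈ E) {z : V ⊗[ℚ] V} (hz : z ∈ tensorSquare D) :
    TensorProduct.lift f z ∈ E :=
  map_mem_of_tensorSquare (fun a ha b hb => by simpa using h a ha b hb) hz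

lemma lift_congr_tensorSquare {V M : Type*} [AddCommGroup V] [Module ℚ V] [AddCommGroup M]
    [Module ℚ M] {D : Submodule ℚ V} {f g : V →ₗ[ℚ] V →ₗ[ℚ] M}
    (h : ∀ a ∈ D, ∀ b ∈ D, f a b = g a b) {z : V ⊗[ℚ] V} (hz : z ∈ tensorSquare D) :
    TensorProduct.lift f z = TensorProduct.lift g z :=
  eq_on_tensorSquare (fun a ha b hb => by simpa using h a ha b hb) hz

variable {m : Words Biletter →ₗ[ℚ] Words Biletter →ₗ[ℚ] Words Biletter}
  {δ : Words Biletter →ₗ[ℚ] Words Biletter ⊗[ℚ] Words Biletter}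

/-- The iterates of the recursion `e x = x - m (e x' ⊗ x'')`, where `δ x = x' ⊗ x''`. -/
def projIter (m : Words Biletter →ₗ[ℚ] Words Biletter →ₗ[ℚ] Words Biletter)
    (δ : Words Biletter →ₗ[ℚ] Words Biletter ⊗[ℚ] Words Biletter) :
    ℕ → Words Biletter →ₗ[ℚ] Words Biletter
  | 0 => 0
  | k + 1 => LinearMap.id - TensorProduct.lift (m ∘ₗ projIter m δ k) ∘ₗ δ

/-- The solution of the recursion `e x = x - m (e x' ⊗ x'')`, where `δ x = x' ⊗ x''`: when `δ`
lowers the length, the iterates are stationary on words of bounded length. -/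
def proj (m : Words Biletter →ₗ[ℚ] Words Biletter →ₗ[ℚ] Words Biletter)
    (δ : Words Biletter →ₗ[ℚ] Words Biletter ⊗[ℚ] Words Biletter) :
    Words Biletter →ₗ[ℚ] Words Biletter :=
  linExt fun w => projIter m δ w.length (word w)

lemma projIter_succ (k : ℕ) (x : Words Biletter) : projIter m δ (k + 1) x =
    x - TensorProduct.lift (m ∘ₗ projIter m δ k) (δ x) := rfl

lemma projIter_stable (hδ : ∀ n, ∀ x ∈ gradedPermsLE n, δ x ∈ tensorLE n) {k j : ℕ} (hkj : k ≤ j)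
    {x : Words Biletter} (hx : x ∈ gradedPermsLE k) : projIter m δ j x = projIter m δ k x := by
  induction k generalizing j x with
  | zero =>
    rw [gradedPermsLE_zero, Submodule.mem_bot] at hx
    rw [hx, map_zero, map_zero]
  | succ k ih =>
    obtain ⟨j, rfl⟩ : ∃ i, j = i + 1 := ⟨j - 1, by omega⟩
    rw [projIter_succ, projIter_succ]
    congr 1
    refine lift_congr_tensorSquare (fun a ha b _ => ?_) (tensorLE_succ_le k (hδ _ x hx))
    rw [LinearMap.comp_apply, LinearMap.comp_apply, ih (by omega) ha]

lemma proj_eq_projIter (hδ : ∀ n, ∀ x ∈ gradedPermsLE n, δ x ∈ tensorLE n) {k : ℕ}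
    {x : Words Biletter} (hx : x ∈ gradedPermsLE k) : proj m δ x = projIter m δ k x := by
  refine gradedPermsLE_induction (E := LinearMap.eqLocus (proj m δ) (projIter m δ k))
    (fun w hw h0 hl => ?_) hx
  rw [LinearMap.mem_eqLocus, proj, linExt_word]
  exact (projIter_stable hδ hl (word_mem_gradedPermsLE hw h0 le_rfl)).symm

lemma proj_eq (hδ : ∀ n, ∀ x ∈ gradedPermsLE n, δ x ∈ tensorLE n)
    {x : Words Biletter} (hx : x ∈ gradedPermsPlus) :
    proj m δ x = x - TensorProduct.lift (m ∘ₗ proj m δ) (δ x) := by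
  obtain ⟨k, hk⟩ := exists_mem_gradedPermsLE hx
  have hk' := gradedPermsLE_mono (Nat.le_succ k) hk
  rw [proj_eq_projIter hδ hk', projIter_succ]
  congr 1
  refine lift_congr_tensorSquare (fun a ha b _ => ?_) (tensorLE_succ_le k (hδ _ x hk'))
  rw [LinearMap.comp_apply, LinearMap.comp_apply, proj_eq_projIter hδ ha]

lemma proj_mem (hδ : ∀ n, ∀ x ∈ gradedPermsLE n, δ x ∈ tensorLE n)
    {D : Submodule ℚ (Words Biletter)} (hD : D ≤ gradedPermsPlus)
    (hm : ∀ a ∈ D, ∀ b ∈ D, m a b ∈ D) (hδD : ∀ a ∈ D, δ a ∈ tensorSquare D)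
    {x : Words Biletter} (hx : x ∈ D) : proj m δ x ∈ D := by
  obtain ⟨k, hk⟩ := exists_mem_gradedPermsLE (hD hx)
  rw [proj_eq_projIter hδ hk]
  clear hk
  induction k generalizing x with
  | zero => exact zero_mem _
  | succ k ih =>
    rw [projIter_succ]
    exact sub_mem hx (lift_mem_of_tensorSquare (fun a ha b hb => hm _ (ih ha) b hb) (hδD x hx))

lemma proj_mem_gradedPermsLE (hδ : ∀ n, ∀ x ∈ gradedPermsLE n, δ x ∈ tensorLE n)
    (hm : ∀ i j, ∀ x ∈ gradedPermsLE i, ∀ y ∈ gradedPermsLE j, m x y ∈ gradedPermsLE (i + j))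
    {k : ℕ} {x : Words Biletter} (hx : x ∈ gradedPermsLE k) : proj m δ x ∈ gradedPermsLE k := by
  rw [proj_eq_projIter hδ hx]
  have key : ∀ j, ∀ i, ∀ x ∈ gradedPermsLE i, projIter m δ j x ∈ gradedPermsLE i := by
    intro j
    induction j with
    | zero => exact fun i x _ => zero_mem _
    | succ j ih =>
      intro i x hx
      rw [projIter_succ]
      refine sub_mem hx ?_
      have h : tensorLE i ≤
          (gradedPermsLE i).comap (TensorProduct.lift (m ∘ₗ projIter m δ j)) := by
        refine Submodule.span_le.2 ?_
        rintro _ ⟨r, s, hrs, y, hy, z, hz, rfl⟩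
        rw [SetLike.mem_coe, Submodule.mem_comap, TensorProduct.lift.tmul]
        exact gradedPermsLE_mono hrs (hm r s _ (ih r y hy) z hz)
      exact h (hδ i x hx)
  exact key k k x hx

/-- If `e` solves the recursion `e a = a - m (e a' ⊗ a'')` for the coproduct `Δ₁`, the map
`m ∘ (e ⊗ id)` inverts `δ` on the image of `δ`, provided that `Δ₁`, `Δ₂` and `δ` are coassociative
and that `m (e a)` intertwines the coproducts up to the extra term `e a ⊗ b`. -/
lemma coprod_lift_eq {V : Type*} [AddCommGroup V] [Module ℚ V] {m : V →ₗ[ℚ] V →ₗ[ℚ] V}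
    {e : V →ₗ[ℚ] V} {δ Δ₁ Δ₂ : V →ₗ[ℚ] V ⊗[ℚ] V} {D : Submodule ℚ V} {z : V ⊗[ℚ] V}
    (hz : z ∈ tensorSquare D)
    (hco : TensorProduct.assoc ℚ V V V (Δ₁.rTensor V z) = Δ₂.lTensor V z)
    (he : ∀ a ∈ D, e a = a - TensorProduct.lift (m ∘ₗ e) (Δ₁ a))
    (hδ : ∀ a ∈ D, ∀ b ∈ D, δ (m (e a) b) = e a ⊗ₜ b + (m (e a)).rTensor V (Δ₂ b)) :
    δ (TensorProduct.lift (m ∘ₗ e) z) = z := by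
  set R : V ⊗[ℚ] (V ⊗[ℚ] V) →ₗ[ℚ] V ⊗[ℚ] V :=
    (TensorProduct.lift (m ∘ₗ e)).rTensor V ∘ₗ (TensorProduct.assoc ℚ V V V).symm.toLinearMap
    with hR
  have hR' : ∀ a z, R (a ⊗ₜ z) = (m (e a)).rTensor V z := by
    intro a z
    induction z using TensorProduct.induction_on with
    | zero => simp
    | tmul b c => simp [hR]
    | add x y hx hy => rw [TensorProduct.tmul_add, map_add, hx, hy, map_add]
  have h1 : (δ ∘ₗ TensorProduct.lift (m ∘ₗ e)) z = ((LinearMap.id : V ⊗[ℚ] V →ₗ[ℚ] V ⊗[ℚ] V) -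
      (TensorProduct.lift (m ∘ₗ e)).rTensor V ∘ₗ Δ₁.rTensor V + R ∘ₗ Δ₂.lTensor V) z := by
    refine eq_on_tensorSquare (fun a ha b hb => ?_) hz
    simp only [LinearMap.comp_apply, LinearMap.add_apply, LinearMap.sub_apply, LinearMap.id_apply,
      TensorProduct.lift.tmul, LinearMap.rTensor_tmul, LinearMap.lTensor_tmul]
    rw [hδ a ha b hb, hR', ← TensorProduct.sub_tmul, ← he a ha]
  simp only [LinearMap.comp_apply, LinearMap.add_apply, LinearMap.sub_apply,
    LinearMap.id_apply, ← hco] at h1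
  rw [h1, hR]
  simp

end Projection

/-! ### Generation by the primitive elements -/

section Generation

/-- The projection onto `Ker Δ_≺` along `S_+ ≺ S_+`. -/
def projPrec : Words Biletter →ₗ[ℚ] Words Biletter := proj prec dprec

/-- The projection onto the kernel of `Δ_≺ + Δ_≻` along `S_+ ≻ S_+`. -/
def projFull : Words Biletter →ₗ[ℚ] Words Biletter := proj succ.flip (dprec + dsucc)

lemma full_mem_tensorLE (n : ℕ) (x : Words Biletter) (hx : x ∈ gradedPermsLE n) :
    (dprec + dsucc) x ∈ tensorLE n :=
  add_mem (dprec_mem_tensorLE hx) (dsucc_mem_tensorLE hx)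

lemma projPrec_eq {x : Words Biletter} (hx : x ∈ gradedPermsPlus) :
    projPrec x = x - TensorProduct.lift (prec ∘ₗ projPrec) (dprec x) :=
  proj_eq (fun _ _ => dprec_mem_tensorLE) hx

lemma projFull_eq {x : Words Biletter} (hx : x ∈ gradedPermsPlus) : projFull x =
    x - TensorProduct.lift (succ.flip ∘ₗ projFull) ((dprec + dsucc) x) :=
  proj_eq full_mem_tensorLE hx

namespace IsStable

variable {D : Submodule ℚ (Words Biletter)}

lemma projPrec_mem (h : IsStable D) {x : Words Biletter} (hx : x ∈ D) : projPrec x ∈ D :=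
  proj_mem (fun _ _ => dprec_mem_tensorLE) h.le h.prec_mem h.dprec_mem hx

lemma projFull_mem (h : IsStable D) {x : Words Biletter} (hx : x ∈ D) : projFull x ∈ D :=
  proj_mem full_mem_tensorLE h.le (fun a ha b hb => h.succ_mem b hb a ha)
    (fun a ha => add_mem (h.dprec_mem a ha) (h.dsucc_mem a ha)) hx

end IsStable

lemma dprec_projPrec {x : Words Biletter} (hx : x ∈ gradedPermsPlus) : dprec (projPrec x) = 0 := by
  obtain ⟨k, hk⟩ := exists_mem_gradedPermsLE hx
  clear hx
  induction k generalizing x with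
  | zero =>
    rw [gradedPermsLE_zero, Submodule.mem_bot] at hk
    rw [hk, map_zero, map_zero]
  | succ k ih =>
    have hx := gradedPermsLE_le _ hk
    have hS := isStable_gradedPermsPlus
    rw [projPrec_eq hx, map_sub, sub_eq_zero]
    refine (coprod_lift_eq (Δ₂ := dprec + dsucc) (tensorLE_succ_le k (dprec_mem_tensorLE hk))
      (dprec_dprec hx) (fun a ha => projPrec_eq (gradedPermsLE_le k ha)) fun a ha b hb => ?_).symm
    rw [dprec_prec (hS.projPrec_mem (gradedPermsLE_le k ha)) (gradedPermsLE_le k hb), ih ha]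
    simp [add_comm]

/-- The coproduct `Δ_≺` of a product `b ≻ a` whose second factor has `(Δ_≺ + Δ_≻) a = 0`. -/
lemma dprec_succ_of_full {a b : Words Biletter} (ha : a ∈ gradedPermsPlus)
    (hb : b ∈ gradedPermsPlus) (h : (dprec + dsucc) a = 0) :
    dprec (succ b a) = (succ.flip a).rTensor _ (dprec b) := by
  rw [LinearMap.add_apply] at h
  rw [dprec_succ hb ha, h]
  simp

/-- The coproduct `Δ_≻` of a product `b ≻ a` whose second factor has `(Δ_≺ + Δ_≻) a = 0`. -/
lemma dsucc_succ_of_full {a b : Words Biletter} (ha : a ∈ gradedPermsPlus)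
    (hb : b ∈ gradedPermsPlus) (h : (dprec + dsucc) a = 0) :
    dsucc (succ b a) = a ⊗ₜ b + (succ.flip a).rTensor _ (dsucc b) := by
  rw [LinearMap.add_apply] at h
  rw [dsucc_succ hb ha, h]
  simp [add_comm]

/-- The full coproduct is coassociative. -/
lemma full_full {x : Words Biletter} (hx : x ∈ gradedPermsPlus) :
    TensorProduct.assoc ℚ _ _ _ ((dprec + dsucc).rTensor _ ((dprec + dsucc) x)) =
      (dprec + dsucc).lTensor _ ((dprec + dsucc) x) := by
  have h1 := dprec_dprec hx
  have h2 := dsucc_dprec hx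
  have h3 := dsucc_dsucc hx
  simp only [LinearMap.rTensor_add, LinearMap.lTensor_add, LinearMap.add_apply, map_add] at h1 h3 ⊢
  rw [h1, h2, add_assoc, h3]

lemma full_projFull {x : Words Biletter} (hx : x ∈ gradedPermsPlus) :
    (dprec + dsucc) (projFull x) = 0 := by
  obtain ⟨k, hk⟩ := exists_mem_gradedPermsLE hx
  clear hx
  induction k generalizing x with
  | zero =>
    rw [gradedPermsLE_zero, Submodule.mem_bot] at hk
    rw [hk, map_zero, map_zero]
  | succ k ih =>
    have hx := gradedPermsLE_le _ hk
    have hS := isStable_gradedPermsPlus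
    rw [projFull_eq hx, map_sub, sub_eq_zero]
    refine (coprod_lift_eq (Δ₂ := dprec + dsucc) (tensorLE_succ_le k (full_mem_tensorLE _ _ hk))
      (full_full hx) (fun a ha => projFull_eq (gradedPermsLE_le k ha)) fun a ha b hb => ?_).symm
    have ha' := hS.projFull_mem (gradedPermsLE_le k ha)
    rw [LinearMap.flip_apply, LinearMap.add_apply,
      dprec_succ_of_full ha' (gradedPermsLE_le k hb) (ih ha),
      dsucc_succ_of_full ha' (gradedPermsLE_le k hb) (ih ha), LinearMap.add_apply, map_add]
    abel

/-- On `Ker Δ_≺`, the projection onto the primitive elements along `S_+ ≻ S_+`. -/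
def projPrim : Words Biletter →ₗ[ℚ] Words Biletter :=
  LinearMap.id - TensorProduct.lift (succ.flip ∘ₗ projFull) ∘ₗ dsucc

lemma projPrim_apply (x : Words Biletter) :
    projPrim x = x - TensorProduct.lift (succ.flip ∘ₗ projFull) (dsucc x) := rfl

lemma IsStable.projPrim_mem {D : Submodule ℚ (Words Biletter)} (h : IsStable D)
    {x : Words Biletter} (hx : x ∈ D) : projPrim x ∈ D :=
  sub_mem hx (lift_mem_of_tensorSquare
    (fun _ ha b hb => h.succ_mem b hb _ (h.projFull_mem ha)) (h.dsucc_mem x hx))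

lemma dsucc_projPrim {x : Words Biletter} (hx : x ∈ gradedPermsPlus) : dsucc (projPrim x) = 0 := by
  have hS := isStable_gradedPermsPlus
  rw [projPrim_apply, map_sub, sub_eq_zero]
  refine (coprod_lift_eq (Δ₂ := dsucc) (hS.dsucc_mem x hx) (dsucc_dsucc hx)
    (fun a ha => projFull_eq ha) fun a ha b hb => ?_).symm
  exact dsucc_succ_of_full (hS.projFull_mem ha) hb (full_projFull ha)

lemma dprec_projPrim {x : Words Biletter} (hx : x ∈ gradedPermsPlus) (h0 : dprec x = 0) :
    dprec (projPrim x) = 0 := by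
  have hS := isStable_gradedPermsPlus
  rw [projPrim_apply, map_sub, h0, zero_sub, neg_eq_zero]
  -- `Δ_≺` of the correction term factors through `(id ⊗ Δ_≺) Δ_≻ x = (Δ_≻ ⊗ id) Δ_≺ x`
  set R : Words Biletter ⊗[ℚ] (Words Biletter ⊗[ℚ] Words Biletter) →ₗ[ℚ]
      Words Biletter ⊗[ℚ] Words Biletter :=
    (TensorProduct.lift (succ.flip ∘ₗ projFull)).rTensor _ ∘ₗ
      (TensorProduct.assoc ℚ _ _ _).symm.toLinearMap with hR
  have hR' : ∀ a z, R (a ⊗ₜ z) = (succ.flip (projFull a)).rTensor _ z := by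
    intro a z
    induction z using TensorProduct.induction_on with
    | zero => simp
    | tmul b c => simp [hR]
    | add x y hx hy => rw [TensorProduct.tmul_add, map_add, hx, hy, map_add]
  have h1 : (dprec ∘ₗ TensorProduct.lift (succ.flip ∘ₗ projFull)) (dsucc x) =
      (R ∘ₗ dprec.lTensor _) (dsucc x) := by
    refine eq_on_tensorSquare (fun a ha b hb => ?_) (hS.dsucc_mem x hx)
    rw [LinearMap.comp_apply, LinearMap.comp_apply, TensorProduct.lift.tmul, LinearMap.comp_apply,
      LinearMap.flip_apply, LinearMap.lTensor_tmul, hR',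
      dprec_succ_of_full (hS.projFull_mem ha) hb (full_projFull ha)]
  rw [LinearMap.comp_apply, LinearMap.comp_apply, ← dsucc_dprec hx, h0] at h1
  rw [h1]
  simp

/-- Approximate reconstruction of an element from its primitive parts: stage `k` is exact in
lengths at most `k`, and takes its values in the dendriform algebra generated by the primitive
elements. -/
def reconstruct : ℕ → Words Biletter →ₗ[ℚ] Words Biletter
  | 0 => 0
  | k + 1 => projPrim ∘ₗ projPrec +
      TensorProduct.lift (succ.flip.compl₁₂ (reconstruct k ∘ₗ projFull) (reconstruct k)) ∘ₗ
        dsucc ∘ₗ projPrec +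
      TensorProduct.lift (prec.compl₁₂ (reconstruct k ∘ₗ projPrec) (reconstruct k)) ∘ₗ dprec

lemma reconstruct_succ (k : ℕ) (x : Words Biletter) : reconstruct (k + 1) x =
    projPrim (projPrec x) +
      TensorProduct.lift (succ.flip.compl₁₂ (reconstruct k ∘ₗ projFull) (reconstruct k))
        (dsucc (projPrec x)) +
      TensorProduct.lift (prec.compl₁₂ (reconstruct k ∘ₗ projPrec) (reconstruct k)) (dprec x) := rfl

/-- The corrections subtracted by `projPrec` and `projPrim` are products of shorter elements, on
which the previous stage is exact. -/
lemma reconstruct_eq {k : ℕ} {x : Words Biletter} (hx : x ∈ gradedPermsLE k) :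
    reconstruct k x = x := by
  induction k generalizing x with
  | zero =>
    rw [gradedPermsLE_zero, Submodule.mem_bot] at hx
    rw [hx, map_zero]
  | succ k ih =>
    have hπ : ∀ {n}, ∀ a ∈ gradedPermsLE n, projPrec a ∈ gradedPermsLE n := fun _ ha =>
      proj_mem_gradedPermsLE (fun _ _ => dprec_mem_tensorLE)
        (fun _ _ _ hx _ hy => prec_mem_gradedPermsLE hx hy) ha
    have he : ∀ a ∈ gradedPermsLE k, projFull a ∈ gradedPermsLE k := fun a ha =>
      proj_mem_gradedPermsLE full_mem_tensorLE
        (fun i j _ hx _ hy => add_comm i j ▸ succ_mem_gradedPermsLE hy hx) ha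
    have h1 : TensorProduct.lift (succ.flip.compl₁₂ (reconstruct k ∘ₗ projFull) (reconstruct k))
        (dsucc (projPrec x)) =
        TensorProduct.lift (succ.flip ∘ₗ projFull) (dsucc (projPrec x)) :=
      lift_congr_tensorSquare (fun a ha b hb => by simp [ih (he a ha), ih hb])
        (tensorLE_succ_le k (dsucc_mem_tensorLE (hπ x hx)))
    have h2 : TensorProduct.lift (prec.compl₁₂ (reconstruct k ∘ₗ projPrec) (reconstruct k))
        (dprec x) = TensorProduct.lift (prec ∘ₗ projPrec) (dprec x) :=
      lift_congr_tensorSquare (fun a ha b hb => by simp [ih (hπ a ha), ih hb])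
        (tensorLE_succ_le k (dprec_mem_tensorLE hx))
    rw [reconstruct_succ, h1, h2, projPrim_apply, sub_add_cancel,
      projPrec_eq (gradedPermsLE_le _ hx), sub_add_cancel]

/-- A stable subspace is generated, as a dendriform algebra, by its primitive elements. -/
lemma IsStable.le_of_primDend_le {D G : Submodule ℚ (Words Biletter)} (h : IsStable D)
    (hP : primDend D dprec dsucc ≤ G) (hp : ∀ a ∈ G, ∀ b ∈ G, prec a b ∈ G)
    (hs : ∀ a ∈ G, ∀ b ∈ G, succ a b ∈ G) : D ≤ G := by
  have key : ∀ k, ∀ x ∈ D, reconstruct k x ∈ G := by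
    intro k
    induction k with
    | zero => exact fun x _ => zero_mem _
    | succ k ih =>
      intro x hx
      have hπ := h.projPrec_mem hx
      rw [reconstruct_succ]
      refine add_mem (add_mem (hP ⟨h.projPrim_mem hπ,
        dprec_projPrim (h.le hπ) (dprec_projPrec (h.le hx)), dsucc_projPrim (h.le hπ)⟩) ?_) ?_
      · exact lift_mem_of_tensorSquare
          (fun a ha b hb => hs _ (ih b hb) _ (ih _ (h.projFull_mem ha))) (h.dsucc_mem _ hπ)
      · exact lift_mem_of_tensorSquare
          (fun a ha b hb => hp _ (ih _ (h.projPrec_mem ha)) _ (ih b hb)) (h.dprec_mem x hx)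
  intro x hx
  obtain ⟨k, hk⟩ := exists_mem_gradedPermsLE (h.le hx)
  exact reconstruct_eq hk ▸ key k x hx

end Generation

/-! ### Dendriform algebras with a unit, and evaluation of binary trees -/

section Unital

/-- A dendriform algebra with a formal unit: the associative product `mul` has the unit `one`, it
enters the half-shuffle relations, and is the sum of the half-products when its left factor is a
product for `≺`. -/
structure UnitalDendriform (B : Type*) [AddCommGroup B] [Module ℚ B] where
  prec : B →ₗ[ℚ] B →ₗ[ℚ] B
  succ : B →ₗ[ℚ] B →ₗ[ℚ] B
  mul : B →ₗ[ℚ] B →ₗ[ℚ] B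
  one : B
  prec_prec : ∀ a b c, prec (prec a b) c = prec a (mul b c)
  succ_prec : ∀ a b c, prec (succ a b) c = succ a (prec b c)
  succ_succ : ∀ a b c, succ (mul a b) c = succ a (succ b c)
  one_mul : ∀ a, mul one a = a
  mul_one : ∀ a, mul a one = a
  mul_prec : ∀ a b c, mul (prec a b) c = prec (prec a b) c + succ (prec a b) c

namespace UnitalDendriform

variable {B C ι : Type*} [AddCommGroup B] [Module ℚ B] [AddCommGroup C] [Module ℚ C]

/-- The evaluation of a binary tree with decorated nodes: a node with decoration `i` and subtrees
`l`, `r` is sent to `(l ≻ g i) ≺ r`, and the empty tree to the unit. -/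
def eval (U : UnitalDendriform B) (g : ι → B) : BinaryTree ι → B
  | .nil => U.one
  | .node i l r => U.prec (U.succ (U.eval g l) (g i)) (U.eval g r)

/-- The span of the evaluations of all trees. -/
def treeSpan (U : UnitalDendriform B) (g : ι → B) : Submodule ℚ B :=
  Submodule.span ℚ (Set.range (U.eval g))

/-- The span of the evaluations of the nonempty trees. -/
def treeSpanPlus (U : UnitalDendriform B) (g : ι → B) : Submodule ℚ B :=
  Submodule.span ℚ {x | ∃ i l r, x = U.eval g (.node i l r)}

variable (U : UnitalDendriform B) (g : ι → B)

lemma eval_mem (t : BinaryTree ι) : U.eval g t ∈ U.treeSpan g := Submodule.subset_span ⟨t, rfl⟩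

lemma treeSpanPlus_le : U.treeSpanPlus g ≤ U.treeSpan g := by
  refine Submodule.span_le.2 ?_
  rintro _ ⟨i, l, r, rfl⟩
  exact U.eval_mem g _

variable {U g}

lemma node_mem {x y : B} (hx : x ∈ U.treeSpan g) (hy : y ∈ U.treeSpan g) (i : ι) :
    U.prec (U.succ x (g i)) y ∈ U.treeSpanPlus g := by
  have h1 : U.treeSpan g ≤ (U.treeSpanPlus g).comap
      (U.prec.flip y ∘ₗ U.succ.flip (g i)) := by
    refine Submodule.span_le.2 ?_
    rintro _ ⟨l, rfl⟩
    have h2 : U.treeSpan g ≤ (U.treeSpanPlus g).comap (U.prec (U.succ (U.eval g l) (g i))) := by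
      refine Submodule.span_le.2 ?_
      rintro _ ⟨r, rfl⟩
      exact Submodule.subset_span ⟨i, l, r, rfl⟩
    exact h2 hy
  exact h1 hx

/-- The products of two trees are combinations of trees, by induction on the number of nodes. -/
lemma mul_eval_mem (s t : BinaryTree ι) : U.mul (U.eval g s) (U.eval g t) ∈ U.treeSpan g := by
  induction h : s.numNodes + t.numNodes using Nat.strong_induction_on generalizing s t with
  | _ n ih =>
    cases s with
    | nil => rw [eval, U.one_mul]; exact U.eval_mem g t
    | node i l r =>
      cases t with
      | nil => rw [eval, eval, U.mul_one]; exact U.eval_mem g (.node i l r)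
      | node j l' r' =>
        have h1 := ih _ (by simp only [BinaryTree.numNodes] at h ⊢; omega) r (.node j l' r') rfl
        have h2 := ih _ (by simp only [BinaryTree.numNodes] at h ⊢; omega) (.node i l r) l' rfl
        have e1 : U.mul (U.eval g (.node i l r)) (U.eval g (.node j l' r')) =
            U.prec (U.succ (U.eval g l) (g i)) (U.mul (U.eval g r) (U.eval g (.node j l' r'))) +
            U.prec (U.succ (U.mul (U.eval g (.node i l r)) (U.eval g l')) (g j))
              (U.eval g r') := by
          rw [U.succ_succ (U.eval g (.node i l r)) (U.eval g l') (g j),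
            U.succ_prec (U.eval g (.node i l r)), ← U.prec_prec (U.succ (U.eval g l) (g i))]
          exact U.mul_prec _ _ _
        rw [e1]
        exact U.treeSpanPlus_le g (add_mem (node_mem (U.eval_mem g l) h1 i)
          (node_mem h2 (U.eval_mem g r') j))

lemma mul_mem {x y : B} (hx : x ∈ U.treeSpan g) (hy : y ∈ U.treeSpan g) :
    U.mul x y ∈ U.treeSpan g := by
  have h1 : U.treeSpan g ≤ (U.treeSpan g).comap (U.mul.flip y) := by
    refine Submodule.span_le.2 ?_
    rintro _ ⟨s, rfl⟩
    have h2 : U.treeSpan g ≤ (U.treeSpan g).comap (U.mul (U.eval g s)) := by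
      refine Submodule.span_le.2 ?_
      rintro _ ⟨t, rfl⟩
      exact mul_eval_mem s t
    exact h2 hy
  exact h1 hx

lemma prec_mem_treeSpanPlus {x y : B} (hx : x ∈ U.treeSpanPlus g) (hy : y ∈ U.treeSpanPlus g) :
    U.prec x y ∈ U.treeSpanPlus g := by
  have h1 : U.treeSpanPlus g ≤ (U.treeSpanPlus g).comap (U.prec.flip y) := by
    refine Submodule.span_le.2 ?_
    rintro _ ⟨i, l, r, rfl⟩
    rw [SetLike.mem_coe, Submodule.mem_comap, LinearMap.flip_apply, eval, U.prec_prec]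
    exact node_mem (U.eval_mem g l) (mul_mem (U.eval_mem g r) (U.treeSpanPlus_le g hy)) i
  exact h1 hx

lemma succ_mem_treeSpanPlus {x y : B} (hx : x ∈ U.treeSpanPlus g) (hy : y ∈ U.treeSpanPlus g) :
    U.succ x y ∈ U.treeSpanPlus g := by
  have h1 : U.treeSpanPlus g ≤ (U.treeSpanPlus g).comap (U.succ x) := by
    refine Submodule.span_le.2 ?_
    rintro _ ⟨i, l, r, rfl⟩
    rw [SetLike.mem_coe, Submodule.mem_comap, eval, ← U.succ_prec, ← U.succ_succ]
    exact node_mem (mul_mem (U.treeSpanPlus_le g hx) (U.eval_mem g l)) (U.eval_mem g r) i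
  exact h1 hy

/-- The adjunction of a formal unit to a dendriform algebra. -/
def ofDendriform (A : DendriformAlgebra B) : UnitalDendriform (ℚ × B) where
  prec := LinearMap.mk₂ ℚ (fun x y => (0, y.1 • x.2 + A.prec x.2 y.2))
    (fun x y z => by ext <;> simp; module) (fun c x y => by ext <;> simp; module)
    (fun x y z => by ext <;> simp; module) (fun c x y => by ext <;> simp; module)
  succ := LinearMap.mk₂ ℚ (fun x y => (0, x.1 • y.2 + A.succ x.2 y.2))
    (fun x y z => by ext <;> simp; module) (fun c x y => by ext <;> simp; module)
    (fun x y z => by ext <;> simp; module) (fun c x y => by ext <;> simp; module)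
  mul := LinearMap.mk₂ ℚ (fun x y => (x.1 * y.1,
      y.1 • x.2 + x.1 • y.2 + (A.prec x.2 y.2 + A.succ x.2 y.2)))
    (fun x y z => by ext <;> simp [add_mul]; module)
    (fun c x y => by ext <;> simp [mul_assoc]; module)
    (fun x y z => by ext <;> simp [mul_add]; module)
    (fun c x y => by ext <;> simp [mul_left_comm]; module)
  one := (1, 0)
  prec_prec a b c := by
    ext
    · simp
    · simp [A.prec_prec, mul_smul]; module
  succ_prec a b c := by
    ext
    · simp
    · simp [A.succ_prec]; module
  succ_succ a b c := by
    ext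
    · simp
    · have := A.succ_succ a.2 b.2 c.2
      simp only [map_add, LinearMap.add_apply] at this
      simp [this, mul_smul]; module
  one_mul a := by ext <;> simp
  mul_one a := by ext <;> simp
  mul_prec a b c := by ext <;> simp; module

/-- The product of two dendriform algebras with unit. -/
def prod (U : UnitalDendriform B) (W : UnitalDendriform C) : UnitalDendriform (B × C) where
  prec := LinearMap.mk₂ ℚ (fun x y => (U.prec x.1 y.1, W.prec x.2 y.2))
    (fun x y z => by ext <;> simp) (fun c x y => by ext <;> simp)
    (fun x y z => by ext <;> simp) (fun c x y => by ext <;> simp)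
  succ := LinearMap.mk₂ ℚ (fun x y => (U.succ x.1 y.1, W.succ x.2 y.2))
    (fun x y z => by ext <;> simp) (fun c x y => by ext <;> simp)
    (fun x y z => by ext <;> simp) (fun c x y => by ext <;> simp)
  mul := LinearMap.mk₂ ℚ (fun x y => (U.mul x.1 y.1, W.mul x.2 y.2))
    (fun x y z => by ext <;> simp) (fun c x y => by ext <;> simp)
    (fun x y z => by ext <;> simp) (fun c x y => by ext <;> simp)
  one := (U.one, W.one)
  prec_prec a b c := by ext <;> simp [prec_prec]
  succ_prec a b c := by ext <;> simp [succ_prec]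
  succ_succ a b c := by ext <;> simp [succ_succ]
  one_mul a := by ext <;> simp [one_mul]
  mul_one a := by ext <;> simp [mul_one]
  mul_prec a b c := by ext <;> simp [mul_prec]

lemma ofDendriform_prec (A : DendriformAlgebra B) (x y : ℚ × B) :
    (ofDendriform A).prec x y = (0, y.1 • x.2 + A.prec x.2 y.2) := rfl

lemma ofDendriform_succ (A : DendriformAlgebra B) (x y : ℚ × B) :
    (ofDendriform A).succ x y = (0, x.1 • y.2 + A.succ x.2 y.2) := rfl

lemma prod_prec (U : UnitalDendriform B) (W : UnitalDendriform C) (x y : B × C) :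
    (U.prod W).prec x y = (U.prec x.1 y.1, W.prec x.2 y.2) := rfl

lemma prod_succ (U : UnitalDendriform B) (W : UnitalDendriform C) (x y : B × C) :
    (U.prod W).succ x y = (U.succ x.1 y.1, W.succ x.2 y.2) := rfl

lemma prod_one (U : UnitalDendriform B) (W : UnitalDendriform C) :
    (U.prod W).one = (U.one, W.one) := rfl

lemma ofDendriform_one (A : DendriformAlgebra B) : (ofDendriform A).one = (1, 0) := rfl

lemma fst_eval_prod (U : UnitalDendriform B) (W : UnitalDendriform C) (g : ι → B × C)
    (t : BinaryTree ι) : ((U.prod W).eval g t).1 = U.eval (fun i => (g i).1) t := by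
  induction t with
  | nil => rfl
  | node i l r hl hr => rw [eval, eval, ← hl, ← hr]; rfl

end UnitalDendriform

/-- The unital dendriform structure on words in biletters. -/
def wordsUnital : UnitalDendriform (Words Biletter) where
  prec := prec
  succ := succ
  mul := gmul
  one := word []
  prec_prec := prec_prec
  succ_prec := succ_prec
  succ_succ := succ_succ
  one_mul := gmul_nil_left
  mul_one := gmul_nil_right
  mul_prec a b c := by rw [gmul_eq_add, eps_prec]; simp

end Unital

/-! ### Linear independence of the trees in primitive elements -/

section Independence

variable {ι : Type*} {g : ι → Words Biletter}

/-- The evaluation of a decorated binary tree in `S`. -/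
def treeEval (g : ι → Words Biletter) (t : BinaryTree ι) : Words Biletter := wordsUnital.eval g t

@[simp] lemma treeEval_nil : treeEval g .nil = word [] := rfl

lemma treeEval_node (i : ι) (l r : BinaryTree ι) :
    treeEval g (.node i l r) = prec (succ (treeEval g l) (g i)) (treeEval g r) := rfl

lemma treeEval_mem (hg : ∀ i, g i ∈ gradedPermsPlus) (t : BinaryTree ι) :
    treeEval g t ∈ gradedPerms := by
  induction t with
  | nil => exact word_mem_gradedPerms isGradedPerm_nil
  | node i l r hl hr =>
    exact gradedPermsPlus_le (prec_mem (gradedPermsPlus_le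
      (succ_mem hl (gradedPermsPlus_le (hg i)))) hr)

lemma treeEval_node_mem (hg : ∀ i, g i ∈ gradedPermsPlus) (i : ι) (l r : BinaryTree ι) :
    treeEval g (.node i l r) ∈ gradedPermsPlus :=
  prec_mem (gradedPermsPlus_le (succ_mem (treeEval_mem hg l) (gradedPermsPlus_le (hg i))))
    (treeEval_mem hg r)

/-- The linear extension of the evaluation of trees. -/
def treeEvalL (g : ι → Words Biletter) : (BinaryTree ι →₀ ℚ) →ₗ[ℚ] Words Biletter :=
  Finsupp.linearCombination ℚ (treeEval g)

@[simp] lemma treeEvalL_single (t : BinaryTree ι) :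
    treeEvalL g (Finsupp.single t 1) = treeEval g t := by simp [treeEvalL]

/-- The bilinear extension of the grafting of two trees on a node decorated by `i`. -/
def graft (i : ι) : (BinaryTree ι →₀ ℚ) →ₗ[ℚ] (BinaryTree ι →₀ ℚ) →ₗ[ℚ] BinaryTree ι →₀ ℚ :=
  Finsupp.linearCombination ℚ fun l => Finsupp.linearCombination ℚ fun r =>
    Finsupp.single (.node i l r) 1

lemma graft_single (i : ι) (l r : BinaryTree ι) :
    graft i (Finsupp.single l 1) (Finsupp.single r 1) = Finsupp.single (.node i l r) 1 := by
  simp [graft]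

lemma treeEvalL_graft (i : ι) (x y : BinaryTree ι →₀ ℚ) :
    treeEvalL g (graft i x y) = prec (succ (treeEvalL g x) (g i)) (treeEvalL g y) := by
  have : (graft i).compr₂ (treeEvalL g) =
      (prec.compl₁₂ (succ.flip (g i) ∘ₗ treeEvalL g) (treeEvalL g)) := by
    refine Finsupp.lhom_ext' fun l => LinearMap.ext_ring (Finsupp.lhom_ext' fun r =>
      LinearMap.ext_ring ?_)
    simp [graft_single, treeEval_node]
  exact LinearMap.congr_fun₂ this x y

lemma graft_apply_nil (i : ι) (x y : BinaryTree ι →₀ ℚ) : graft i x y .nil = 0 := by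
  have : (graft i).compr₂ (Finsupp.lapply BinaryTree.nil) = 0 := by
    refine Finsupp.lhom_ext' fun l => LinearMap.ext_ring (Finsupp.lhom_ext' fun r =>
      LinearMap.ext_ring ?_)
    simp [graft_single]
  exact LinearMap.congr_fun₂ this x y

open Classical in
lemma graft_apply_node (i j : ι) (l r : BinaryTree ι) (x y : BinaryTree ι →₀ ℚ) :
    graft i x y (.node j l r) = if j = i then x l * y r else 0 := by
  have : (graft i).compr₂ (Finsupp.lapply (BinaryTree.node j l r)) =
      if j = i then (LinearMap.mul ℚ ℚ).compl₁₂ (Finsupp.lapply l) (Finsupp.lapply r) else 0 := by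
    refine Finsupp.lhom_ext' fun l' => LinearMap.ext_ring (Finsupp.lhom_ext' fun r' =>
      LinearMap.ext_ring ?_)
    by_cases h : j = i
    · subst h
      simp [graft_single, Finsupp.single_apply]
      by_cases h1 : l' = l <;> by_cases h2 : r' = r <;> simp [h1, h2]
    · rw [if_neg h]
      have h' : ¬ i = j := fun e => h e.symm
      simp [graft_single, h']
  have := LinearMap.congr_fun₂ this x y
  split_ifs at this ⊢ <;> simpa using this

/-- The coefficient of the tree `s` in a tensor whose first factor is a combination of trees. -/
def coeff (s : BinaryTree ι) :
    (BinaryTree ι →₀ ℚ) ⊗[ℚ] Words Biletter →ₗ[ℚ] Words Biletter :=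
  TensorProduct.lift ((LinearMap.lsmul ℚ _) ∘ₗ Finsupp.lapply s)

@[simp] lemma coeff_tmul (s : BinaryTree ι) (x : BinaryTree ι →₀ ℚ) (y : Words Biletter) :
    coeff s (x ⊗ₜ y) = x s • y := by simp [coeff]

/-- The product of tensors by grafting on a node decorated by `i` in the first factor and by
`gmul` in the second. -/
def graftMul (i : ι) : (BinaryTree ι →₀ ℚ) ⊗[ℚ] Words Biletter →ₗ[ℚ]
    (BinaryTree ι →₀ ℚ) ⊗[ℚ] Words Biletter →ₗ[ℚ] (BinaryTree ι →₀ ℚ) ⊗[ℚ] Words Biletter :=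
  TensorProduct.map₂ (graft i) gmul

lemma coeff_nil_graftMul (i : ι) (X Y : (BinaryTree ι →₀ ℚ) ⊗[ℚ] Words Biletter) :
    coeff .nil (graftMul i X Y) = 0 := by
  have : (graftMul i).compr₂ (coeff .nil) = 0 := tmul_hom_ext₂ fun a b c d => by
    simp [graftMul, graft_apply_nil]
  exact LinearMap.congr_fun₂ this X Y

open Classical in
lemma coeff_node_graftMul (i j : ι) (l r : BinaryTree ι)
    (X Y : (BinaryTree ι →₀ ℚ) ⊗[ℚ] Words Biletter) : coeff (.node j l r) (graftMul i X Y) =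
      if j = i then gmul (coeff l X) (coeff r Y) else 0 := by
  have : (graftMul i).compr₂ (coeff (.node j l r)) =
      if j = i then gmul.compl₁₂ (coeff l) (coeff r) else 0 := tmul_hom_ext₂ fun a b c d => by
    by_cases h : j = i
    · simp [graftMul, graft_apply_node, h, mul_smul]
      exact smul_comm _ _ _
    · simp [graftMul, graft_apply_node, h]
  have := LinearMap.congr_fun₂ this X Y
  split_ifs at this ⊢ <;> simpa using this

/-- The half-coproducts `halfCop c`, lifted to trees in the first factor. -/
def treeCop (g : ι → Words Biletter) (c : Bool) :
    BinaryTree ι → (BinaryTree ι →₀ ℚ) ⊗[ℚ] Words Biletter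
  | .nil => if c then 0 else Finsupp.single .nil 1 ⊗ₜ word []
  | .node i l r => (if c then Finsupp.single .nil 1 ⊗ₜ treeEval g (.node i l r) else 0) +
      graftMul i (treeCop g c l) (treeCop g false r + treeCop g true r)

/-- The half-coproducts of `x ≻ a` for a primitive element `a`: every proper cut is a cut of `x`,
with `a` attached to its left part. -/
lemma halfCop_succ_prim (c : Bool) {x a : Words Biletter}
    (hx : x ∈ gradedPermsPlus ∨ x = word []) (ha : a ∈ gradedPermsPlus) (h1 : dprec a = 0)
    (h2 : dsucc a = 0) : halfCop c (succ x a) = (if c then word [] ⊗ₜ succ x a else 0) +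
      (succ.flip a).rTensor _ (halfCop c x) := by
  rcases hx with hx | rfl
  · have h0 : succ.flip (word []) = 0 := LinearMap.ext fun x => by simp
    rw [halfCop_succ c hx (gradedPermsPlus_le ha), cop_eq ha, h1, h2]
    simp only [add_zero, map_add, map₂_apply_tmul_right, h0, gmul_flip_nil,
      TensorProduct.map_zero_left, LinearMap.zero_apply]
    rfl
  · rw [one_succ ha, halfCop_nil]
    cases c
    · rw [halfCop_false ha, h1]
      simp [one_succ ha]
    · rw [halfCop_true ha, h2]
      simp

/-- The lifted coproducts are compatible with the evaluation of trees in primitive elements. -/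
lemma treeEvalL_treeCop (hg : ∀ i, g i ∈ gradedPermsPlus) (h1 : ∀ i, dprec (g i) = 0)
    (h2 : ∀ i, dsucc (g i) = 0) (c : Bool) (t : BinaryTree ι) :
    (treeEvalL g).rTensor _ (treeCop g c t) = halfCop c (treeEval g t) := by
  induction t generalizing c with
  | nil => cases c <;> simp [treeCop]
  | node i l r hl hr =>
    have hgraft : ∀ X Y, (treeEvalL g).rTensor (Words Biletter) (graftMul i X Y) =
        TensorProduct.map₂ prec gmul ((succ.flip (g i)).rTensor _ ((treeEvalL g).rTensor _ X))
          ((treeEvalL g).rTensor _ Y) := by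
      intro X Y
      have : (graftMul i).compr₂ ((treeEvalL g).rTensor (Words Biletter)) =
          (TensorProduct.map₂ prec gmul).compl₁₂
            ((succ.flip (g i)).rTensor _ ∘ₗ (treeEvalL g).rTensor _)
            ((treeEvalL g).rTensor _) := tmul_hom_ext₂ fun a b c d => by
        simp [graftMul, treeEvalL_graft]
      exact LinearMap.congr_fun₂ this X Y
    have hl' : treeEval g l ∈ gradedPermsPlus ∨ treeEval g l = word [] := by
      cases l with
      | nil => exact Or.inr rfl
      | node j l' r' => exact Or.inl (treeEval_node_mem hg j l' r')
    have h0 : prec (word []) = 0 := LinearMap.ext fun x => by simp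
    have hs := succ_mem (treeEval_mem hg l) (gradedPermsPlus_le (hg i))
    rw [treeCop, map_add, hgraft, map_add, hl, hr, hr, halfCop_add, treeEval_node,
      halfCop_prec c hs (treeEval_mem hg r), halfCop_succ_prim c hl' (hg i) (h1 i) (h2 i)]
    cases c
    · simp
    · simp [h0]

open Classical in
/-- The leading term of the coproducts of a tree. -/
lemma coeff_treeCop (c : Bool) {s t : BinaryTree ι} (h : t.numNodes ≤ s.numNodes) :
    coeff s (treeCop g c t) = if c = false ∧ s = t then word [] else 0 := by
  induction t generalizing c s with
  | nil =>
    cases c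
    · by_cases hs : s = .nil
      · simp [treeCop, hs]
      · simp [treeCop, hs]
    · simp [treeCop]
  | node i l r hl hr =>
    cases s with
    | nil => simp [BinaryTree.numNodes] at h
    | node j l' r' =>
      have h0 : coeff (.node j l' r') (if c then Finsupp.single BinaryTree.nil 1 ⊗ₜ[ℚ]
          treeEval g (.node i l r) else 0) = 0 := by cases c <;> simp
      rw [treeCop, map_add, h0, zero_add, coeff_node_graftMul, map_add]
      simp only [BinaryTree.numNodes] at h
      by_cases hj : j = i
      · rw [if_pos hj]
        have hr' : r.numNodes ≤ r'.numNodes → coeff r' (treeCop g false r) +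
            coeff r' (treeCop g true r) = if r' = r then word [] else 0 := fun h => by
          rw [hr false h, hr true h]; simp
        by_cases hll : l.numNodes ≤ l'.numNodes
        · rw [hl c hll]
          by_cases hc : c = false ∧ l' = l
          · rw [if_pos hc, hr' (by have := congrArg BinaryTree.numNodes hc.2; omega)]
            simp [hc, hj]
          · rw [if_neg hc, if_neg]
            · simp
            · rintro ⟨h1, h2⟩
              exact hc ⟨h1, (BinaryTree.node.inj h2).2.1⟩
        · have hne : r' ≠ r := by rintro rfl; omega
          rw [hr' (by omega), if_neg hne, if_neg]
          · simp
          · rintro ⟨h1, h2⟩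
            exact hne (BinaryTree.node.inj h2).2.2
      · rw [if_neg hj, if_neg]
        rintro ⟨h1, h2⟩
        exact hj (BinaryTree.node.inj h2).1

end Independence

section TreeIndependence

variable {ι : Type*} {g : ι → Words Biletter}

/-- The trees with at most `N` nodes have linearly independent evaluations. -/
def IndepLE (g : ι → Words Biletter) (N : ℕ) : Prop :=
  ∀ z : BinaryTree ι →₀ ℚ, (∀ t, z t ≠ 0 → t.numNodes ≤ N) → treeEvalL g z = 0 → z = 0

/-- The injectivity of the evaluation on trees with at most `N` nodes passes to tensors. -/
lemma IndepLE.coeff_eq_zero {N : ℕ} (h : IndepLE g N)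
    {X : (BinaryTree ι →₀ ℚ) ⊗[ℚ] Words Biletter}
    (hX : ∀ s : BinaryTree ι, N < s.numNodes → coeff s X = 0)
    (h0 : (treeEvalL g).rTensor _ X = 0) (s : BinaryTree ι) : coeff s X = 0 := by
  rw [← Module.forall_dual_apply_eq_zero_iff ℚ]
  intro ψ
  -- the contraction of the second factor by a linear form
  set y : BinaryTree ι →₀ ℚ := TensorProduct.rid ℚ _ (ψ.lTensor _ X) with hy
  have hys : ∀ s, y s = ψ (coeff s X) := by
    intro s
    have : Finsupp.lapply s ∘ₗ (TensorProduct.rid ℚ (BinaryTree ι →₀ ℚ)).toLinearMap ∘ₗ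
        ψ.lTensor _ = ψ ∘ₗ coeff s := TensorProduct.ext' fun a b => by simp [mul_comm]
    exact LinearMap.congr_fun this X
  have hye : treeEvalL g y = 0 := by
    have : treeEvalL g ∘ₗ (TensorProduct.rid ℚ (BinaryTree ι →₀ ℚ)).toLinearMap ∘ₗ
        ψ.lTensor _ = (TensorProduct.rid ℚ (Words Biletter)).toLinearMap ∘ₗ
          ψ.lTensor _ ∘ₗ (treeEvalL g).rTensor _ := TensorProduct.ext' fun a b => by simp
    have := LinearMap.congr_fun this X
    simp only [LinearMap.comp_apply, h0, map_zero] at this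
    exact this
  rw [← hys, h y (fun t ht => ?_) hye, Finsupp.zero_apply]
  by_contra hlt
  exact ht (by rw [hys, hX t (by omega), map_zero])

open Classical in
/-- Reindexing of a vanishing linear combination whose terms vanish off the image of `e`. -/
lemma linearCombination_comapDomain_eq_zero {κ τ V : Type*} [AddCommGroup V] [Module ℚ V]
    {z : τ →₀ ℚ} {q : τ → V} {f : κ → V} {e : κ → τ} (he : Function.Injective e) (S : Set κ)
    (h0 : Finsupp.linearCombination ℚ q z = 0)
    (hq : ∀ t, z t ≠ 0 → (∀ k ∈ S, e k ≠ t) → q t = 0)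
    (hf : ∀ k ∈ S, z (e k) ≠ 0 → q (e k) = f k) :
    Finsupp.linearCombination ℚ f ((z.comapDomain e he.injOn).filter (· ∈ S)) = 0 := by
  rw [← h0, Finsupp.linearCombination_apply, Finsupp.linearCombination_apply, Finsupp.sum,
    Finsupp.sum]
  have hmem : ∀ k, k ∈ ((z.comapDomain e he.injOn).filter (· ∈ S)).support ↔
      z (e k) ≠ 0 ∧ k ∈ S := fun k => by
    simp [Finsupp.mem_support_iff, and_comm]
  refine Finset.sum_of_injOn e he.injOn ?_ ?_ ?_
  · intro k hk
    have := (hmem k).1 hk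
    simpa using this.1
  · intro t ht hnt
    rw [Finsupp.mem_support_iff] at ht
    rw [hq t ht, smul_zero]
    rintro k hk rfl
    exact hnt ⟨k, (hmem k).2 ⟨ht, hk⟩, rfl⟩
  · intro k hk
    have := (hmem k).1 hk
    rw [Finsupp.filter_apply_pos _ _ this.2, Finsupp.comapDomain_apply, hf k this.2 this.1]

/-- Extraction of coefficients from a vanishing combination of evaluations of small trees. -/
lemma IndepLE.apply_eq_zero {N : ℕ} (h : IndepLE g N) {τ : Type*} {z : τ →₀ ℚ}
    {q : τ → Words Biletter} {e : BinaryTree ι → τ} (he : Function.Injective e)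
    (S : Set (BinaryTree ι)) (hN : ∀ k ∈ S, z (e k) ≠ 0 → k.numNodes ≤ N)
    (h0 : Finsupp.linearCombination ℚ q z = 0)
    (hq : ∀ t, z t ≠ 0 → (∀ k ∈ S, e k ≠ t) → q t = 0)
    (hf : ∀ k ∈ S, z (e k) ≠ 0 → q (e k) = treeEval g k) {k : BinaryTree ι} (hk : k ∈ S) :
    z (e k) = 0 := by
  classical
  have h1 := linearCombination_comapDomain_eq_zero he S h0 hq hf
  have h2 := h _ (fun t ht => ?_) h1
  · have := DFunLike.congr_fun h2 k
    rwa [Finsupp.filter_apply_pos _ _ hk] at this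
  · rw [Finsupp.filter_apply] at ht
    split_ifs at ht with hS
    · exact hN t hS ht
    · exact absurd rfl ht

/-- The linear extension of the lifted half-coproducts. -/
def treeCopL (g : ι → Words Biletter) (c : Bool) :
    (BinaryTree ι →₀ ℚ) →ₗ[ℚ] (BinaryTree ι →₀ ℚ) ⊗[ℚ] Words Biletter :=
  Finsupp.linearCombination ℚ (treeCop g c)

lemma coeff_treeCopL (c : Bool) (s : BinaryTree ι) (z : BinaryTree ι →₀ ℚ) :
    coeff s (treeCopL g c z) =
      Finsupp.linearCombination ℚ (fun t => coeff s (treeCop g c t)) z := by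
  rw [treeCopL, Finsupp.apply_linearCombination]
  rfl

lemma treeEvalL_treeCopL (hg : ∀ i, g i ∈ gradedPermsPlus) (h1 : ∀ i, dprec (g i) = 0)
    (h2 : ∀ i, dsucc (g i) = 0) (c : Bool) (z : BinaryTree ι →₀ ℚ) :
    (treeEvalL g).rTensor _ (treeCopL g c z) = halfCop c (treeEvalL g z) := by
  have : (treeEvalL g).rTensor _ ∘ₗ treeCopL g c = halfCop c ∘ₗ treeEvalL g :=
    Finsupp.lhom_ext' fun t => LinearMap.ext_ring (by
      simp [treeCopL, treeEvalL_treeCop hg h1 h2])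
  exact LinearMap.congr_fun this z

lemma coeff_nil_treeCop (c : Bool) (t : BinaryTree ι) : coeff .nil (treeCop g c t) =
    match t, c with
    | .nil, true => 0
    | .nil, false => word []
    | .node _ _ _, false => 0
    | .node i l r, true => treeEval g (.node i l r) := by
  cases t <;> cases c <;> simp [treeCop, coeff_nil_graftMul]

lemma coeff_node_treeCop (c : Bool) (i : ι) (l r l' r' : BinaryTree ι) :
    coeff (.node i l' r') (treeCop g c (.node i l r)) =
      gmul (coeff l' (treeCop g c l)) (coeff r' (treeCop g false r + treeCop g true r)) := by
  classical
  cases c <;> simp [treeCop, coeff_node_graftMul]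

lemma coeff_node_treeCop_of_ne (c : Bool) {i j : ι} (h : j ≠ i) (l r l' r' : BinaryTree ι) :
    coeff (.node j l' r') (treeCop g c (.node i l r)) = 0 := by
  classical
  cases c <;> simp [treeCop, coeff_node_graftMul, h]

lemma coeff_node_treeCop_nil (c : Bool) (j : ι) (l' r' : BinaryTree ι) :
    coeff (.node j l' r') (treeCop g c .nil) = 0 := by
  cases c <;> simp [treeCop]

/-- The trees with a nonempty left subtree do not occur in a linear relation: they are detected by
the cuts with the entry `1` in the right part. -/
lemma apply_node_eq_zero_of_left {N : ℕ} (h : IndepLE g N) (hg : ∀ i, g i ∈ gradedPermsPlus)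
    (h1 : ∀ i, dprec (g i) = 0) (h2 : ∀ i, dsucc (g i) = 0) {z : BinaryTree ι →₀ ℚ}
    (hz : ∀ t, z t ≠ 0 → t.numNodes ≤ N + 1) (h0 : treeEvalL g z = 0) (i : ι)
    {l : BinaryTree ι} (r : BinaryTree ι) (hl : l ≠ .nil) : z (.node i l r) = 0 := by
  classical
  have hX : ∀ s, coeff s (treeCopL g true z) = 0 := by
    refine h.coeff_eq_zero (fun s hs => ?_) (by rw [treeEvalL_treeCopL hg h1 h2, h0, map_zero])
    rw [coeff_treeCopL, Finsupp.linearCombination_apply, Finsupp.sum]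
    refine Finset.sum_eq_zero fun t ht => ?_
    rw [coeff_treeCop true ((hz t (Finsupp.mem_support_iff.1 ht)).trans hs), if_neg (by simp),
      smul_zero]
  -- descending induction on the number of nodes of the right subtree
  have key : ∀ m : ℕ, ∀ l r : BinaryTree ι, l ≠ .nil → N < r.numNodes + m →
      z (.node i l r) = 0 := by
    intro m
    induction m with
    | zero =>
      intro l r _ hr
      by_contra hne
      have := hz _ hne
      simp only [BinaryTree.numNodes] at this
      omega
    | succ m ih =>
      intro l r hl hr
      have hs := hX (.node i .nil r)
      rw [coeff_treeCopL] at hs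
      refine h.apply_eq_zero (e := fun l => .node i l r)
        (fun a b hab => (BinaryTree.node.inj hab).2.1) {l | l ≠ .nil} (fun k _ hk => ?_) hs
        (fun t ht hne => ?_) (fun k hk _ => ?_) hl
      · have := hz _ hk
        simp only [BinaryTree.numNodes] at this
        omega
      · cases t with
        | nil => exact coeff_node_treeCop_nil _ _ _ _
        | node j l' r' =>
          by_cases hj : i = j
          · subst hj
            rw [coeff_node_treeCop, coeff_nil_treeCop]
            cases l' with
            | nil => simp
            | node j' l'' r'' =>
              rcases lt_or_ge r.numNodes r'.numNodes with hlt | hge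
              · exact absurd (ih _ r' (by simp) (by omega)) ht
              · have hrr : r ≠ r' := fun e =>
                  hne (.node j' l'' r'') (by simp) (by rw [e])
                rw [map_add, coeff_treeCop false hge, coeff_treeCop true hge]
                simp [hrr]
          · exact coeff_node_treeCop_of_ne _ hj _ _ _ _
      · rw [coeff_node_treeCop, coeff_nil_treeCop, map_add, coeff_treeCop false le_rfl,
          coeff_treeCop true le_rfl]
        cases k with
        | nil => exact absurd rfl hk
        | node j l' r' => simp
  exact key (N + 1) l r hl (by omega)

/-- The trees with an empty left subtree and a nonempty right subtree do not occur in a linear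
relation: they are detected by the cuts with the entry `1` in the left part. -/
lemma apply_node_eq_zero_of_right {N : ℕ} (h : IndepLE g N) (hg : ∀ i, g i ∈ gradedPermsPlus)
    (h1 : ∀ i, dprec (g i) = 0) (h2 : ∀ i, dsucc (g i) = 0) {z : BinaryTree ι →₀ ℚ}
    (hz : ∀ t, z t ≠ 0 → t.numNodes ≤ N + 1) (h0 : treeEvalL g z = 0) (i : ι)
    {r : BinaryTree ι} (hr : r ≠ .nil) : z (.node i .nil r) = 0 := by
  classical
  have hc : ∀ s, coeff s (treeCopL g false z - z ⊗ₜ word []) = Finsupp.linearCombination ℚ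
      (fun t => coeff s (treeCop g false t) - if s = t then word [] else 0) z := by
    intro s
    have : coeff s ∘ₗ (treeCopL g false - (TensorProduct.mk ℚ _ _).flip (word [])) =
        Finsupp.linearCombination ℚ
          (fun t => coeff s (treeCop g false t) - if s = t then word [] else 0) := by
      refine Finsupp.lhom_ext' fun t => LinearMap.ext_ring ?_
      by_cases hst : s = t
      · simp [treeCopL, hst]
      · simp [treeCopL, hst]
    exact LinearMap.congr_fun this z
  have hX : ∀ s, coeff s (treeCopL g false z - z ⊗ₜ word []) = 0 := by
    refine h.coeff_eq_zero (fun s hs => ?_) ?_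
    · rw [hc, Finsupp.linearCombination_apply, Finsupp.sum]
      refine Finset.sum_eq_zero fun t ht => ?_
      rw [coeff_treeCop false ((hz t (Finsupp.mem_support_iff.1 ht)).trans hs)]
      simp
    · rw [map_sub, treeEvalL_treeCopL hg h1 h2, h0, map_zero, LinearMap.rTensor_tmul, h0,
        TensorProduct.zero_tmul, sub_zero]
  have hs := hX (.node i .nil .nil)
  rw [hc] at hs
  refine h.apply_eq_zero (e := fun r => .node i .nil r)
    (fun a b hab => (BinaryTree.node.inj hab).2.2) {r | r ≠ .nil} (fun k _ hk => ?_) hs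
    (fun t ht hne => ?_) (fun k hk _ => ?_) hr
  · have := hz _ hk
    simp only [BinaryTree.numNodes] at this
    omega
  · cases t with
    | nil => simp [coeff_node_treeCop_nil]
    | node j l' r' =>
      by_cases hj : i = j
      · subst hj
        cases l' with
        | nil =>
          cases r' with
          | nil => simp [coeff_node_treeCop, coeff_nil_treeCop]
          | node j' l'' r'' => exact absurd rfl (hne (.node j' l'' r'') (by simp))
        | node j' l'' r'' =>
          exact absurd (apply_node_eq_zero_of_left h hg h1 h2 hz h0 i r' (by simp)) ht
      · rw [coeff_node_treeCop_of_ne _ hj, if_neg fun e => hj (BinaryTree.node.inj e).1, sub_zero]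
  · have hk' : ¬ BinaryTree.nil = k := fun e => hk e.symm
    cases k with
    | nil => exact absurd rfl hk
    | node j l' r' => simp [coeff_node_treeCop, coeff_nil_treeCop]

/-- The evaluations of the trees in linearly independent primitive elements are linearly
independent. -/
lemma indepLE (hg : ∀ i, g i ∈ gradedPermsPlus) (h1 : ∀ i, dprec (g i) = 0)
    (h2 : ∀ i, dsucc (g i) = 0) (hli : LinearIndependent ℚ g) (N : ℕ) : IndepLE g N := by
  classical
  have hnil : ∀ z : BinaryTree ι →₀ ℚ, treeEvalL g z = 0 → z .nil = 0 := by
    intro z hz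
    have : eps ∘ₗ treeEvalL g = Finsupp.lapply BinaryTree.nil := by
      refine Finsupp.lhom_ext' fun t => LinearMap.ext_ring ?_
      cases t with
      | nil => simp
      | node i l r => simp [treeEval_node, eps_prec]
    have := LinearMap.congr_fun this z
    rw [LinearMap.comp_apply, hz, map_zero] at this
    exact this.symm
  induction N with
  | zero =>
    intro z hz h0
    ext t
    by_contra hne
    have := hz t hne
    cases t with
    | nil => exact hne (hnil z h0)
    | node i l r => simp [BinaryTree.numNodes] at this
  | succ N ih =>
    intro z hz h0
    have hs : ∀ t, z t ≠ 0 → ∃ i, BinaryTree.node i .nil .nil = t := by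
      intro t ht
      cases t with
      | nil => exact absurd (hnil z h0) ht
      | node i l r =>
        by_cases hl : l = .nil
        · by_cases hr : r = .nil
          · exact ⟨i, by rw [hl, hr]⟩
          · rw [hl] at ht
            exact absurd (apply_node_eq_zero_of_right ih hg h1 h2 hz h0 i hr) ht
        · exact absurd (apply_node_eq_zero_of_left ih hg h1 h2 hz h0 i r hl) ht
    have h3 := linearCombination_comapDomain_eq_zero (f := g) (q := treeEval g)
      (e := fun i : ι => BinaryTree.node i .nil .nil)
      (fun a b hab => (BinaryTree.node.inj hab).1) Set.univ h0
      (fun t ht hne => by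
        obtain ⟨i, hi⟩ := hs t ht
        exact absurd hi (hne i trivial))
      (fun i _ _ => by simp [treeEval_node, one_succ (hg i), prec_one (hg i)])
    have h4 := linearIndependent_iff.1 hli _ h3
    ext t
    by_contra ht
    obtain ⟨i, rfl⟩ := hs t ht
    have := DFunLike.congr_fun h4 i
    rw [Finsupp.filter_apply, if_pos (Set.mem_univ i)] at this
    exact ht this

lemma treeEvalL_injective (hg : ∀ i, g i ∈ gradedPermsPlus) (h1 : ∀ i, dprec (g i) = 0)
    (h2 : ∀ i, dsucc (g i) = 0) (hli : LinearIndependent ℚ g) {z : BinaryTree ι →₀ ℚ}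
    (hz : treeEvalL g z = 0) : z = 0 :=
  indepLE hg h1 h2 hli (z.support.sup BinaryTree.numNodes) z
    (fun _ ht => Finset.le_sup (Finsupp.mem_support_iff.2 ht)) hz

end TreeIndependence

/-! ### Freeness -/

section Freeness

variable {D : Submodule ℚ (Words Biletter)} {A : Type*} [AddCommGroup A] [Module ℚ A]

/-- In a product, a combination of trees vanishes as soon as its first component does, because the
trees are linearly independent in that component. -/
lemma eq_zero_of_mem_treeSpan {C ι : Type*} [AddCommGroup C] [Module ℚ C]
    {W : UnitalDendriform C} {g : ι → Words Biletter × C} (hg : ∀ i, (g i).1 ∈ gradedPermsPlus)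
    (h1 : ∀ i, dprec (g i).1 = 0) (h2 : ∀ i, dsucc (g i).1 = 0)
    (hli : LinearIndependent ℚ fun i => (g i).1) {x : Words Biletter × C}
    (hx : x ∈ (wordsUnital.prod W).treeSpan g) (h0 : x.1 = 0) : x = 0 := by
  rw [UnitalDendriform.treeSpan, ← Finsupp.range_linearCombination] at hx
  obtain ⟨z, rfl⟩ := hx
  have hz : LinearMap.fst ℚ _ C ∘ₗ
      Finsupp.linearCombination ℚ ((wordsUnital.prod W).eval g) =
      treeEvalL fun i => (g i).1 := by
    refine Finsupp.lhom_ext' fun t => LinearMap.ext_ring ?_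
    simp only [LinearMap.comp_apply, Finsupp.lsingle_apply, treeEvalL_single,
      Finsupp.linearCombination_single, one_smul, LinearMap.fst_apply]
    exact UnitalDendriform.fst_eval_prod _ _ _ t
  rw [treeEvalL_injective hg h1 h2 hli ((LinearMap.congr_fun hz z).symm.trans h0), map_zero]

/-- The graph of the extension of `f`: the span of the nonempty trees in the elements
`(b i, f (b i))`, for a basis `b` of the primitive elements. -/
def graph {ι : Type*} {P : Submodule ℚ (Words Biletter)} (b : Module.Basis ι ℚ P)
    (dA : DendriformAlgebra A) (f : P →ₗ[ℚ] A) : Submodule ℚ (Words Biletter × (ℚ × A)) :=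
  (wordsUnital.prod (UnitalDendriform.ofDendriform dA)).treeSpanPlus
    fun i => ((b i : Words Biletter), ((0 : ℚ), f (b i)))

section Graph

variable {ι : Type*} {P : Submodule ℚ (Words Biletter)} {b : Module.Basis ι ℚ P}
  {dA : DendriformAlgebra A} {f : P →ₗ[ℚ] A}

lemma prec_mem_graph {x y : Words Biletter} {a c : A} (hx : (x, ((0 : ℚ), a)) ∈ graph b dA f)
    (hy : (y, ((0 : ℚ), c)) ∈ graph b dA f) :
    (prec x y, ((0 : ℚ), dA.prec a c)) ∈ graph b dA f := by
  have h := UnitalDendriform.prec_mem_treeSpanPlus hx hy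
  rw [UnitalDendriform.prod_prec, UnitalDendriform.ofDendriform_prec, zero_smul, zero_add] at h
  exact h

lemma succ_mem_graph {x y : Words Biletter} {a c : A} (hx : (x, ((0 : ℚ), a)) ∈ graph b dA f)
    (hy : (y, ((0 : ℚ), c)) ∈ graph b dA f) :
    (succ x y, ((0 : ℚ), dA.succ a c)) ∈ graph b dA f := by
  have h := UnitalDendriform.succ_mem_treeSpanPlus hx hy
  rw [UnitalDendriform.prod_succ, UnitalDendriform.ofDendriform_succ, zero_smul, zero_add] at h
  exact h

lemma mem_graph_fst {x : Words Biletter × (ℚ × A)} (hx : x ∈ graph b dA f) : x.2.1 = 0 := by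
  have : graph b dA f ≤
      LinearMap.ker (LinearMap.fst ℚ ℚ A ∘ₗ LinearMap.snd ℚ (Words Biletter) (ℚ × A)) := by
    refine Submodule.span_le.2 ?_
    rintro _ ⟨i, l, r, rfl⟩
    rw [SetLike.mem_coe, LinearMap.mem_ker, LinearMap.comp_apply, LinearMap.snd_apply,
      LinearMap.fst_apply, UnitalDendriform.eval, UnitalDendriform.prod_prec,
      UnitalDendriform.ofDendriform_prec]
  exact this hx

/-- `graph` is the graph of a function on its projection. -/
lemma eq_zero_of_mem_graph (hP : P ≤ gradedPermsPlus) (h1 : ∀ x ∈ P, dprec x = 0)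
    (h2 : ∀ x ∈ P, dsucc x = 0) {x : Words Biletter × (ℚ × A)} (hx : x ∈ graph b dA f)
    (h0 : x.1 = 0) : x = 0 := by
  have hli : LinearIndependent ℚ fun i => (b i : Words Biletter) :=
    b.linearIndependent.map' P.subtype (Submodule.ker_subtype _)
  have hx' := UnitalDendriform.treeSpanPlus_le _ _ hx
  refine eq_zero_of_mem_treeSpan (g := fun i => ((b i : Words Biletter), ((0 : ℚ), f (b i))))
    ?_ ?_ ?_ ?_ hx' h0
  · exact fun i => hP (b i).2
  · exact fun i => h1 _ (b i).2
  · exact fun i => h2 _ (b i).2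
  · exact hli

lemma mem_graph (hP : P ≤ gradedPermsPlus) (x : P) :
    ((x : Words Biletter), ((0 : ℚ), f x)) ∈ graph b dA f := by
  have hle : Submodule.span ℚ (Set.range b) ≤
      (graph b dA f).comap (P.subtype.prod (LinearMap.prod 0 f)) := by
    refine Submodule.span_le.2 ?_
    rintro _ ⟨i, rfl⟩
    have hbi : (b i : Words Biletter) ∈ gradedPermsPlus := hP (b i).2
    have e : ((b i : Words Biletter), ((0 : ℚ), f (b i))) =
        (wordsUnital.prod (UnitalDendriform.ofDendriform dA)).eval
          (fun i => ((b i : Words Biletter), ((0 : ℚ), f (b i)))) (.node i .nil .nil) := by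
      rw [UnitalDendriform.eval, UnitalDendriform.eval, UnitalDendriform.prod_prec,
        UnitalDendriform.prod_succ, UnitalDendriform.prod_one, UnitalDendriform.ofDendriform_prec,
        UnitalDendriform.ofDendriform_succ, UnitalDendriform.ofDendriform_one]
      refine Prod.ext ?_ (Prod.ext rfl ?_)
      · exact ((congrArg (fun y => prec y (word [])) (one_succ hbi)).trans (prec_one hbi)).symm
      · simp
    exact Submodule.subset_span ⟨i, .nil, .nil, e⟩
  exact hle (b.span_eq ▸ Submodule.mem_top)

end Graph

/-- Every linear map on the primitive elements extends to a morphism of dendriform algebras. -/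
lemma IsStable.exists_lift (h : IsStable D) (dA : DendriformAlgebra A)
    (f : primDend D dprec dsucc →ₗ[ℚ] A) : ∃ F : D →ₗ[ℚ] A,
      (∀ a b c : D, (c : Words Biletter) = prec a b → F c = dA.prec (F a) (F b)) ∧
      (∀ a b c : D, (c : Words Biletter) = succ a b → F c = dA.succ (F a) (F b)) ∧
      ∀ x : primDend D dprec dsucc, F ⟨x, x.2.1⟩ = f x := by
  set Γ := graph (Module.Basis.ofVectorSpace ℚ _) dA f with hΓ
  have hP : primDend D dprec dsucc ≤ gradedPermsPlus := inf_le_left.trans h.le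
  have hex : ∀ x ∈ D, ∃ a : A, (x, ((0 : ℚ), a)) ∈ Γ := by
    have hDΓ : D ≤ Γ.map (LinearMap.fst ℚ (Words Biletter) (ℚ × A)) := by
      refine h.le_of_primDend_le (fun x hx => ⟨_, mem_graph hP ⟨x, hx⟩, rfl⟩) ?_ ?_
      · rintro _ ⟨γ, hγ, rfl⟩ _ ⟨γ', hγ', rfl⟩
        exact ⟨_, UnitalDendriform.prec_mem_treeSpanPlus hγ hγ', rfl⟩
      · rintro _ ⟨γ, hγ, rfl⟩ _ ⟨γ', hγ', rfl⟩
        exact ⟨_, UnitalDendriform.succ_mem_treeSpanPlus hγ hγ', rfl⟩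
    intro x hx
    obtain ⟨⟨y, c, a⟩, hγ, rfl⟩ := hDΓ hx
    obtain rfl : c = 0 := mem_graph_fst hγ
    exact ⟨a, hγ⟩
  choose F hF using fun x : D => hex x x.2
  have huniq : ∀ (x : D) (a : A), ((x : Words Biletter), ((0 : ℚ), a)) ∈ Γ → F x = a := by
    intro x a ha
    have := eq_zero_of_mem_graph hP (fun _ hx => hx.2.1) (fun _ hx => hx.2.2)
      (sub_mem (hF x) ha) (sub_self _)
    exact sub_eq_zero.1 (congrArg (fun γ => γ.2.2) this)
  refine ⟨{ toFun := F
            map_add' := fun x y => huniq _ _ (by simpa using add_mem (hF x) (hF y))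
            map_smul' := fun c x => huniq _ _ (by simpa using Submodule.smul_mem _ c (hF x)) },
    fun a b c hc => huniq _ _ ?_, fun a b c hc => huniq _ _ ?_,
    fun x => huniq _ _ (mem_graph hP x)⟩
  · rw [hc]
    exact prec_mem_graph (hF a) (hF b)
  · rw [hc]
    exact succ_mem_graph (hF a) (hF b)

/-- A morphism of dendriform algebras is determined by its values on the primitive elements. -/
lemma IsStable.hom_ext (h : IsStable D) {dA : DendriformAlgebra A} {F F' : D →ₗ[ℚ] A}
    (hp : ∀ a b c : D, (c : Words Biletter) = prec a b → F c = dA.prec (F a) (F b))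
    (hs : ∀ a b c : D, (c : Words Biletter) = succ a b → F c = dA.succ (F a) (F b))
    (hp' : ∀ a b c : D, (c : Words Biletter) = prec a b → F' c = dA.prec (F' a) (F' b))
    (hs' : ∀ a b c : D, (c : Words Biletter) = succ a b → F' c = dA.succ (F' a) (F' b))
    (hx : ∀ x : primDend D dprec dsucc, F ⟨x, x.2.1⟩ = F' ⟨x, x.2.1⟩) : F = F' := by
  have hD : D ≤ (LinearMap.eqLocus F F').map D.subtype := by
    refine h.le_of_primDend_le (fun x hxP => ⟨⟨x, hxP.1⟩, hx ⟨x, hxP⟩, rfl⟩) ?_ ?_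
    · rintro _ ⟨a, ha, rfl⟩ _ ⟨c, hc, rfl⟩
      refine ⟨⟨prec a c, h.prec_mem _ a.2 _ c.2⟩, ?_, rfl⟩
      rw [SetLike.mem_coe, LinearMap.mem_eqLocus] at ha hc ⊢
      rw [hp a c _ rfl, hp' a c _ rfl, ha, hc]
    · rintro _ ⟨a, ha, rfl⟩ _ ⟨c, hc, rfl⟩
      refine ⟨⟨succ a c, h.succ_mem _ a.2 _ c.2⟩, ?_, rfl⟩
      rw [SetLike.mem_coe, LinearMap.mem_eqLocus] at ha hc ⊢
      rw [hs a c _ rfl, hs' a c _ rfl, ha, hc]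
  ext x
  obtain ⟨y, hy, hyx⟩ := hD x.2
  rw [← Subtype.ext hyx]
  exact hy

/-- A stable subspace is a free dendriform algebra over its primitive elements. -/
lemma IsStable.isFreeDendriformOn (h : IsStable D) :
    IsFreeDendriformOn.{u} D (primDend D dprec dsucc) prec succ where
  prec_mem := h.prec_mem
  succ_mem := h.succ_mem
  prec_prec a _ _ hb c _ := prec_prec_of_mem a c (h.le hb)
  succ_prec a _ b _ c _ := succ_prec a b c
  succ_succ _ ha b _ c _ := succ_succ_of_mem b c (h.le ha)
  le := inf_le_left
  existsUnique_lift A _ _ dA f := by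
    obtain ⟨F, hp, hs, hx⟩ := h.exists_lift dA f
    exact ⟨F, ⟨hp, hs, hx⟩, fun F' hF' => h.hom_ext hF'.1 hF'.2.1 hp hs fun x =>
      (hF'.2.2 x).trans (hx x).symm⟩

end Freeness

end GradedPerm

end

theorem mainTheorem3 :
    -- `S` is realized in `End(Sh(X))` as a dendriform subalgebra, so that `p_n` is the projection
    -- on the words of weight `n` and `Descd` is generated by these projections
    (∀ (X : Type v) (wt : X → ℕ+),
      ((∀ n, {x | wt x = n}.Infinite) →
        Set.InjOn (GradedPerm.toEnd wt) (GradedPerm.gradedPerms : Set _)) ∧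
      (∀ a ∈ GradedPerm.gradedPerms, ∀ b ∈ GradedPerm.gradedPerms,
        GradedPerm.toEnd wt (GradedPerm.prec a b) =
          GradedPerm.convPrec (GradedPerm.toEnd wt a) (GradedPerm.toEnd wt b) ∧
        GradedPerm.toEnd wt (GradedPerm.succ a b) =
          GradedPerm.convSucc (GradedPerm.toEnd wt a) (GradedPerm.toEnd wt b)) ∧
      (∀ n, GradedPerm.toEnd wt (GradedPerm.p n) = GradedPerm.weightProj wt n) ∧
      GradedPerm.descd.map (GradedPerm.toEnd wt) =
        GradedPerm.dendClosure GradedPerm.convPrec GradedPerm.convSucc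
          (Set.range (GradedPerm.weightProj wt))) ∧
    -- `Descd ⊆ S`, and the augmentation ideal of `Descd` is generated by the `p_n` with `n ≥ 1`
    GradedPerm.descd ≤ GradedPerm.gradedPerms ∧
    GradedPerm.descd = Submodule.span ℚ {GradedPerm.p 0} ⊔ GradedPerm.descdPlus ∧
    GradedPerm.descdPlus = GradedPerm.dendClosure (fun a b => GradedPerm.prec a b)
      (fun a b => GradedPerm.succ a b) {x | ∃ n, 1 ≤ n ∧ x = GradedPerm.p n} ∧
    -- the half-coproducts of `p_n`
    (∀ n, 1 ≤ n → GradedPerm.dsucc (GradedPerm.p n) = 0 ∧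
      GradedPerm.dprec (GradedPerm.p n) =
        ∑ i ∈ Finset.Ico 1 n, GradedPerm.p i ⊗ₜ[ℚ] GradedPerm.p (n - i)) ∧
    -- `S` is a bidendriform bialgebra and `Descd` is a sub-bidendriform bialgebra of it
    GradedPerm.IsBidendriformOp GradedPerm.gradedPermsPlus ∧
    GradedPerm.IsBidendriformOp GradedPerm.descdPlus ∧
    -- `Descd` is a free dendriform algebra over its dendriform primitive elements
    GradedPerm.IsFreeDendriformOn.{u} GradedPerm.descdPlus
      (GradedPerm.primDend GradedPerm.descdPlus GradedPerm.dprec GradedPerm.dsucc)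
      GradedPerm.prec GradedPerm.succ := by
  open GradedPerm in
  exact ⟨fun X wt => ⟨toEnd_injOn, fun a ha b hb => ⟨toEnd_prec ha hb, toEnd_succ ha hb⟩, toEnd_p,
      map_descd⟩, descd_le, descd_eq, descdPlus_eq, fun n _ => ⟨dsucc_p n, dprec_p n⟩,
    isStable_gradedPermsPlus.isBidendriformOp, isStable_descdPlus.isBidendriformOp,
    isStable_descdPlus.isFreeDendriformOn⟩
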